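/- **Theorem (Observable estimation via extrapolation).** Setting. Let $L_1,\dots,L_m$ be Lindblad generators on a finite-dimensional Hilbert space (each of the form $X\mapsto -i[H,X]+\sum_\nu(L_\nu XL_\nu^\dagger-\tfrac12\{L_\nu^\dagger L_\nu,X\})$ with $H$ Hermitian; in particular single coherent terms and single dissipators are allowed), $\mathcal L=\sum_{j=1}^m L_j$, and let $$\mathcal S(\tau)=\big(e^{\tau L_m/2}\cdots e^{\tau L_1/2}\big)\big(e^{\tau L_1/2}\cdots e^{\tau L_m/2}\big)$$ be the second-order product formula; one application of $\mathcal S(\tau)$ is one Trotter step. Write $[A_1,\dots,A_q]=[A_1,[A_2,\dots,[A_{q-1},A_q]\cdots]]$, let $\|\cdot\|_\diamond$ be the diamond norm, and put $$\alpha^{(q)}_{\rm comm}=\sum_{j_1,\dots,j_q=1}^m\|[L_{j_1},\dots,L_{j_q}]\|_\diamond,\qquad \alpha^{(q_1,\dots,q_d)}_{\rm comm}=\sum_{j_{1,1},\dots,j_{d,q_d}=1}^m\big\|\big[[L_{j_{1,1}},\dots,L_{j_{1,q_1}}],\dots,[L_{j_{d,1}},\dots,L_{j_{d,q_d}}]\big]\big\|_\diamond,$$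 $$\mu_{\mathrm{comm},q_0}=\max_{q=3,5,\dots\le q_0}\big(\alpha^{(q)}_{\rm comm}\big)^{1/q}\ (=0\text{ if }q_0<3),\qquad \alpha_{\mathrm{comm},q_0}(\tau)=\sum_{d\ge1}\frac1{d!}\sum_{\substack{1\le q_1,\dots,q_d\le q_0\\ q_1+\cdots+q_d\ge q_0+1}}\alpha_{\rm comm}^{(q_1,\dots,q_d)}\tau^{q_1+\cdots+q_d}.$$ For $p\ge2$ and $j=1,\dots,p$ let $r_j=\Big\lceil\frac{\sqrt8\,p}{\pi\sin(\pi(2j-1)/(8p))}\Big\rceil$, $b_j=\prod_{\ell\ne j}\frac1{1-r_\ell^2/r_j^2}$ and $\|b\|_1=\sum_{j=1}^p|b_j|$. Statement. There is an absolute constant $C>0$ with $\|b\|_1\le C\log p$ for all $p\ge2$, and an absolute constant $K>0$, such that the following holds for every system as above, every integer $q_0\ge1$, time $t>0$, precision $\varepsilon\in(0,1)$, observable $O$ (Hermitian) and initial state $\rho_0$. Let $p$ be the smallest integer $p\ge2$ with $e^{-2p}\le\varepsilon/(8C\log p)$. Then $p$ exists and $p\le K(1+\log(1/\varepsilon))$.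 Call $s_0$ with $1/s_0\in\mathbb Z_{>0}$ admissible if $s_p=s_0/r_p$ satisfies $$s_p\,(2\mu_{\mathrm{comm},q_0}t)^{3/2}\le e^{-1},\qquad \alpha_{\mathrm{comm},q_0}(s_pt)\le\frac{s_p\,\varepsilon}{4eC\log p}.$$ Then there is a largest admissible $s_0$. Moreover, for every admissible $s_0$, put $s_j=s_0/r_j$ and $S=\lceil4\|b\|_1^2\varepsilon^{-2}\log(3p)\rceil$, and for each $i=1,\dots,p$ perform $S$ independent circuit runs, each of which applies $\mathcal S(s_it)$ exactly $1/s_i$ times to $\rho_0$ and then measures $O$, with outcomes $\mu_{i,1},\dots,\mu_{i,S}$ (so that $\mathbb E\,\mu_{i,j}=f(s_i)$ with $f(s)=\mathrm{Tr}[O\,\mathcal S(st)^{1/s}\rho_0]$). Then: 1. with probability at least $2/3$, $\Big|\sum_{i=1}^p b_i\,\frac1S\sum_{j=1}^S\mu_{i,j}-\mathrm{Tr}[O\,e^{t\mathcal L}\rho_0]\Big|\le\varepsilon\|O\|$, where $\|O\|$ is the operator norm; 2. with $\Lambda=1+\log(1/\varepsilon)$, the number of circuit runs is $pS\le K\,\Lambda\,(1+\log\Lambda)^3/\varepsilon^2=\widetilde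 O(1/\varepsilon^2)$; 3. each run uses at most $K\,\Lambda/s_p=\widetilde O(1/s_p)$ Trotter steps; 4. the total number of Trotter steps is $S\sum_{j=1}^p1/s_j\le K\,\Lambda\,(1+\log\Lambda)^4/(\varepsilon^2s_p)$. -/

import Mathlib

noncomputable section

namespace Lindblad

open scoped BigOperators ENNReal ComplexOrder

section Superoperators

variable {ι : Type} [Fintype ι] [DecidableEq ι]

/-- Superoperators: linear maps on the operators of the finite-dimensional Hilbert space `ℂ^ι`. -/
abbrev Superop (ι : Type) : Type := Module.End ℂ (Matrix ι ι ℂ)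

/-- The operator (spectral) norm of a matrix acting on the Euclidean space `ℂ^ι`. -/
def opNorm (A : Matrix ι ι ℂ) : ℝ := ‖Matrix.toEuclideanCLM (n := ι) (𝕜 := ℂ) A‖

/-- The trace norm `‖X‖₁ = Tr √(X† X)`, i.e. the sum of the singular values of `X`. -/
def traceNorm (X : Matrix ι ι ℂ) : ℝ :=
  ∑ i, Real.sqrt ((Matrix.isHermitian_conjTranspose_mul_self X).eigenvalues i)

/-- The action of `Φ ⊗ id` on operators of `ℂ^ι ⊗ ℂ^ι`. -/
def ampliation (Φ : Superop ι) (X : Matrix (ι × ι) (ι × ι) ℂ) : Matrix (ι × ι) (ι × ι) ℂ :=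
  Matrix.of fun a b => Φ (Matrix.of fun c d => X (c, a.2) (d, b.2)) a.1 b.1

/-- The diamond norm `‖Φ‖_⋄ = sup { ‖(Φ ⊗ id)(X)‖₁ : ‖X‖₁ ≤ 1 }`, with an ancilla that is a copy of
the system (larger ancillas do not increase the value). The set is nonempty and bounded. -/
def diamondNorm (Φ : Superop ι) : ℝ :=
  sSup {c : ℝ | ∃ X : Matrix (ι × ι) (ι × ι) ℂ, traceNorm X ≤ 1 ∧ c = traceNorm (ampliation Φ X)}

/-- Lindblad generators:
`X ↦ -i[H, X] + ∑_ν (L_ν X L_ν† - (1/2){L_ν† L_ν, X})` with `H` Hermitian and finitely many jump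
operators `L_ν`. Single coherent terms (no jump operator) and single dissipators (`H = 0`) are
instances. -/
def IsLindbladian (Φ : Superop ι) : Prop :=
  ∃ (H : Matrix ι ι ℂ) (k : ℕ) (J : Fin k → Matrix ι ι ℂ), H.IsHermitian ∧
    ∀ X : Matrix ι ι ℂ, Φ X = -Complex.I • (H * X - X * H) +
      ∑ ν, (J ν * X * (J ν).conjTranspose
        - (1 / 2 : ℂ) • ((J ν).conjTranspose * J ν * X + X * ((J ν).conjTranspose * J ν)))

/-- The exponential `e^Φ = ∑ₖ Φᵏ / k!` of a superoperator, computed as the matrix exponential in the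
basis of matrix units. -/
def superExp (Φ : Superop ι) : Superop ι :=
  (LinearMap.toMatrixAlgEquiv (Matrix.stdBasis ℂ ι ι)).symm
    (NormedSpace.exp (LinearMap.toMatrixAlgEquiv (Matrix.stdBasis ℂ ι ι) Φ))

/-- The second-order product formula
`S(τ) = (e^{τ L_m/2} ⋯ e^{τ L_1/2}) (e^{τ L_1/2} ⋯ e^{τ L_m/2})`. -/
def productFormula {m : ℕ} (L : Fin m → Superop ι) (τ : ℝ) : Superop ι :=
  (List.ofFn fun j => superExp (((τ / 2 : ℝ) : ℂ) • L j)).reverse.prod *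
    (List.ofFn fun j => superExp (((τ / 2 : ℝ) : ℂ) • L j)).prod

/-- The right-nested commutator `[A₁, …, A_q] = [A₁, [A₂, …, [A_{q-1}, A_q] ⋯ ]]`
(for `q = 1` it is `A₁`). -/
def nestedComm : List (Superop ι) → Superop ι
  | [] => 0
  | [A] => A
  | A :: B :: l => A * nestedComm (B :: l) - nestedComm (B :: l) * A

/-- `α_comm^{(q₁,…,q_d)}`: the sum over all index tuples of the diamond norms of the doubly
right-nested commutators `[[L_{j₁₁}, …, L_{j₁q₁}], …, [L_{j_d1}, …, L_{j_dq_d}]]`. -/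
def alphaComm {m : ℕ} (L : Fin m → Superop ι) {d : ℕ} (q : Fin d → ℕ) : ℝ :=
  ∑ j : (a : Fin d) → Fin (q a) → Fin m,
    diamondNorm (nestedComm (List.ofFn fun a => nestedComm (List.ofFn fun b => L (j a b))))

/-- `α_comm^{(q)}`: the sum of the diamond norms of the grade-`q` right-nested commutators. -/
def alphaGrade {m : ℕ} (L : Fin m → Superop ι) (q : ℕ) : ℝ :=
  ∑ j : Fin q → Fin m, diamondNorm (nestedComm (List.ofFn fun b => L (j b)))

/-- `α_{comm,q₀}(τ) = ∑_{d ≥ 1} (1/d!) ∑_{1 ≤ q₁,…,q_d ≤ q₀, q₁+⋯+q_d ≥ q₀+1}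
α_comm^{(q₁,…,q_d)} τ^{q₁+⋯+q_d}`. The term `d = 0` is an empty sum, and the series converges for
every `τ`. -/
def alphaTrunc {m : ℕ} (L : Fin m → Superop ι) (q₀ : ℕ) (τ : ℝ) : ℝ :=
  ∑' d : ℕ, (1 / (d.factorial : ℝ)) *
    ∑ q ∈ (Fintype.piFinset fun _ : Fin d => Finset.Icc 1 q₀) with q₀ + 1 ≤ ∑ a, q a,
      alphaComm L q * τ ^ (∑ a, q a)

/-- `μ_{comm,q₀} = max_{q = 3, 5, … ≤ q₀} (α_comm^{(q)})^{1/q}`, which is `0` if `q₀ < 3`. -/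
def muComm {m : ℕ} (L : Fin m → Superop ι) (q₀ : ℕ) : ℝ :=
  sSup {x : ℝ | ∃ q : ℕ, 3 ≤ q ∧ q ≤ q₀ ∧ Odd q ∧ x = alphaGrade L q ^ (1 / (q : ℝ))}

/-- Density matrices. -/
def IsDensity (ρ : Matrix ι ι ℂ) : Prop := ρ.PosSemidef ∧ ρ.trace = 1

/-- The law of the outcome of a projective measurement of the observable `O` in the state `ρ`
(Born rule): the eigenvalue `λ_k` is observed with probability `⟨u_k, ρ u_k⟩`, where `u_k` is an
orthonormal eigenbasis of `O` (coinciding eigenvalues add up). -/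
def measurementLaw {O : Matrix ι ι ℂ} (hO : O.IsHermitian) (ρ : Matrix ι ι ℂ) :
    MeasureTheory.Measure ℝ :=
  ∑ k, ENNReal.ofReal
      (star ⇑(hO.eigenvectorBasis k) ⬝ᵥ ρ.mulVec ⇑(hO.eigenvectorBasis k)).re •
    MeasureTheory.Measure.dirac (hO.eigenvalues k)

end Superoperators

section Richardson

/-- The repetition numbers `r_j = ⌈√8 p / (π sin(π (2j-1) / (8p)))⌉`, `j = 1, …, p`. -/
def repNum (p j : ℕ) : ℕ :=
  ⌈Real.sqrt 8 * p / (Real.pi * Real.sin (Real.pi * (2 * (j : ℝ) - 1) / (8 * p)))⌉₊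

/-- The Richardson coefficients `b_j = ∏_{l ≠ j} 1 / (1 - r_l² / r_j²)`, `j = 1, …, p`. -/
def richCoeff (p j : ℕ) : ℝ :=
  ∏ l ∈ (Finset.Icc 1 p).erase j, 1 / (1 - (repNum p l : ℝ) ^ 2 / (repNum p j : ℝ) ^ 2)

/-- `‖b‖₁`. -/
def richNorm (p : ℕ) : ℝ := ∑ j ∈ Finset.Icc 1 p, |richCoeff p j|

/-- `p` is the smallest integer (at least `2`, so that `log p > 0`) with
`e^{-2p} ≤ ε / (8 C log p)`. -/
def IsExtrapolationOrder (C ε : ℝ) (p : ℕ) : Prop :=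
  IsLeast {p' : ℕ | 2 ≤ p' ∧ Real.exp (-2 * p') ≤ ε / (8 * C * Real.log p')} p

/-- With `s₀ = 1/k`, the step sizes are `s_j = s₀ / r_j`; a run with step size `s_j` applies
`1 / s_j = k r_j` Trotter steps. -/
def numSteps (p k j : ℕ) : ℕ := k * repNum p j

/-- The maximal step size `s_p = s₀ / r_p`, where `s₀ = 1/k`. -/
def maxStep (p k : ℕ) : ℝ := 1 / (k : ℝ) / (repNum p p : ℝ)

/-- The number of runs per step size, `⌈4 (‖b‖₁² / ε²) log(3p)⌉`. -/
def shots (p : ℕ) (ε : ℝ) : ℕ := ⌈4 * (richNorm p ^ 2 / ε ^ 2) * Real.log (3 * p)⌉₊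

/-- The total number of circuit runs. -/
def totalRuns (p : ℕ) (ε : ℝ) : ℕ := p * shots p ε

/-- The total number of Trotter steps over all circuit runs. -/
def totalSteps (p k : ℕ) (ε : ℝ) : ℕ := ∑ j ∈ Finset.Icc 1 p, shots p ε * numSteps p k j

/-- The estimate `∑_i b_i (1/S) ∑_j μ_{i,j}` computed from the outcomes `μ_{i,j}` of `S` runs for
each of the `p` step sizes. -/
def estimate (p S : ℕ) (μ : Fin p × Fin S → ℝ) : ℝ :=
  ∑ i : Fin p, richCoeff p (i + 1) * ((∑ j : Fin S, μ (i, j)) / S)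

end Richardson

section Algorithm

variable {ι : Type} [Fintype ι] [DecidableEq ι] {m : ℕ}

/-- The conditions on `s₀ = 1/k`, `k` a positive integer, in terms of `s_p = s₀ / r_p`:
`s_p ≤ e⁻¹ (2 μ_{comm,q₀} t)^{-3/2}` (no condition if `μ_{comm,q₀} = 0`) and
`α_{comm,q₀}(s_p t) ≤ s_p ε / (4 e C log p)`. -/
def Admissible (C : ℝ) (L : Fin m → Superop ι) (q₀ : ℕ) (t ε : ℝ) (p k : ℕ) : Prop :=
  1 ≤ k ∧
  maxStep p k * (2 * muComm L q₀ * t) ^ (3 / 2 : ℝ) ≤ Real.exp (-1) ∧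
  alphaTrunc L q₀ (maxStep p k * t) ≤ maxStep p k * ε / (4 * Real.exp 1 * C * Real.log p)

/-- The state `S(st)^{1/s} ρ₀` for `s = 1/N`, produced by `N` Trotter steps. -/
def trotterState (L : Fin m → Superop ι) (t : ℝ) (N : ℕ) (ρ₀ : Matrix ι ι ℂ) : Matrix ι ι ℂ :=
  (productFormula L (t / N) ^ N) ρ₀

/-- The joint law of the outcomes of all the runs: they are independent, and the run `(i, j)`
measures `O` in the state `S(s_i t)^{1/s_i} ρ₀`. -/
def outcomeLaw (L : Fin m → Superop ι) (t : ℝ) {O : Matrix ι ι ℂ} (hO : O.IsHermitian)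
    (ρ₀ : Matrix ι ι ℂ) (p k S : ℕ) : MeasureTheory.Measure (Fin p × Fin S → ℝ) :=
  MeasureTheory.Measure.pi fun ij =>
    measurementLaw hO (trotterState L t (numSteps p k (ij.1 + 1)) ρ₀)

end Algorithm

end Lindblad

end

/-!
The estimate has two errors. The statistical one is controlled by Chebyshev's inequality: the state
after any number of Trotter steps is a state, so each outcome has variance at most `‖O‖²`, and the
number of runs is chosen so that the deviation is at most `3ε/4 ‖O‖` with probability `2/3`
(`estimate_deviation`). The rest of the argument bounds the bias of Richardson extrapolation by
`ε/4 ‖O‖` (`norm_bias_le`).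

*The setting.* The map `amp` sends a superoperator `Φ` to `Φ ⊗ id`, as a bounded operator on
matrices with the trace norm. It is a homomorphism of algebras with `diamondNorm Φ = ‖amp Φ‖`, so
that the whole analysis of product formulas takes place in a Banach algebra. All that is used of
Lindblad generators there is that they are dissipative, `‖1 + hΦ‖ ≤ 1 + O(h²)` for `h ≥ 0`
(`IsLindbladian.dissipative`): up to `O(h²)`, `1 + hΦ` is a trace-preserving map in Kraus form.
Semigroups of dissipative elements are contractions, and perturbations of them obey Grönwall's
inequality.

*The effective generator.* The product formula is `U = ∏ e^{τ A_j / 2}` over a palindromic list of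
letters. Its formal logarithm is odd in `τ`, and the coefficient of `τ^q` is a linear combination of
right-nested commutators of `q` letters with coefficients of absolute value at most `1`
(`exists_log_coeff`). For the bound, advance one stage at a time: along a stage of letter `j`, the
logarithm `Ω` satisfies `Ω' = ∫₀¹ (1 + v (Ad_U - 1))⁻¹ (τ A_j / 2) dv`, as
`log (1 + V) / V = ∫₀¹ (1 + vV)⁻¹ dv`. The resolvent `Z = (1 + v (Ad_U - 1))⁻¹` satisfies a Riccati
equation, and comparing its word coefficients with the product over the letters of the time spent on
each of them shows that the former are dominated by the latter, which is at most `1` since every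
letter occurs twice with weight `1/2`.

Truncate `Ω` at grade `q₀`. The exponential of the truncation solves the differential equation of a
stage up to the commutators of total grade above `q₀`, by the formula for the derivative of the
exponential. Grönwall's inequality over all stages bounds the distance of this exponential from
`S(τ)` by `e^{α(τ)} - 1`, where `α` is the series `alphaTrunc` (`exists_odd_generator`).

*Extrapolation.* Hence `S(st)^{1/s}` is, up to a controlled error, the value at `w = s²` of
`exp (effGen w)`, where `effGen` is a polynomial in `w` with the exact generator as its value at
`w = 0`. The condition on `s_p` says that on the circle of radius `(e s_p)²` the perturbation of the
exact generator is at most `1/4` (`norm_effGen_sub_le`), so that this entire function is bounded by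
a constant there. The Richardson coefficients are the Lagrange weights for evaluation at `w = 0`
from the nodes `w = s_j²`; they annihilate `w, …, w^{p-1}`, and Cauchy's estimates leave a remainder
of order `‖b‖₁ e^{-2p}` (`norm_extrapolation_bias_le`).

*The Richardson coefficients.* The bound `‖b‖₁ ≤ C log p` follows from `|b_j| ≤ const / (2j - 1)`
(`abs_richCoeff_le`). If the nodes `sin θ_j` are replaced by the linear nodes `2j - 1`, the
coefficients have a closed form in binomial coefficients (`prod_linear_nodes`), at most
`const · e^{-j²/p} / (2j - 1)`. The sine and the rounding of the `r_j` to integers change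
the product by at most `exp (0.97 j²/p + const)`, which the Gaussian factor absorbs.
-/

noncomputable section

namespace Lindblad

section

open PowerSeries Finset

/-! ### Functional calculus of noncommutative power series -/

section SeriesEval

variable {R : Type*} [Ring R] [Algebra ℝ R]

omit [Algebra ℝ R] in
lemma coeff_pow_of_lt {P : R⟦X⟧} (hP : constantCoeff P = 0) {n k : ℕ} (h : n < k) :
    coeff n (P ^ k) = 0 := by
  induction k generalizing n with
  | zero => omega
  | succ k ih =>
    rw [pow_succ', coeff_mul]
    refine sum_eq_zero fun p hp => ?_
    rw [HasAntidiagonal.mem_antidiagonal] at hp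
    rcases Nat.eq_zero_or_pos p.1 with h0 | h0
    · rw [h0, coeff_zero_eq_constantCoeff_apply, hP, zero_mul]
    · rw [ih (by omega), mul_zero]

/-- The value `∑ₖ fₖ Pᵏ` of a real power series `f` at a series `P` without constant term, over a
possibly noncommutative coefficient ring. The truncation of the sum is harmless because
`Pᵏ` has order at least `k`. -/
def seriesEval (f : ℝ⟦X⟧) (P : R⟦X⟧) : R⟦X⟧ :=
  mk fun n => ∑ k ∈ range (n + 1), coeff k f • coeff n (P ^ k)

lemma coeff_seriesEval (f : ℝ⟦X⟧) {P : R⟦X⟧} (hP : constantCoeff P = 0) {n N : ℕ} (h : n < N) :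
    coeff n (seriesEval f P) = ∑ k ∈ range N, coeff k f • coeff n (P ^ k) := by
  rw [seriesEval, coeff_mk]
  refine sum_subset (range_subset_range.2 (by omega)) fun k _ hk => ?_
  rw [coeff_pow_of_lt hP (by simpa using hk), smul_zero]

lemma coeff_aeval (p : Polynomial ℝ) {P : R⟦X⟧} (hP : constantCoeff P = 0) {n N : ℕ}
    (h : n < N) : coeff n (Polynomial.aeval P p) =
      ∑ k ∈ range N, p.coeff k • coeff n (P ^ k) := by
  have hc : ∀ (r : ℝ) (Q : R⟦X⟧), coeff n (r • Q) = r • coeff n Q := fun _ _ => rfl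
  rw [Polynomial.aeval_eq_sum_range' (n := max N (p.natDegree + 1)) (by omega), map_sum]
  simp only [hc]
  symm
  refine sum_subset (range_subset_range.2 (le_max_left _ _)) fun k _ hk => ?_
  rw [coeff_pow_of_lt hP (lt_of_lt_of_le h (by simpa using hk)), smul_zero]

lemma seriesEval_mul (f g : ℝ⟦X⟧) {P : R⟦X⟧} (hP : constantCoeff P = 0) :
    seriesEval (f * g) P = seriesEval f P * seriesEval g P := by
  have key : ∀ (f : ℝ⟦X⟧) {i n : ℕ}, i ≤ n →
      coeff i (seriesEval f P) = coeff i (Polynomial.aeval P (trunc (n + 1) f)) := by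
    intro f i n hi
    rw [coeff_seriesEval f hP (Nat.lt_succ_of_le hi), coeff_aeval _ hP (Nat.lt_succ_of_le hi)]
    refine sum_congr rfl fun k hk => ?_
    rw [coeff_trunc, if_pos (by simpa using hk)]
  ext n
  rw [coeff_mul]
  have : ∑ p ∈ antidiagonal n, coeff p.1 (seriesEval f P) * coeff p.2 (seriesEval g P) =
      coeff n (Polynomial.aeval P (trunc (n + 1) f * trunc (n + 1) g)) := by
    rw [map_mul, coeff_mul]
    refine sum_congr rfl fun p hp => ?_
    rw [HasAntidiagonal.mem_antidiagonal] at hp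
    rw [key f (by omega : p.1 ≤ n), key g (by omega : p.2 ≤ n)]
  rw [this, coeff_seriesEval _ hP n.lt_succ_self, coeff_aeval _ hP n.lt_succ_self]
  refine sum_congr rfl fun k hk => ?_
  rw [coeff_mul_eq_coeff_trunc_mul_trunc f g (by simpa using hk : k < n + 1), ← Polynomial.coeff_coe,
    Polynomial.coe_mul]

lemma seriesEval_add (f g : ℝ⟦X⟧) (P : R⟦X⟧) :
    seriesEval (f + g) P = seriesEval f P + seriesEval g P := by
  ext n; simp [seriesEval, add_smul, sum_add_distrib]

lemma seriesEval_sub (f g : ℝ⟦X⟧) (P : R⟦X⟧) :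
    seriesEval (f - g) P = seriesEval f P - seriesEval g P := by
  ext n; simp [seriesEval, sub_smul, sum_sub_distrib]

lemma seriesEval_one (P : R⟦X⟧) : seriesEval 1 P = 1 := by
  ext n
  simp [seriesEval, PowerSeries.coeff_one]

lemma seriesEval_X {P : R⟦X⟧} (hP : constantCoeff P = 0) : seriesEval X P = P := by
  ext n
  rw [coeff_seriesEval X hP (by omega : n < n + 2)]
  simp [PowerSeries.coeff_X]

lemma seriesEval_pow (f : ℝ⟦X⟧) {P : R⟦X⟧} (hP : constantCoeff P = 0) (k : ℕ) :
    seriesEval (f ^ k) P = seriesEval f P ^ k := by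
  induction k with
  | zero => simp [seriesEval_one]
  | succ k ih => rw [pow_succ, pow_succ, seriesEval_mul _ _ hP, ih]

lemma constantCoeff_seriesEval (f : ℝ⟦X⟧) (P : R⟦X⟧) :
    constantCoeff (seriesEval f P) = constantCoeff f • (1 : R) := by
  rw [← coeff_zero_eq_constantCoeff_apply, seriesEval, coeff_mk]
  simp

/-- Functional calculus is compatible with composition of power series. -/
lemma seriesEval_subst (f : ℝ⟦X⟧) {g : ℝ⟦X⟧} (hg : constantCoeff g = 0) {P : R⟦X⟧}
    (hP : constantCoeff P = 0) :
    seriesEval (f.subst g) P = seriesEval f (seriesEval g P) := by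
  have hgP : constantCoeff (seriesEval g P) = 0 := by
    rw [constantCoeff_seriesEval, hg, zero_smul]
  have hs : ∀ {r N : ℕ}, r < N →
      coeff r (f.subst g) = ∑ k ∈ range N, coeff k f * coeff r (g ^ k) := by
    intro r N hr
    rw [coeff_subst' (HasSubst.of_constantCoeff_zero' hg), finsum_eq_sum_of_support_subset
      (s := range N)]
    · rfl
    · intro k hk
      by_contra hk'
      refine hk ?_
      have : r < k := lt_of_lt_of_le hr (by simpa using hk')
      simp [coeff_pow_of_lt hg this]
  ext n
  rw [coeff_seriesEval _ hP n.lt_succ_self, coeff_seriesEval _ hgP n.lt_succ_self]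
  have h1 : ∀ k, coeff n (seriesEval g P ^ k) =
      ∑ r ∈ range (n + 1), coeff r (g ^ k) • coeff n (P ^ r) := fun k => by
    rw [← seriesEval_pow g hP, coeff_seriesEval _ hP n.lt_succ_self]
  simp only [h1, smul_sum]
  rw [sum_comm]
  refine sum_congr rfl fun r hr => ?_
  rw [hs (by simpa using hr : r < n + 1), sum_smul]
  exact sum_congr rfl fun k _ => mul_smul _ _ _

/-- `e^P` for a series `P` without constant term. -/
abbrev fexp (P : R⟦X⟧) : R⟦X⟧ := seriesEval (PowerSeries.exp ℝ) P

/-- `log U` for a series `U` with constant term `1`. -/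
abbrev flog (U : R⟦X⟧) : R⟦X⟧ := seriesEval (PowerSeries.log ℝ) (U - 1)

/-- The series `log (1 + X) / X = ∑ₖ (-1)ᵏ Xᵏ / (k + 1)`. -/
def logQuot : ℝ⟦X⟧ := mk fun k => (-1) ^ k / (k + 1 : ℝ)

/-- The series `(e^X - 1) / X = ∑ₖ Xᵏ / (k + 1)!`. -/
def expQuot : ℝ⟦X⟧ := mk fun k => 1 / ((k + 1).factorial : ℝ)

lemma X_mul_logQuot : X * logQuot = PowerSeries.log ℝ := by
  ext n
  cases n with
  | zero => simp
  | succ n =>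
    rw [coeff_succ_X_mul, logQuot, coeff_mk, coeff_log, if_neg (by omega)]
    simp [pow_succ]

lemma X_mul_expQuot : X * expQuot = PowerSeries.exp ℝ - 1 := by
  ext n
  cases n with
  | zero => simp
  | succ n =>
    rw [coeff_succ_X_mul, expQuot, coeff_mk, map_sub, coeff_exp, PowerSeries.coeff_one,
      if_neg (by omega)]
    simp

lemma derivative_log_mul : d⁄dX ℝ (PowerSeries.log ℝ) * (1 + X) = 1 := by
  rw [deriv_log]
  ext n
  rw [mul_add, mul_one, map_add]
  cases n with
  | zero => simp
  | succ n => rw [coeff_succ_mul_X]; simp [PowerSeries.coeff_one, pow_succ]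

lemma log_subst_exp_sub_one : (PowerSeries.log ℝ).subst (PowerSeries.exp ℝ - 1) = (X : ℝ⟦X⟧) := by
  have hE : HasSubst (PowerSeries.exp ℝ - 1) := HasSubst.exp_sub_one
  have h0 : constantCoeff (PowerSeries.exp ℝ - 1) = 0 := by simp
  apply derivative.ext
  · rw [derivative_subst hE, map_sub, derivative_exp]
    have h1 := congrArg (PowerSeries.subst (PowerSeries.exp ℝ - 1)) derivative_log_mul
    rw [subst_mul hE, subst_add hE, subst_X hE] at h1
    have h2 : PowerSeries.subst (PowerSeries.exp ℝ - 1) (1 : ℝ⟦X⟧) = (1 : ℝ⟦X⟧) := by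
      rw [← coe_substAlgHom hE, map_one]
    rw [h2] at h1
    rw [derivative_X]
    simpa using h1
  · rw [constantCoeff_X]
    exact constantCoeff_subst_eq_zero h0 _ constantCoeff_log

/-- `exp (log (1 + X)) = 1 + X`: the product of the left-hand side with the derivative `1 / (1 + X)`
of `log (1 + X)` has vanishing derivative. -/
lemma exp_subst_log : (PowerSeries.exp ℝ).subst (PowerSeries.log ℝ) = (1 + X : ℝ⟦X⟧) := by
  have hL : HasSubst (PowerSeries.log ℝ) := HasSubst.log
  set y : ℝ⟦X⟧ := (PowerSeries.exp ℝ).subst (PowerSeries.log ℝ) with hy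
  set l : ℝ⟦X⟧ := d⁄dX ℝ (PowerSeries.log ℝ) with hl
  have hl1 : l * (1 + X) = 1 := derivative_log_mul
  have hDy : d⁄dX ℝ y = y * l := by
    rw [hy, derivative_subst hL, derivative_exp]
  have hDl : d⁄dX ℝ l = -(l * l) := by
    have h := congrArg (d⁄dX ℝ) hl1
    rw [Derivation.leibniz, map_add, Derivation.map_one_eq_zero, derivative_X] at h
    simp only [zero_add, smul_eq_mul, mul_one] at h
    have : d⁄dX ℝ l = d⁄dX ℝ l * (l * (1 + X)) := by rw [hl1, mul_one]
    linear_combination this + l * h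
  have hc : y * l = 1 := by
    apply derivative.ext
    · rw [Derivation.leibniz, hDy, hDl, Derivation.map_one_eq_zero]
      simp only [smul_eq_mul]
      ring
    · rw [map_mul, map_one]
      have h1 : constantCoeff y = 1 := by
        have := constantCoeff_subst (R := ℝ) hL (PowerSeries.exp ℝ)
        rw [constantCoeff_eq, hy, this, finsum_eq_single _ 0]
        · simp
        · intro n hn
          have : MvPowerSeries.constantCoeff (PowerSeries.log ℝ) = 0 := constantCoeff_log
          simp [this, hn]
      have h2 : constantCoeff l = 1 := by
        have := congrArg (constantCoeff (R := ℝ)) hl1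
        simpa using this
      rw [h1, h2, mul_one]
  calc y = y * (l * (1 + X)) := by rw [hl1, mul_one]
    _ = 1 + X := by rw [← mul_assoc, hc, one_mul]

lemma logQuot_subst_mul_expQuot :
    logQuot.subst (PowerSeries.exp ℝ - 1) * expQuot = (1 : ℝ⟦X⟧) := by
  have hE : HasSubst (PowerSeries.exp ℝ - 1) := HasSubst.exp_sub_one
  have h := log_subst_exp_sub_one
  rw [← X_mul_logQuot, subst_mul hE, subst_X hE, ← X_mul_expQuot] at h
  rw [← X_mul_expQuot]
  refine mul_left_cancel₀ (X_ne_zero (R := ℝ)) ?_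
  rw [mul_one]
  linear_combination h

lemma constantCoeff_flog (U : R⟦X⟧) : constantCoeff (flog U) = 0 := by
  rw [flog, constantCoeff_seriesEval]; simp

lemma fexp_flog {U : R⟦X⟧} (hU : constantCoeff U = 1) : fexp (flog U) = U := by
  have h0 : constantCoeff (U - 1) = 0 := by simp [hU]
  rw [fexp, flog, ← seriesEval_subst _ constantCoeff_log h0, exp_subst_log, seriesEval_add,
    seriesEval_one, seriesEval_X h0]
  abel

lemma fexp_sub_one (P : R⟦X⟧) : fexp P - 1 = seriesEval (PowerSeries.exp ℝ - 1) P := by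
  rw [seriesEval_sub, seriesEval_one]

lemma flog_fexp {P : R⟦X⟧} (hP : constantCoeff P = 0) : flog (fexp P) = P := by
  rw [flog, fexp_sub_one, ← seriesEval_subst _ (by simp) hP, log_subst_exp_sub_one, seriesEval_X hP]

lemma fexp_mul_fexp_neg {P : R⟦X⟧} (hP : constantCoeff P = 0) : fexp P * fexp (-P) = 1 := by
  have h : fexp (-P) = seriesEval (evalNegHom (PowerSeries.exp ℝ)) P := by
    ext n
    simp only [seriesEval, coeff_mk, evalNegHom, coeff_rescale]
    refine sum_congr rfl fun k _ => ?_
    rcases Nat.even_or_odd k with hk | hk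
    · rw [hk.neg_pow, hk.neg_pow]; simp
    · rw [hk.neg_pow, hk.neg_pow]; simp
  rw [h, ← seriesEval_mul _ _ hP, exp_mul_exp_neg_eq_one, seriesEval_one]

lemma seriesEval_logQuot_mul_expQuot {P : R⟦X⟧} (hP : constantCoeff P = 0) :
    seriesEval logQuot (fexp P - 1) * seriesEval expQuot P = 1 := by
  rw [fexp_sub_one, ← seriesEval_subst _ (by simp) hP, ← seriesEval_mul _ _ hP,
    logQuot_subst_mul_expQuot, seriesEval_one]

end SeriesEval

/-! ### Iterated commutators -/

section AdPow

variable {R : Type*} [Ring R]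

/-- The iterated commutator `[a, [a, …, [a, b]]]` with `k` copies of `a`. -/
def adPow (a : R) : ℕ → R → R
  | 0, b => b
  | k + 1, b => a * adPow a k b - adPow a k b * a

/-- Leibniz rule for moving a power of `a` past `b`. -/
lemma pow_mul_eq_sum_adPow (a b : R) (n : ℕ) :
    a ^ n * b = ∑ k ∈ range (n + 1), n.choose k • (adPow a k b * a ^ (n - k)) := by
  induction n with
  | zero => simp [adPow]
  | succ n ih =>
    have h1 : ∀ k ∈ range (n + 1), a * (n.choose k • (adPow a k b * a ^ (n - k))) =
        n.choose k • (adPow a (k + 1) b * a ^ (n - k)) +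
          n.choose k • (adPow a k b * a ^ (n + 1 - k)) := by
      intro k hk
      have hk' : k ≤ n := by simpa [Nat.lt_succ_iff] using hk
      rw [show n + 1 - k = (n - k) + 1 by omega, pow_succ', adPow, ← smul_add, mul_smul_comm]
      congr 1
      noncomm_ring
    rw [pow_succ', mul_assoc, ih, mul_sum, sum_congr rfl h1, sum_add_distrib,
      sum_range_succ' (fun k => (n + 1).choose k • (adPow a k b * a ^ (n + 1 - k))) (n + 1),
      sum_range_succ' (fun k => n.choose k • (adPow a k b * a ^ (n + 1 - k))) n]
    simp only [Nat.choose_succ_succ, add_smul, sum_add_distrib, Nat.add_sub_add_right]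
    rw [sum_range_succ (fun k => n.choose (k + 1) • (adPow a (k + 1) b * a ^ (n - k))) n]
    simp only [Nat.choose_succ_self, zero_smul, add_zero, Nat.choose_zero_right]
    abel

/-- The derivative of `aⁿ` in direction `b`, sorted by the number of commutators with `a`. -/
lemma sum_pow_mul_pow_eq (a b : R) (n : ℕ) :
    ∑ i ∈ range n, a ^ i * b * a ^ (n - 1 - i) =
      ∑ k ∈ range n, n.choose (k + 1) • (adPow a k b * a ^ (n - 1 - k)) := by
  induction n with
  | zero => simp
  | succ n ih =>
    have h1 : ∀ i ∈ range n, a ^ i * b * a ^ (n + 1 - 1 - i) =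
        a ^ i * b * a ^ (n - 1 - i) * a := by
      intro i hi
      have : i < n := by simpa using hi
      rw [show n + 1 - 1 - i = (n - 1 - i) + 1 by omega, pow_succ, mul_assoc _ _ a]
    have h2 : ∀ k ∈ range n, n.choose (k + 1) • (adPow a k b * a ^ (n - 1 - k)) * a =
        n.choose (k + 1) • (adPow a k b * a ^ (n - k)) := by
      intro k hk
      have : k < n := by simpa using hk
      rw [show n - k = (n - 1 - k) + 1 by omega, pow_succ, smul_mul_assoc, mul_assoc]
    rw [sum_range_succ, sum_congr rfl h1, ← sum_mul, ih, sum_mul, sum_congr rfl h2]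
    simp only [Nat.add_sub_cancel, Nat.sub_self, pow_zero, mul_one]
    rw [pow_mul_eq_sum_adPow, sum_range_succ _ n, sum_range_succ _ n]
    simp only [Nat.choose_succ_succ, add_smul, sum_add_distrib, Nat.choose_succ_self, add_zero]
    abel

end AdPow

/-- A family on pairs of indices which vanishes beyond total degree `n` can be summed by total
degree. -/
lemma sum_antidiagonal_range {M : Type*} [AddCommMonoid M] (f : ℕ × ℕ → M) (n : ℕ)
    (hf : ∀ p : ℕ × ℕ, n < p.1 + p.2 → f p = 0) :
    ∑ p ∈ range (n + 1) ×ˢ range (n + 1), f p =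
      ∑ N ∈ range (n + 1), ∑ p ∈ antidiagonal N, f p := by
  rw [← sum_subset (filter_subset (fun p : ℕ × ℕ => p.1 + p.2 ≤ n) _),
    ← sum_fiberwise_of_maps_to (t := range (n + 1)) (g := fun p : ℕ × ℕ => p.1 + p.2)]
  · refine sum_congr rfl fun N hN => sum_congr ?_ fun _ _ => rfl
    ext p
    simp only [mem_filter, mem_product, mem_range, HasAntidiagonal.mem_antidiagonal] at hN ⊢
    omega
  · intro p hp
    simp only [mem_filter, mem_range] at hp ⊢
    omega
  · intro p hp hp'
    refine hf p ?_
    by_contra h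
    exact hp' (mem_filter.2 ⟨hp, by omega⟩)

/-! ### Differentiation of curves of power series -/

section Deriv

variable {R : Type*} [NormedRing R] [NormedAlgebra ℝ R]

/-- The coefficients of the series `P x` are differentiable in `x`, with derivatives `P' x`. -/
def HasCoeffDeriv (P P' : ℝ → R⟦X⟧) : Prop :=
  ∀ n x, HasDerivAt (fun y => coeff n (P y)) (coeff n (P' x)) x

lemma HasCoeffDeriv.mul {P P' Q Q' : ℝ → R⟦X⟧} (hP : HasCoeffDeriv P P')
    (hQ : HasCoeffDeriv Q Q') :
    HasCoeffDeriv (fun x => P x * Q x) (fun x => P' x * Q x + P x * Q' x) := by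
  intro n x
  simp only [map_add, coeff_mul, ← sum_add_distrib]
  exact HasDerivAt.fun_sum fun p _ => (hP p.1 x).mul (hQ p.2 x)

lemma HasCoeffDeriv.const (P : R⟦X⟧) : HasCoeffDeriv (fun _ => P) (fun _ => 0) :=
  fun n x => by simpa using hasDerivAt_const x (coeff n P)

lemma HasCoeffDeriv.sub {P P' Q Q' : ℝ → R⟦X⟧} (hP : HasCoeffDeriv P P')
    (hQ : HasCoeffDeriv Q Q') : HasCoeffDeriv (fun x => P x - Q x) (fun x => P' x - Q' x) := by
  intro n x
  simpa only [map_sub] using (hP n x).fun_sub (hQ n x)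

lemma HasCoeffDeriv.unique {P P' P'' : ℝ → R⟦X⟧} (h : HasCoeffDeriv P P')
    (h' : HasCoeffDeriv P P'') : P' = P'' := by
  funext x; ext n
  exact (h n x).unique (h' n x)

lemma HasCoeffDeriv.pow {P P' : ℝ → R⟦X⟧} (hP : HasCoeffDeriv P P') (k : ℕ) :
    HasCoeffDeriv (fun x => P x ^ k)
      (fun x => ∑ i ∈ range k, P x ^ i * P' x * P x ^ (k - 1 - i)) := by
  induction k with
  | zero => simpa using HasCoeffDeriv.const (1 : R⟦X⟧)
  | succ k ih =>
    have h := ih.mul hP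
    simp only [← pow_succ] at h
    convert h using 2 with x
    rw [sum_range_succ, sum_mul]
    simp only [Nat.add_sub_cancel, Nat.sub_self, pow_zero, mul_one]
    congr 1
    refine sum_congr rfl fun i hi => ?_
    have : i < k := by simpa using hi
    rw [show k - i = (k - 1 - i) + 1 by omega, pow_succ, mul_assoc _ _ (P x)]

lemma HasCoeffDeriv.seriesEval {P P' : ℝ → R⟦X⟧} (hP : HasCoeffDeriv P P')
    (h0 : ∀ x, constantCoeff (P x) = 0) (f : ℝ⟦X⟧) {n N : ℕ} (hN : n < N) (x : ℝ) :
    HasDerivAt (fun y => coeff n (seriesEval f (P y)))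
      (∑ k ∈ range N, coeff k f •
        coeff n (∑ i ∈ range k, P x ^ i * P' x * P x ^ (k - 1 - i))) x := by
  simp only [coeff_seriesEval f (h0 _) hN]
  exact HasDerivAt.fun_sum fun k _ => (hP.pow k n x).const_smul (coeff k f)

/-- Functional calculus preserves coefficientwise differentiability. -/
lemma HasCoeffDeriv.exists_seriesEval {P P' : ℝ → R⟦X⟧} (hP : HasCoeffDeriv P P')
    (h0 : ∀ x, constantCoeff (P x) = 0) (f : ℝ⟦X⟧) :
    ∃ Q', HasCoeffDeriv (fun x => Lindblad.seriesEval f (P x)) Q' :=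
  ⟨fun x => mk fun n => _, fun n x => by
    rw [coeff_mk]; exact hP.seriesEval h0 f n.lt_succ_self x⟩

/-- The series `∑ₖ [Ω, …, [Ω, Ω']] / (k + 1)!`, which is `(e^Ω)' e^{-Ω}`. -/
def dexpSeries (Ω Ω' : R⟦X⟧) : R⟦X⟧ :=
  mk fun n => ∑ k ∈ range (n + 1), (1 / ((k + 1).factorial : ℝ)) • coeff n (adPow Ω k Ω')

omit [NormedAlgebra ℝ R] in
lemma coeff_mul_of_order {P Q : R⟦X⟧} {a b n : ℕ} (hP : ∀ i < a, coeff i P = 0)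
    (hQ : ∀ i < b, coeff i Q = 0) (h : n < a + b) : coeff n (P * Q) = 0 := by
  rw [coeff_mul]
  refine sum_eq_zero fun p hp => ?_
  rw [HasAntidiagonal.mem_antidiagonal] at hp
  rcases lt_or_ge p.1 a with h1 | h1
  · rw [hP _ h1, zero_mul]
  · rw [hQ p.2 (by omega), mul_zero]

lemma coeff_adPow_of_lt {Ω Ω' : R⟦X⟧} (h0 : constantCoeff Ω = 0) (h0' : constantCoeff Ω' = 0)
    {n k : ℕ} (h : n < k + 1) : coeff n (adPow Ω k Ω') = 0 := by
  induction k generalizing n with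
  | zero =>
    obtain rfl : n = 0 := by omega
    rw [adPow, coeff_zero_eq_constantCoeff_apply, h0']
  | succ k ih =>
    have hΩ : ∀ i < 1, coeff i Ω = 0 := fun i hi => by
      rw [Nat.lt_one_iff.1 hi, coeff_zero_eq_constantCoeff_apply, h0]
    rw [adPow, map_sub, coeff_mul_of_order (a := 1) (b := k + 1) hΩ (fun i hi => ih hi) (by omega),
      coeff_mul_of_order (a := k + 1) (b := 1) (fun i hi => ih hi) hΩ (by omega), sub_zero]

lemma coeff_dexpSeries {Ω Ω' : R⟦X⟧} (h0 : constantCoeff Ω = 0) (h0' : constantCoeff Ω' = 0)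
    {n N : ℕ} (h : n < N) : coeff n (dexpSeries Ω Ω') =
      ∑ k ∈ range N, (1 / ((k + 1).factorial : ℝ)) • coeff n (adPow Ω k Ω') := by
  rw [dexpSeries, coeff_mk]
  refine sum_subset (range_subset_range.2 (by omega)) fun k _ hk => ?_
  have : n < k := by simpa using hk
  rw [coeff_adPow_of_lt h0 h0' (by omega), smul_zero]

/-- The derivative of the exponential of a noncommutative series. -/
theorem HasCoeffDeriv.fexp {Ω Ω' : ℝ → R⟦X⟧} (hΩ : HasCoeffDeriv Ω Ω')
    (h0 : ∀ x, constantCoeff (Ω x) = 0) (h0' : ∀ x, constantCoeff (Ω' x) = 0) :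
    HasCoeffDeriv (fun x => fexp (Ω x)) (fun x => dexpSeries (Ω x) (Ω' x) * fexp (Ω x)) := by
  intro n x
  convert hΩ.seriesEval h0 (PowerSeries.exp ℝ) (by omega : n < n + 2) x using 1
  set f : ℕ × ℕ → R := fun p =>
    (1 / ((p.1 + 1).factorial : ℝ) * (1 / (p.2.factorial : ℝ))) •
      coeff n (adPow (Ω x) p.1 (Ω' x) * Ω x ^ p.2) with hf
  have hR : ∀ k ∈ range (n + 1), coeff (k + 1) (PowerSeries.exp ℝ) •
      coeff n (∑ i ∈ range (k + 1), Ω x ^ i * Ω' x * Ω x ^ (k + 1 - 1 - i)) =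
      ∑ p ∈ antidiagonal k, f p := by
    intro k _
    rw [sum_pow_mul_pow_eq, Nat.sum_antidiagonal_eq_sum_range_succ_mk, map_sum, smul_sum]
    refine sum_congr rfl fun i hi => ?_
    have hi' : i ≤ k := by simpa [Nat.lt_succ_iff] using hi
    rw [hf, coeff_exp, map_nsmul, ← Nat.cast_smul_eq_nsmul ℝ, smul_smul, Nat.add_sub_cancel]
    congr 1
    have := Nat.choose_mul_factorial_mul_factorial (by omega : i + 1 ≤ k + 1)
    rw [Nat.add_sub_add_right] at this
    have h2 : ((k + 1).choose (i + 1) : ℝ) * ((i + 1).factorial : ℝ) * ((k - i).factorial : ℝ) =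
        ((k + 1).factorial : ℝ) := by
      exact_mod_cast this
    have h3 : ((i + 1).factorial : ℝ) ≠ 0 := by positivity
    have h4 : ((k - i).factorial : ℝ) ≠ 0 := by positivity
    have h5 : ((k + 1).factorial : ℝ) ≠ 0 := by positivity
    simp only [one_div, map_inv₀, map_natCast]
    field_simp
    linear_combination h2
  rw [sum_range_succ' _ (n + 1), sum_congr rfl hR]
  simp only [range_zero, sum_empty, map_zero, smul_zero, add_zero]
  rw [← sum_antidiagonal_range, coeff_mul]
  · have h1 : ∀ p ∈ antidiagonal n, coeff p.1 (dexpSeries (Ω x) (Ω' x)) *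
        coeff p.2 (Lindblad.fexp (Ω x)) = ∑ q ∈ range (n + 1) ×ˢ range (n + 1),
          (1 / ((q.1 + 1).factorial : ℝ) * (1 / (q.2.factorial : ℝ))) •
            (coeff p.1 (adPow (Ω x) q.1 (Ω' x)) * coeff p.2 (Ω x ^ q.2)) := by
      intro p hp
      rw [HasAntidiagonal.mem_antidiagonal] at hp
      rw [coeff_dexpSeries (h0 x) (h0' x) (by omega : p.1 < n + 1),
        coeff_seriesEval _ (h0 x) (by omega : p.2 < n + 1), sum_mul_sum, sum_product]
      refine sum_congr rfl fun k _ => sum_congr rfl fun l _ => ?_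
      rw [smul_mul_smul_comm, coeff_exp]
      simp
    rw [sum_congr rfl h1, sum_comm]
    refine sum_congr rfl fun q _ => ?_
    rw [← smul_sum, ← coeff_mul]
  · intro p hp
    rw [hf]
    refine smul_eq_zero_of_right _ (coeff_mul_of_order (a := p.1 + 1) (b := p.2)
      (fun i hi => coeff_adPow_of_lt (h0 x) (h0' x) hi) (fun i hi => coeff_pow_of_lt (h0 x) hi)
      (by omega))

/-- Uniqueness for the linear differential equation `P' = A P` when `A` has no constant term. -/
lemma HasCoeffDeriv.eq_of_mul {A : R⟦X⟧} (hA : constantCoeff A = 0) {P Q : ℝ → R⟦X⟧}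
    (hP : HasCoeffDeriv P fun x => A * P x) (hQ : HasCoeffDeriv Q fun x => A * Q x)
    (h0 : P 0 = Q 0) : P = Q := by
  have key : ∀ n x, coeff n (P x) = coeff n (Q x) := by
    intro n
    induction n using Nat.strong_induction_on with
    | _ n ih =>
      intro x
      have hd : ∀ y, HasDerivAt (fun y => coeff n (P y) - coeff n (Q y)) 0 y := by
        intro y
        have h := (hP n y).fun_sub (hQ n y)
        have hz : coeff n (A * P y) - coeff n (A * Q y) = 0 := by
          rw [coeff_mul, coeff_mul, ← sum_sub_distrib]
          refine sum_eq_zero fun p hp => ?_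
          rw [HasAntidiagonal.mem_antidiagonal] at hp
          rcases Nat.eq_zero_or_pos p.1 with h1 | h1
          · rw [h1, coeff_zero_eq_constantCoeff_apply, hA, zero_mul, zero_mul, sub_zero]
          · rw [ih p.2 (by omega) y, sub_self]
        rw [← hz]
        exact h
      have h := is_const_of_deriv_eq_zero (fun y => (hd y).differentiableAt)
        (fun y => (hd y).deriv) x 0
      simp only [h0, sub_self] at h
      exact sub_eq_zero.1 h
  funext x; ext n
  exact key n x

/-- The formal exponential `e^{x a X}`. -/
def expLin (a : R) (x : ℝ) : R⟦X⟧ := mk fun n => (x ^ n / (n.factorial : ℝ)) • a ^ n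

lemma expLin_zero (a : R) : expLin a 0 = 1 := by
  ext n
  rw [expLin, coeff_mk, PowerSeries.coeff_one]
  cases n <;> simp

lemma hasCoeffDeriv_expLin (a : R) :
    HasCoeffDeriv (expLin a) fun x => monomial 1 a * expLin a x := by
  intro n x
  cases n with
  | zero => 
    have : (fun y => coeff 0 (expLin a y)) = fun _ => (1 : R) := by
      funext y; simp [expLin]
    rw [this]
    simpa [coeff_mul, coeff_monomial] using hasDerivAt_const x (1 : R)
  | succ n =>
    have h1 : coeff (n + 1) (monomial 1 a * expLin a x) = (x ^ n / n.factorial) • a ^ (n + 1) := by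
      rw [coeff_mul, sum_eq_single (1, n)]
      · rw [coeff_monomial, if_pos rfl, expLin, coeff_mk, pow_succ', mul_smul_comm]
      · rintro ⟨i, j⟩ hp hne
        rw [HasAntidiagonal.mem_antidiagonal] at hp
        rw [coeff_monomial, if_neg, zero_mul]
        rintro rfl
        exact hne (by simp at hp ⊢; omega)
      · intro h; exact absurd (HasAntidiagonal.mem_antidiagonal.2 (by simp [add_comm])) h
    rw [h1]
    simp only [expLin, coeff_mk]
    refine HasDerivAt.smul_const ?_ _
    have := (hasDerivAt_pow (n + 1) x).div_const ((n + 1).factorial : ℝ)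
    convert this using 1
    rw [Nat.factorial_succ]
    push_cast
    have : (n.factorial : ℝ) ≠ 0 := by positivity
    field_simp

end Deriv

/-! ### The adjoint action of power series -/

section Adjoint

variable {R : Type*} [NormedRing R] [NormedAlgebra ℝ R]

variable (R) in
/-- The bounded operators on `R`. The algebra structure is sealed behind a definition, so that every
ring structure derived from it is found along a single path. -/
def Op : Type _ := R →L[ℝ] R

instance : NormedRing (Op R) := inferInstanceAs (NormedRing (R →L[ℝ] R))

instance : NormedAlgebra ℝ (Op R) := inferInstanceAs (NormedAlgebra ℝ (R →L[ℝ] R))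

/-- The action of operators on vectors. -/
def opApply : Op R →L[ℝ] R →L[ℝ] R := ContinuousLinearMap.id ℝ (R →L[ℝ] R)

lemma opApply_mul (E F : Op R) (x : R) : opApply (E * F) x = opApply E (opApply F x) := rfl

lemma opApply_one (x : R) : opApply (1 : Op R) x = x := rfl

/-- The adjoint action `a ↦ (x ↦ a x - x a)` as a continuous linear map. -/
def adCLM : R →L[ℝ] Op R :=
  (ContinuousLinearMap.mul ℝ R - (ContinuousLinearMap.mul ℝ R).flip : R →L[ℝ] R →L[ℝ] R)

lemma adCLM_apply (a x : R) : opApply (adCLM a) x = a * x - x * a := by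
  change (ContinuousLinearMap.mul ℝ R - (ContinuousLinearMap.mul ℝ R).flip) a x = _
  simp

lemma op_ext {E F : Op R} (h : ∀ x, opApply E x = opApply F x) : E = F :=
  ContinuousLinearMap.ext h

lemma adCLM_commutator (a b : R) :
    adCLM (a * b - b * a) = adCLM a * adCLM b - adCLM b * adCLM a := by
  refine op_ext fun x => ?_
  rw [map_sub opApply, _root_.sub_apply, opApply_mul, opApply_mul]
  simp only [adCLM_apply]
  noncomm_ring

/-- The coefficientwise adjoint action of a series. -/
def adSeries (P : R⟦X⟧) : (Op R)⟦X⟧ := mk fun n => adCLM (coeff n P)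

/-- A series of operators applied to a series of vectors. -/
def act (E : (Op R)⟦X⟧) (B : R⟦X⟧) : R⟦X⟧ :=
  mk fun n => ∑ p ∈ antidiagonal n, opApply (coeff p.1 E) (coeff p.2 B)

lemma act_mul (E F : (Op R)⟦X⟧) (B : R⟦X⟧) : act (E * F) B = act E (act F B) := by
  ext n
  simp only [act, coeff_mk, coeff_mul, map_sum, _root_.sum_apply, opApply_mul, Finset.sum_sigma']
  refine sum_nbij' (fun x => ⟨(x.2.1, x.2.2 + x.1.2), (x.2.2, x.1.2)⟩)
    (fun x => ⟨(x.1.1 + x.2.1, x.2.2), (x.1.1, x.2.1)⟩) ?_ ?_ ?_ ?_ ?_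
  · rintro ⟨⟨a, b⟩, ⟨c, d⟩⟩ h
    simp only [mem_sigma, HasAntidiagonal.mem_antidiagonal] at h ⊢
    obtain ⟨rfl, rfl⟩ := h
    exact ⟨by ring, trivial⟩
  · rintro ⟨⟨a, b⟩, ⟨c, d⟩⟩ h
    simp only [mem_sigma, HasAntidiagonal.mem_antidiagonal] at h ⊢
    obtain ⟨rfl, rfl⟩ := h
    exact ⟨by ring, trivial⟩
  · rintro ⟨⟨a, b⟩, ⟨c, d⟩⟩ h
    simp only [mem_sigma, HasAntidiagonal.mem_antidiagonal] at h
    obtain ⟨_, rfl⟩ := h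
    rfl
  · rintro ⟨⟨a, b⟩, ⟨c, d⟩⟩ h
    simp only [mem_sigma, HasAntidiagonal.mem_antidiagonal] at h
    obtain ⟨_, rfl⟩ := h
    rfl
  · intros; rfl

lemma one_act (B : R⟦X⟧) : act 1 B = B := by
  ext n
  rw [act, coeff_mk, sum_eq_single (0, n)]
  · simp [opApply_one]
  · rintro ⟨i, j⟩ hp hne
    rw [HasAntidiagonal.mem_antidiagonal] at hp
    have : i ≠ 0 := by
      rintro rfl
      exact hne (by simp at hp; simp [hp])
    simp [PowerSeries.coeff_one, this]
  · intro h; exact absurd (HasAntidiagonal.mem_antidiagonal.2 (by simp)) h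

lemma adSeries_act (P B : R⟦X⟧) : act (adSeries P) B = P * B - B * P := by
  ext n
  rw [act, coeff_mk, map_sub, coeff_mul, coeff_mul,
    ← Finset.Nat.sum_antidiagonal_swap (f := fun p => coeff p.1 B * coeff p.2 P), ← sum_sub_distrib]
  refine sum_congr rfl fun p _ => ?_
  simp [adSeries, adCLM_apply]

lemma adSeries_commutator (P Q : R⟦X⟧) :
    adSeries (P * Q - Q * P) = adSeries P * adSeries Q - adSeries Q * adSeries P := by
  ext n : 1
  rw [map_sub, coeff_mul, coeff_mul,
    ← Finset.Nat.sum_antidiagonal_swap (f := fun p => coeff p.1 (adSeries Q) * coeff p.2 (adSeries P)),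
    ← sum_sub_distrib, adSeries, coeff_mk, map_sub, coeff_mul, coeff_mul,
    ← Finset.Nat.sum_antidiagonal_swap (f := fun p => coeff p.1 Q * coeff p.2 P),
    ← sum_sub_distrib, map_sum]
  refine sum_congr rfl fun p _ => ?_
  simp only [adSeries, coeff_mk, Prod.fst_swap, Prod.snd_swap]
  exact adCLM_commutator _ _

lemma adSeries_adPow (P Q : R⟦X⟧) (k : ℕ) :
    adSeries (adPow P k Q) = adPow (adSeries P) k (adSeries Q) := by
  induction k with
  | zero => rfl
  | succ k ih => rw [adPow, adPow, adSeries_commutator, ih]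

lemma constantCoeff_adSeries {P : R⟦X⟧} (hP : constantCoeff P = 0) :
    constantCoeff (adSeries P) = 0 := by
  rw [← coeff_zero_eq_constantCoeff_apply, adSeries, coeff_mk, coeff_zero_eq_constantCoeff_apply,
    hP, map_zero]

lemma adSeries_dexpSeries (P Q : R⟦X⟧) :
    adSeries (dexpSeries P Q) = dexpSeries (adSeries P) (adSeries Q) := by
  ext n : 1
  simp only [dexpSeries, adSeries, coeff_mk, map_sum, map_smul]
  refine sum_congr rfl fun k _ => ?_
  have := congrArg (coeff n) (adSeries_adPow P Q k)
  rw [adSeries, coeff_mk] at this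
  rw [this]
  rfl

lemma adPow_act (P B : R⟦X⟧) (k : ℕ) : act (adSeries P ^ k) B = adPow P k B := by
  induction k with
  | zero => rw [pow_zero, one_act, adPow]
  | succ k ih => rw [pow_succ', act_mul, ih, adSeries_act, adPow]

/-- `dexp_P = (e^{ad P} - 1) / ad P`. -/
lemma expQuot_act {P B : R⟦X⟧} (hP : constantCoeff P = 0) (hB : constantCoeff B = 0) :
    act (seriesEval expQuot (adSeries P)) B = dexpSeries P B := by
  ext n
  rw [coeff_dexpSeries hP hB n.lt_succ_self, act, coeff_mk]
  have h1 : ∀ p ∈ antidiagonal n, opApply (coeff p.1 (seriesEval expQuot (adSeries P))) (coeff p.2 B) =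
      ∑ k ∈ range (n + 1), (1 / ((k + 1).factorial : ℝ)) •
        opApply (coeff p.1 (adSeries P ^ k)) (coeff p.2 B) := by
    intro p hp
    rw [HasAntidiagonal.mem_antidiagonal] at hp
    rw [coeff_seriesEval _ (constantCoeff_adSeries hP) (by omega : p.1 < n + 1),
      map_sum, _root_.sum_apply]
    refine sum_congr rfl fun k _ => ?_
    rw [expQuot, coeff_mk, map_smul, _root_.smul_apply]
  rw [sum_congr rfl h1, sum_comm]
  refine sum_congr rfl fun k _ => ?_
  rw [← adPow_act, ← smul_sum, act, coeff_mk]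

lemma HasCoeffDeriv.adSeries {P P' : ℝ → R⟦X⟧} (h : HasCoeffDeriv P P') :
    HasCoeffDeriv (fun x => adSeries (P x)) (fun x => Lindblad.adSeries (P' x)) := by
  intro n x
  simp only [Lindblad.adSeries, coeff_mk]
  exact (adCLM (R := R)).hasFDerivAt.comp_hasDerivAt x (h n x)

end Adjoint

/-! ### The formal logarithm of a product of exponentials -/

section Stages

lemma flog_one {R : Type*} [Ring R] [Algebra ℝ R] : flog (1 : R⟦X⟧) = 0 := by
  ext n
  simp only [flog, seriesEval, sub_self, coeff_mk]
  rw [map_zero]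
  refine sum_eq_zero fun k _ => ?_
  rcases k with _ | k <;> simp

variable {m : ℕ} {R : Type*} [NormedRing R] [NormedAlgebra ℝ R]

/-- The formal product `e^{X A_{j₁}/2} ⋯ e^{X A_{j_N}/2}` over a list of letters. -/
def formalProd (A : Fin m → R) (J : List (Fin m)) : R⟦X⟧ :=
  (J.map fun j => expLin ((1 / 2 : ℝ) • A j) 1).prod

/-- The formal product over the letters `J`, followed by the fraction `x` of a factor of
letter `j`. -/
def formalStage (A : Fin m → R) (j : Fin m) (J : List (Fin m)) (x : ℝ) : R⟦X⟧ :=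
  expLin ((1 / 2 : ℝ) • A j) x * formalProd A J

lemma formalStage_zero (A : Fin m → R) (j : Fin m) (J : List (Fin m)) :
    formalStage A j J 0 = formalProd A J := by
  rw [formalStage, expLin_zero, one_mul]

lemma formalStage_one (A : Fin m → R) (j : Fin m) (J : List (Fin m)) :
    formalStage A j J 1 = formalProd A (j :: J) := by
  simp [formalStage, formalProd]

lemma constantCoeff_expLin (a : R) (x : ℝ) : constantCoeff (expLin a x) = 1 := by
  rw [← coeff_zero_eq_constantCoeff_apply, expLin, coeff_mk]; simp

lemma constantCoeff_formalProd (A : Fin m → R) (J : List (Fin m)) :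
    constantCoeff (formalProd A J) = 1 := by
  induction J with
  | nil => simp [formalProd]
  | cons j J ih =>
    rw [formalProd, List.map_cons, List.prod_cons, map_mul, constantCoeff_expLin, one_mul]
    exact ih

lemma constantCoeff_formalStage (A : Fin m → R) (j : Fin m) (J : List (Fin m)) (x : ℝ) :
    constantCoeff (formalStage A j J x) = 1 := by
  rw [formalStage, map_mul, constantCoeff_expLin, constantCoeff_formalProd, mul_one]

lemma hasCoeffDeriv_formalStage (A : Fin m → R) (j : Fin m) (J : List (Fin m)) :
    HasCoeffDeriv (formalStage A j J)
      fun x => monomial 1 ((1 / 2 : ℝ) • A j) * formalStage A j J x := by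
  have h := (hasCoeffDeriv_expLin ((1 / 2 : ℝ) • A j)).mul (HasCoeffDeriv.const (formalProd A J))
  simp only [mul_assoc, mul_zero, add_zero] at h
  exact h

/-- The logarithm of the formal product along a stage: it is differentiable, and its derivative
satisfies `∑ₖ ad_Ω^k Ω' / (k + 1)! = X A_j / 2`. -/
lemma exists_hasCoeffDeriv_flog (A : Fin m → R) (j : Fin m) (J : List (Fin m)) :
    ∃ Ω' : ℝ → R⟦X⟧, HasCoeffDeriv (fun x => flog (formalStage A j J x)) Ω' ∧
      (∀ x, constantCoeff (Ω' x) = 0) ∧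
      ∀ x, dexpSeries (flog (formalStage A j J x)) (Ω' x) = monomial 1 ((1 / 2 : ℝ) • A j) := by
  have hU := hasCoeffDeriv_formalStage A j J
  have hU1 : HasCoeffDeriv (fun x => formalStage A j J x - 1)
      fun x => monomial 1 ((1 / 2 : ℝ) • A j) * formalStage A j J x := by
    simpa using hU.sub (HasCoeffDeriv.const 1)
  obtain ⟨Ω', hΩ⟩ := hU1.exists_seriesEval
    (fun x => by simp [constantCoeff_formalStage]) (PowerSeries.log ℝ)
  have h0' : ∀ x, constantCoeff (Ω' x) = 0 := by
    intro x
    have h := hΩ 0 x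
    simp only [coeff_zero_eq_constantCoeff_apply] at h
    have h2 : (fun y => constantCoeff (seriesEval (PowerSeries.log ℝ) (formalStage A j J y - 1))) =
        fun _ => (0 : R) := funext fun y => constantCoeff_flog _
    rw [h2] at h
    exact h.unique (hasDerivAt_const x 0)
  refine ⟨Ω', hΩ, h0', fun x => ?_⟩
  have h1 := HasCoeffDeriv.fexp hΩ (fun x => constantCoeff_flog _) h0'
  have h2 : (fun x => fexp (flog (formalStage A j J x))) = formalStage A j J :=
    funext fun x => fexp_flog (constantCoeff_formalStage A j J x)
  have h3 := congrFun (HasCoeffDeriv.unique (h2 ▸ h1) hU) x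
  have h4 : formalStage A j J x * fexp (-flog (formalStage A j J x)) = 1 := by
    have := fexp_mul_fexp_neg (constantCoeff_flog (formalStage A j J x))
    rwa [fexp_flog (constantCoeff_formalStage A j J x)] at this
  have h5 := congrArg (fun Q => Q * fexp (-flog (formalStage A j J x))) h3
  rw [fexp_flog (constantCoeff_formalStage A j J x), mul_assoc, mul_assoc, h4, mul_one,
    mul_one] at h5
  exact h5

lemma adSeries_monomial (a : R) (n : ℕ) : adSeries (monomial n a) = monomial n (adCLM a) := by
  ext k : 1
  rw [adSeries, coeff_mk, coeff_monomial, coeff_monomial]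
  split_ifs <;> simp

lemma hasCoeffDeriv_fexp_adSeries_flog (A : Fin m → R) (j : Fin m) (J : List (Fin m)) :
    HasCoeffDeriv (fun x => fexp (adSeries (flog (formalStage A j J x)))) fun x =>
      monomial 1 ((1 / 2 : ℝ) • adCLM (A j)) * fexp (adSeries (flog (formalStage A j J x))) := by
  obtain ⟨Ω', h1, h2, h3⟩ := exists_hasCoeffDeriv_flog A j J
  have h := h1.adSeries.fexp (fun x => constantCoeff_adSeries (constantCoeff_flog _))
    (fun x => constantCoeff_adSeries (h2 x))
  convert h using 3 with x
  rw [← adSeries_dexpSeries, h3, adSeries_monomial, map_smul adCLM]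

/-- `e^{ad log U} = Ad_U`, computed as the product of the `e^{ad X A_j / 2}`. -/
lemma fexp_adSeries_flog_formalProd (A : Fin m → R) (J : List (Fin m)) :
    fexp (adSeries (flog (formalProd A J))) = formalProd (fun j => adCLM (A j)) J := by
  induction J with
  | nil =>
    have h2 : adSeries (0 : R⟦X⟧) = 0 := by
      ext n : 1; simp [adSeries]
    have h3 := fexp_flog (U := (1 : (Op R)⟦X⟧)) (by simp)
    simp only [formalProd, List.map_nil, List.prod_nil]
    rw [flog_one] at h3 ⊢
    rw [h2, h3]
  | cons j J ih =>
    have := HasCoeffDeriv.eq_of_mul (A := monomial 1 ((1 / 2 : ℝ) • adCLM (A j))) (by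
        rw [← coeff_zero_eq_constantCoeff_apply, coeff_monomial]; simp)
      (hasCoeffDeriv_fexp_adSeries_flog A j J)
      (hasCoeffDeriv_formalStage (fun j => adCLM (A j)) j J)
      (by simp only [formalStage_zero]; exact ih)
    have := congrFun this 1
    simpa only [formalStage_one] using this

lemma fexp_adSeries_flog_formalStage (A : Fin m → R) (j : Fin m) (J : List (Fin m)) (x : ℝ) :
    fexp (adSeries (flog (formalStage A j J x))) = formalStage (fun j => adCLM (A j)) j J x := by
  refine congrFun (HasCoeffDeriv.eq_of_mul (A := monomial 1 ((1 / 2 : ℝ) • adCLM (A j))) (by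
      rw [← coeff_zero_eq_constantCoeff_apply, coeff_monomial]; simp)
    (hasCoeffDeriv_fexp_adSeries_flog A j J)
    (hasCoeffDeriv_formalStage (fun j => adCLM (A j)) j J) ?_) x
  simp only [formalStage_zero]
  exact fexp_adSeries_flog_formalProd A J

/-- Along a stage, `Ω' = (log (1 + V) / V) (X A_j / 2)` where `1 + V = Ad_U`. -/
lemma exists_hasCoeffDeriv_flog_act (A : Fin m → R) (j : Fin m) (J : List (Fin m)) :
    ∃ Ω' : ℝ → R⟦X⟧, HasCoeffDeriv (fun x => flog (formalStage A j J x)) Ω' ∧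
      (∀ x, constantCoeff (Ω' x) = 0) ∧
      (∀ x, dexpSeries (flog (formalStage A j J x)) (Ω' x) = monomial 1 ((1 / 2 : ℝ) • A j)) ∧
      ∀ x, Ω' x = act (seriesEval logQuot (formalStage (fun j => adCLM (A j)) j J x - 1))
        (monomial 1 ((1 / 2 : ℝ) • A j)) := by
  obtain ⟨Ω', h1, h2, h3⟩ := exists_hasCoeffDeriv_flog A j J
  refine ⟨Ω', h1, h2, h3, fun x => ?_⟩
  have hc := constantCoeff_flog (formalStage A j J x)
  rw [← h3 x, ← expQuot_act hc (h2 x), ← act_mul, ← fexp_adSeries_flog_formalStage,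
    seriesEval_logQuot_mul_expQuot (constantCoeff_adSeries hc), one_act]

end Stages

/-! ### Word coefficients and the Riccati equation -/

section Words

variable {m : ℕ}

/-- The noncommutative polynomial `∑_w c_w A_{w₁} ⋯ A_{w_q}` over the words of length `q`. -/
def evalWords {R : Type*} [Ring R] [Module ℝ R] (A : Fin m → R) :
    (List (Fin m) → ℝ) → ℕ → R
  | c, 0 => c [] • 1
  | c, q + 1 => ∑ j, A j * evalWords A (fun w => c (j :: w)) q

variable {R : Type*} [NormedRing R] [NormedAlgebra ℝ R] (A : Fin m → R)

lemma evalWords_congr {c d : List (Fin m) → ℝ} {q : ℕ}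
    (h : ∀ w : List (Fin m), w.length = q → c w = d w) : evalWords A c q = evalWords A d q := by
  induction q generalizing c d with
  | zero => simp [evalWords, h [] rfl]
  | succ q ih =>
    simp only [evalWords]
    exact sum_congr rfl fun j _ => by rw [ih fun w hw => h (j :: w) (by simp [hw])]

lemma evalWords_add (c d : List (Fin m) → ℝ) (q : ℕ) :
    evalWords A (fun w => c w + d w) q = evalWords A c q + evalWords A d q := by
  induction q generalizing c d with
  | zero => simp [evalWords, add_smul]
  | succ q ih => simp only [evalWords, ih, mul_add, sum_add_distrib]

lemma evalWords_smul (r : ℝ) (c : List (Fin m) → ℝ) (q : ℕ) :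
    evalWords A (fun w => r * c w) q = r • evalWords A c q := by
  induction q generalizing c with
  | zero => simp [evalWords, mul_smul]
  | succ q ih => simp only [evalWords, ih, mul_smul_comm, smul_sum]

lemma evalWords_sub (c d : List (Fin m) → ℝ) (q : ℕ) :
    evalWords A (fun w => c w - d w) q = evalWords A c q - evalWords A d q := by
  have h := evalWords_add A c (fun w => (-1) * d w) q
  rw [evalWords_smul] at h
  simpa [sub_eq_add_neg] using h

lemma evalWords_zero (q : ℕ) : evalWords A (fun _ => 0) q = 0 := by
  have h := evalWords_smul A 0 (fun _ => 0) q
  simpa using h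

lemma evalWords_sum {ι : Type*} (s : Finset ι) (c : ι → List (Fin m) → ℝ) (q : ℕ) :
    evalWords A (fun w => ∑ i ∈ s, c i w) q = ∑ i ∈ s, evalWords A (c i) q := by
  classical
  induction s using Finset.induction_on with
  | empty => simpa using evalWords_zero A q
  | insert i s hi ih =>
    simp only [sum_insert hi]
    rw [evalWords_add, ih]

lemma evalWords_mul (c d : List (Fin m) → ℝ) (p q : ℕ) :
    evalWords A c p * evalWords A d q =
      evalWords A (fun w => c (w.take p) * d (w.drop p)) (p + q) := by
  induction p generalizing c with
  | zero =>
    simp only [List.take_zero, List.drop_zero, zero_add, evalWords_smul]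
    simp [evalWords]
  | succ p ih =>
    rw [show p + 1 + q = (p + q) + 1 by omega, evalWords, evalWords, sum_mul]
    refine sum_congr rfl fun j _ => ?_
    rw [mul_assoc, ih]
    rfl

/-- A word with the letter `j` at position `p` splits into the `p` letters before it and the rest
after it. -/
lemma evalWords_mul_letter (c d : List (Fin m) → ℝ) (p q : ℕ) (j : Fin m) :
    evalWords A c p * A j * evalWords A d q =
      evalWords A (fun w => if w[p]? = some j then c (w.take p) * d (w.drop (p + 1)) else 0)
        (p + q + 1) := by
  have hj : A j * evalWords A d q =
      evalWords A (fun w => if w[0]? = some j then d (w.drop 1) else 0) (q + 1) := by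
    rw [evalWords, sum_eq_single j]
    · simp
    · intro i _ hi
      have : (fun w : List (Fin m) => if (i :: w)[0]? = some j then d ((i :: w).drop 1) else 0) =
          fun _ => 0 := by
        funext w; simp [hi]
      rw [this, evalWords_zero, mul_zero]
    · simp
  rw [mul_assoc, hj, evalWords_mul, ← add_assoc]
  refine evalWords_congr A fun w _ => ?_
  simp [List.getElem?_drop, List.drop_drop]

lemma hasDerivAt_evalWords {c : List (Fin m) → ℝ → ℝ} {c' : List (Fin m) → ℝ} {x : ℝ} {q : ℕ}
    (h : ∀ w : List (Fin m), w.length = q → HasDerivAt (c w) (c' w) x) :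
    HasDerivAt (fun y => evalWords A (fun w => c w y) q) (evalWords A c' q) x := by
  induction q generalizing c c' with
  | zero => exact (h [] rfl).smul_const _
  | succ q ih =>
    simp only [evalWords]
    refine HasDerivAt.fun_sum fun j _ => ?_
    exact (ih fun w hw => h (j :: w) (by simp [hw])).const_mul (A j)

/-- The right-hand side of the Riccati equation `Z' = -Z a + (1 - v) Z a Z`, `a = X A_j / 2`, at
the coefficient of the word `w`. -/
def riccati (j : Fin m) (v : ℝ) (z : List (Fin m) → ℝ) (w : List (Fin m)) : ℝ :=
  1 / 2 * ∑ i ∈ range w.length, if w[i]? = some j then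
    (1 - v) * z (w.take i) * z (w.drop (i + 1)) - (if i + 1 = w.length then z (w.take i) else 0)
  else 0

lemma evalWords_riccati (j : Fin m) (v : ℝ) (z : List (Fin m) → ℝ) (q : ℕ) :
    evalWords A (riccati j v z) (q + 1) =
      (1 / 2 : ℝ) • ((1 - v) • ∑ p ∈ antidiagonal q, evalWords A z p.1 * A j * evalWords A z p.2 -
        evalWords A z q * A j) := by
  have h1 : evalWords A (fun w => ∑ p ∈ antidiagonal q,
      if w[p.1]? = some j then z (w.take p.1) * z (w.drop (p.1 + 1)) else 0) (q + 1) =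
      ∑ p ∈ antidiagonal q, evalWords A z p.1 * A j * evalWords A z p.2 := by
    rw [evalWords_sum]
    refine sum_congr rfl fun p hp => ?_
    rw [HasAntidiagonal.mem_antidiagonal] at hp
    rw [evalWords_mul_letter, hp]
  have h2 : evalWords A (fun w => if w[q]? = some j then z (w.take q) else 0) (q + 1) =
      evalWords A z q * A j := by
    have := evalWords_mul_letter A z (fun _ => 1) q 0 j
    simp only [mul_one, add_zero] at this
    rw [← this]
    simp [evalWords]
  rw [← h1, ← h2, ← evalWords_smul, ← evalWords_sub, ← evalWords_smul]
  refine evalWords_congr A fun w hw => ?_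
  rw [riccati, hw, Nat.sum_antidiagonal_eq_sum_range_succ_mk]
  congr 1
  have h3 : (if w[q]? = some j then z (w.take q) else 0) = ∑ i ∈ range (q + 1),
      if w[i]? = some j then (if i + 1 = q + 1 then z (w.take i) else 0) else 0 := by
    rw [sum_eq_single q]
    · simp
    · intro i _ hi; simp [hi]
    · simp
  rw [h3, mul_sum, ← sum_sub_distrib]
  refine sum_congr rfl fun i _ => ?_
  split_ifs <;> ring

/-- The solution of the integrated Riccati equation along a stage of letter `j` with initial value
`z₀`, by recursion on the length of the word. -/
def stageCoeff (j : Fin m) (z₀ : List (Fin m) → ℝ → ℝ) (w : List (Fin m)) (v x : ℝ) : ℝ :=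
  z₀ w v + ∫ y in (0 : ℝ)..x, 1 / 2 * ∑ i : Fin w.length, if w[i.1]? = some j then
    (1 - v) * stageCoeff j z₀ (w.take i) v y * stageCoeff j z₀ (w.drop (i + 1)) v y -
      (if i.1 + 1 = w.length then stageCoeff j z₀ (w.take i) v y else 0)
  else 0
termination_by w.length
decreasing_by
  all_goals simp only [List.length_take, List.length_drop]; omega

lemma stageCoeff_eq (j : Fin m) (z₀ : List (Fin m) → ℝ → ℝ) (w : List (Fin m)) (v x : ℝ) :
    stageCoeff j z₀ w v x =
      z₀ w v + ∫ y in (0 : ℝ)..x, riccati j v (fun u => stageCoeff j z₀ u v y) w := by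
  rw [stageCoeff]
  simp only [riccati, Finset.sum_range]

lemma stageCoeff_zero (j : Fin m) (z₀ : List (Fin m) → ℝ → ℝ) (w : List (Fin m)) (v : ℝ) :
    stageCoeff j z₀ w v 0 = z₀ w v := by
  rw [stageCoeff_eq]; simp

lemma stageCoeff_nil (j : Fin m) (z₀ : List (Fin m) → ℝ → ℝ) (v x : ℝ) :
    stageCoeff j z₀ [] v x = z₀ [] v := by
  rw [stageCoeff_eq]; simp [riccati]

lemma continuous_riccati_stageCoeff_of_lt (j : Fin m) (z₀ : List (Fin m) → ℝ → ℝ)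
    (w : List (Fin m)) (h : ∀ u : List (Fin m), u.length < w.length →
      Continuous fun p : ℝ × ℝ => stageCoeff j z₀ u p.1 p.2) :
    Continuous fun p : ℝ × ℝ => riccati j p.1 (fun u => stageCoeff j z₀ u p.1 p.2) w := by
  unfold riccati
  refine continuous_const.mul (continuous_finsetSum _ fun i hi => ?_)
  have hi' : i < w.length := by simpa using hi
  have h1 := h (w.take i) (by simp [hi'])
  have h2 := h (w.drop (i + 1)) (by simp; omega)
  by_cases hj : w[i]? = some j
  · simp only [hj, if_true]
    by_cases hl : i + 1 = w.length
    · simp only [hl, if_true]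
      rw [hl] at h2
      exact (((continuous_const.sub continuous_fst).mul h1).mul h2).sub h1
    · simp only [hl, if_false, sub_zero]
      exact ((continuous_const.sub continuous_fst).mul h1).mul h2
  · simp only [hj, if_false]
    exact continuous_const

lemma continuous_stageCoeff (j : Fin m) {z₀ : List (Fin m) → ℝ → ℝ}
    (h₀ : ∀ w, Continuous (z₀ w)) (w : List (Fin m)) :
    Continuous fun p : ℝ × ℝ => stageCoeff j z₀ w p.1 p.2 := by
  induction hn : w.length using Nat.strong_induction_on generalizing w with
  | _ n ih =>
    subst hn
    have h := continuous_riccati_stageCoeff_of_lt j z₀ w fun u hu => ih _ hu u rfl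
    have h2 : Continuous fun p : ℝ × ℝ => ∫ y in (0 : ℝ)..p.2,
        riccati j p.1 (fun u => stageCoeff j z₀ u p.1 y) w :=
      intervalIntegral.continuous_parametric_primitive_of_continuous (a₀ := (0 : ℝ))
        (f := fun v y => riccati j v (fun u => stageCoeff j z₀ u v y) w) h
    have h3 : (fun p : ℝ × ℝ => stageCoeff j z₀ w p.1 p.2) = fun p => z₀ w p.1 +
        ∫ y in (0 : ℝ)..p.2, riccati j p.1 (fun u => stageCoeff j z₀ u p.1 y) w :=
      funext fun p => stageCoeff_eq j z₀ w p.1 p.2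
    rw [h3]
    exact ((h₀ w).comp continuous_fst).add h2

lemma continuous_riccati_stageCoeff (j : Fin m) {z₀ : List (Fin m) → ℝ → ℝ}
    (h₀ : ∀ w, Continuous (z₀ w)) (w : List (Fin m)) (v : ℝ) :
    Continuous fun y => riccati j v (fun u => stageCoeff j z₀ u v y) w :=
  (continuous_riccati_stageCoeff_of_lt j z₀ w fun u _ => continuous_stageCoeff j h₀ u).comp
    (Continuous.prodMk_right v)

lemma hasDerivAt_stageCoeff (j : Fin m) {z₀ : List (Fin m) → ℝ → ℝ}
    (h₀ : ∀ w, Continuous (z₀ w)) (w : List (Fin m)) (v x : ℝ) :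
    HasDerivAt (fun y => stageCoeff j z₀ w v y)
      (riccati j v (fun u => stageCoeff j z₀ u v x) w) x := by
  have hc := continuous_riccati_stageCoeff j h₀ w v
  have h3 : (fun y => stageCoeff j z₀ w v y) = fun x => z₀ w v +
      ∫ y in (0 : ℝ)..x, riccati j v (fun u => stageCoeff j z₀ u v y) w :=
    funext fun x => stageCoeff_eq j z₀ w v x
  rw [h3]
  exact (intervalIntegral.integral_hasDerivAt_right (hc.intervalIntegrable _ _)
    hc.aestronglyMeasurable.stronglyMeasurableAtFilter hc.continuousAt).const_add _

/-- The product over the letters of `w` of the durations `θ` spent on them. -/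
def durations (θ : Fin m → ℝ) (w : List (Fin m)) : ℝ := (w.map θ).prod

lemma durations_nonneg {θ : Fin m → ℝ} (hθ : ∀ l, 0 ≤ θ l) (w : List (Fin m)) :
    0 ≤ durations θ w :=
  List.prod_nonneg fun a ha => by
    obtain ⟨l, _, rfl⟩ := List.mem_map.1 ha
    exact hθ l

lemma durations_le_one {θ : Fin m → ℝ} (hθ : ∀ l, 0 ≤ θ l) (hθ1 : ∀ l, θ l ≤ 1)
    (w : List (Fin m)) : durations θ w ≤ 1 := by
  induction w with
  | nil => simp [durations]
  | cons l w ih =>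
    rw [durations, List.map_cons, List.prod_cons]
    exact mul_le_one₀ (hθ1 l) (durations_nonneg hθ w) ih

/-- The durations when a stage of letter `j` has advanced by `x`. -/
def advance (θ : Fin m → ℝ) (j : Fin m) (x : ℝ) (l : Fin m) : ℝ :=
  θ l + if l = j then x / 2 else 0

/-- Leibniz rule for the product of the durations: each occurrence of the letter `j` contributes one
term. -/
lemma hasDerivAt_durations (θ : Fin m → ℝ) (j : Fin m) (w : List (Fin m)) (x : ℝ) :
    HasDerivAt (fun y => durations (advance θ j y) w)
      (1 / 2 * ∑ i ∈ range w.length, if w[i]? = some j then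
        durations (advance θ j x) (w.take i) * durations (advance θ j x) (w.drop (i + 1)) else 0)
      x := by
  induction w with
  | nil => simpa [durations] using hasDerivAt_const x (1 : ℝ)
  | cons l w ih =>
    have h1 : HasDerivAt (fun y => advance θ j y l) (if l = j then 1 / 2 else 0) x := by
      unfold advance
      split_ifs with h
      · exact ((hasDerivAt_id x).div_const 2).const_add _
      · exact hasDerivAt_const x _
    have h2 := h1.mul ih
    have h3 : (fun y => durations (advance θ j y) (l :: w)) =
        (fun y => advance θ j y l) * fun y => durations (advance θ j y) w := by
      funext y; simp [durations]
    rw [h3]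
    refine h2.congr_deriv ?_
    rw [List.length_cons, sum_range_succ', mul_add, add_comm]
    congr 1
    · rw [mul_left_comm, mul_sum]
      congr 1
      refine sum_congr rfl fun i _ => ?_
      simp only [List.getElem?_cons_succ, List.take_succ_cons, List.drop_succ_cons]
      split_ifs
      · simp [durations, mul_assoc]
      · simp
    · simp only [List.getElem?_cons_zero, Option.some.injEq, List.take_zero, List.drop_succ_cons,
        List.drop_zero]
      split_ifs <;> simp [durations]

lemma continuous_durations_deriv (θ : Fin m → ℝ) (j : Fin m) (w : List (Fin m)) :
    Continuous fun x => (1 / 2 * ∑ i ∈ range w.length, if w[i]? = some j then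
        durations (advance θ j x) (w.take i) * durations (advance θ j x) (w.drop (i + 1)) else 0) := by
  have hc : ∀ u : List (Fin m), Continuous fun x => durations (advance θ j x) u := fun u =>
    continuous_iff_continuousAt.2 fun x => (hasDerivAt_durations θ j u x).continuousAt
  refine continuous_const.mul (continuous_finsetSum _ fun i _ => ?_)
  split_ifs
  · exact (hc _).mul (hc _)
  · exact continuous_const

/-- The word coefficients of the resolvent are bounded by the products of the durations of their
letters: by induction on the length of the word, the integrand of the Riccati equation is dominated
by the derivative of `durations`. -/
lemma abs_stageCoeff_le (j : Fin m) {z₀ : List (Fin m) → ℝ → ℝ}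
    (hnil : ∀ v, z₀ [] v = 1) {θ : Fin m → ℝ} (hθ : ∀ l, 0 ≤ θ l) {v : ℝ} (hv : v ∈ Set.Icc (0 : ℝ) 1)
    (hb : ∀ w, |z₀ w v| ≤ durations θ w) (w : List (Fin m)) {x : ℝ} (hx : 0 ≤ x) :
    |stageCoeff j z₀ w v x| ≤ durations (advance θ j x) w := by
  induction hn : w.length using Nat.strong_induction_on generalizing w x with
  | _ n ih =>
    subst hn
    have hadv : ∀ y, 0 ≤ y → ∀ l, 0 ≤ advance θ j y l := fun y hy l => by
      unfold advance; split_ifs <;> linarith [hθ l]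
    have hz : ∀ u, durations (advance θ j 0) u = durations θ u := fun u => by
      have : advance θ j 0 = θ := by funext l; simp [advance]
      rw [this]
    set D : ℝ → ℝ := fun x => (1 / 2 * ∑ i ∈ range w.length, if w[i]? = some j then
        durations (advance θ j x) (w.take i) * durations (advance θ j x) (w.drop (i + 1)) else 0)
      with hD
    have hDc : Continuous D := continuous_durations_deriv θ j w
    have hbound : ∀ y ∈ Set.Ioc 0 x, ‖riccati j v (fun u => stageCoeff j z₀ u v y) w‖ ≤ D y := by
      intro y hy
      rw [Real.norm_eq_abs, riccati, hD, abs_mul, abs_of_pos (by norm_num : (0 : ℝ) < 1 / 2)]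
      refine mul_le_mul_of_nonneg_left ((abs_sum_le_sum_abs _ _).trans (sum_le_sum fun i hi => ?_))
        (by norm_num)
      have hi' : i < w.length := by simpa using hi
      have ht := ih (w.take i).length (by simp [hi']) (w.take i) hy.1.le rfl
      have hd := ih (w.drop (i + 1)).length (by simp; omega) (w.drop (i + 1)) hy.1.le rfl
      split_ifs with h1 h2
      -- if `j` is the last letter, the two terms combine to `-v z`
      · have h3 : w.drop (i + 1) = [] := List.drop_eq_nil_of_le h2.ge
        rw [h3, stageCoeff_nil, hnil]
        have h4 : durations (advance θ j y) [] = 1 := by simp [durations]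
        rw [h4, mul_one, mul_one]
        have h5 : (1 - v) * stageCoeff j z₀ (w.take i) v y - stageCoeff j z₀ (w.take i) v y =
            -(v * stageCoeff j z₀ (w.take i) v y) := by ring
        rw [h5, abs_neg, abs_mul, abs_of_nonneg hv.1]
        exact (mul_le_of_le_one_left (abs_nonneg _) hv.2).trans ht
      · rw [sub_zero, abs_mul, abs_mul, abs_of_nonneg (sub_nonneg.2 hv.2)]
        refine mul_le_mul ((mul_le_of_le_one_left (abs_nonneg _) (by linarith [hv.1])).trans ht) hd
          (abs_nonneg _) (durations_nonneg (hadv y hy.1.le) _)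
      · simp
    have hint : ‖∫ y in (0 : ℝ)..x, riccati j v (fun u => stageCoeff j z₀ u v y) w‖ ≤
        ∫ y in (0 : ℝ)..x, D y :=
      intervalIntegral.norm_integral_le_of_norm_le hx
        (MeasureTheory.ae_of_all _ hbound) (hDc.intervalIntegrable _ _)
    -- the bound integrates to the increase of `durations` along the stage
    have hftc : ∫ y in (0 : ℝ)..x, D y =
        durations (advance θ j x) w - durations (advance θ j 0) w :=
      intervalIntegral.integral_eq_sub_of_hasDerivAt
        (fun y _ => hasDerivAt_durations θ j w y) (hDc.intervalIntegrable _ _)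
    rw [stageCoeff_eq]
    rw [hftc, Real.norm_eq_abs, hz] at hint
    calc _ ≤ |z₀ w v| + |∫ y in (0 : ℝ)..x, riccati j v (fun u => stageCoeff j z₀ u v y) w| :=
          abs_add_le _ _
      _ ≤ _ := by linarith [hb w]

end Words

/-! ### The resolvent of a formal product -/

section Resolvent

/-- The geometric series `1 / (1 + v X)`. -/
def geomSeries (v : ℝ) : ℝ⟦X⟧ := mk fun k => (-v) ^ k

lemma geomSeries_mul (v : ℝ) : geomSeries v * (1 + C v * X) = 1 := by
  ext n
  rw [mul_add, mul_one, map_add, ← mul_assoc]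
  cases n with
  | zero => simp [geomSeries]
  | succ n =>
    rw [coeff_succ_mul_X, coeff_mul_C, geomSeries, coeff_mk, coeff_mk, PowerSeries.coeff_one,
      if_neg (by omega), pow_succ]
    ring

variable {R : Type*} [NormedRing R] [NormedAlgebra ℝ R]

lemma seriesEval_C_mul_X (v : ℝ) {P : R⟦X⟧} (hP : constantCoeff P = 0) :
    seriesEval (C v * X) P = v • P := by
  ext n
  rw [coeff_seriesEval _ hP (by omega : n < n + 2)]
  simp [PowerSeries.coeff_X, coeff_C_mul]

/-- `(1 + v P)⁻¹`. -/
def resolvent (v : ℝ) (P : R⟦X⟧) : R⟦X⟧ := seriesEval (geomSeries v) P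

lemma resolvent_mul (v : ℝ) {P : R⟦X⟧} (hP : constantCoeff P = 0) :
    resolvent v P * (1 + v • P) = 1 := by
  have h := seriesEval_mul (geomSeries v) (1 + C v * X) hP
  rw [geomSeries_mul, seriesEval_one, seriesEval_add, seriesEval_one, seriesEval_C_mul_X v hP] at h
  exact h.symm

lemma mul_resolvent (v : ℝ) {P : R⟦X⟧} (hP : constantCoeff P = 0) :
    (1 + v • P) * resolvent v P = 1 := by
  have h := seriesEval_mul (1 + C v * X) (geomSeries v) hP
  rw [mul_comm (1 + C v * X), geomSeries_mul, seriesEval_one, seriesEval_add, seriesEval_one,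
    seriesEval_C_mul_X v hP] at h
  exact h.symm

variable {m : ℕ} (A : Fin m → R)

lemma HasCoeffDeriv.const_smul {P P' : ℝ → R⟦X⟧} (h : HasCoeffDeriv P P') (v : ℝ) :
    HasCoeffDeriv (fun x => v • P x) (fun x => v • P' x) :=
  fun n x => (h n x).const_smul v

lemma HasCoeffDeriv.add {P P' Q Q' : ℝ → R⟦X⟧} (hP : HasCoeffDeriv P P')
    (hQ : HasCoeffDeriv Q Q') : HasCoeffDeriv (fun x => P x + Q x) (fun x => P' x + Q' x) := by
  intro n x
  simpa only [map_add] using (hP n x).fun_add (hQ n x)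

/-- The Riccati equation `Z' = -Z a + (1 - v) Z a Z` of `Z = (1 + v (U - 1))⁻¹`, for `U' = a U`. -/
lemma hasCoeffDeriv_resolvent (j : Fin m) (J : List (Fin m)) (v : ℝ) :
    HasCoeffDeriv (fun x => resolvent v (formalStage A j J x - 1)) fun x =>
      (1 - v) • (resolvent v (formalStage A j J x - 1) * monomial 1 ((1 / 2 : ℝ) • A j) *
          resolvent v (formalStage A j J x - 1)) -
        resolvent v (formalStage A j J x - 1) * monomial 1 ((1 / 2 : ℝ) • A j) := by
  set a : R⟦X⟧ := monomial 1 ((1 / 2 : ℝ) • A j) with ha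
  set U := formalStage A j J with hU
  have hc : ∀ x, constantCoeff (U x - 1) = 0 := fun x => by
    rw [map_sub, hU, constantCoeff_formalStage]; simp
  have hU' : HasCoeffDeriv U fun x => a * U x := hasCoeffDeriv_formalStage A j J
  have hV : HasCoeffDeriv (fun x => U x - 1) fun x => a * U x := by
    simpa using hU'.sub (HasCoeffDeriv.const 1)
  obtain ⟨Z', hZ⟩ := hV.exists_seriesEval hc (geomSeries v)
  have hZ : HasCoeffDeriv (fun x => resolvent v (U x - 1)) Z' := hZ
  have hM : HasCoeffDeriv (fun x => 1 + v • (U x - 1)) fun x => v • (a * U x) := by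
    simpa using (HasCoeffDeriv.const 1).add (hV.const_smul v)
  have h1 := hZ.mul hM
  have h2 : (fun x => resolvent v (U x - 1) * (1 + v • (U x - 1))) = fun _ => 1 :=
    funext fun x => resolvent_mul v (hc x)
  rw [h2] at h1
  convert hZ using 2 with x
  have h3 := congrFun (h1.unique (HasCoeffDeriv.const 1)) x
  have h4 := congrArg (fun Q => Q * resolvent v (U x - 1)) h3
  simp only [add_mul, zero_mul] at h4
  have h5 : Z' x * (1 + v • (U x - 1)) * resolvent v (U x - 1) = Z' x := by
    rw [mul_assoc, mul_resolvent v (hc x), mul_one]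
  have h6 : v • U x * resolvent v (U x - 1) = 1 - (1 - v) • resolvent v (U x - 1) := by
    have := mul_resolvent v (hc x)
    have h7 : (1 + v • (U x - 1)) = v • U x + (1 - v) • 1 := by
      rw [smul_sub, sub_smul, one_smul]; abel
    rw [h7, add_mul, smul_mul_assoc (1 - v), one_mul] at this
    exact eq_sub_of_add_eq this
  rw [h5] at h4
  have h8 : resolvent v (U x - 1) * v • (a * U x) * resolvent v (U x - 1) =
      resolvent v (U x - 1) * a * (v • U x * resolvent v (U x - 1)) := by
    simp only [mul_smul_comm, smul_mul_assoc, mul_assoc]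
  rw [h8, h6, mul_sub, mul_one, mul_smul_comm] at h4
  rw [eq_neg_of_add_eq_zero_left h4]
  abel

lemma coeff_mul_monomial_one (P : R⟦X⟧) (a : R) (n : ℕ) :
    coeff (n + 1) (P * monomial 1 a) = coeff n P * a := by
  rw [coeff_mul, sum_eq_single (n, 1)]
  · rw [coeff_monomial, if_pos rfl]
  · rintro ⟨i, k⟩ hp hne
    rw [HasAntidiagonal.mem_antidiagonal] at hp
    rw [coeff_monomial, if_neg, mul_zero]
    rintro rfl
    exact hne (by simp at hp ⊢; omega)
  · intro h; exact absurd (HasAntidiagonal.mem_antidiagonal.2 (by simp)) h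

lemma coeff_mul_monomial_one_mul (P Q : R⟦X⟧) (a : R) (n : ℕ) :
    coeff (n + 1) (P * monomial 1 a * Q) =
      ∑ p ∈ antidiagonal n, coeff p.1 P * a * coeff p.2 Q := by
  rw [coeff_mul, Nat.sum_antidiagonal_succ]
  have : coeff 0 (P * monomial 1 a) = 0 := by
    rw [coeff_zero_eq_constantCoeff_apply, map_mul, ← coeff_zero_eq_constantCoeff_apply (monomial 1 a),
      coeff_monomial]
    simp
  rw [this, zero_mul, zero_add]
  exact sum_congr rfl fun p _ => by rw [coeff_mul_monomial_one]

lemma constantCoeff_resolvent (v : ℝ) (P : R⟦X⟧) : constantCoeff (resolvent v P) = 1 := by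
  rw [resolvent, constantCoeff_seriesEval]
  simp [geomSeries, ← coeff_zero_eq_constantCoeff_apply]

/-- If the coefficients of the resolvent at the start of a stage are given by word coefficients
`z₀`, then along the stage they are given by `stageCoeff`. -/
lemma coeff_resolvent_formalStage (j : Fin m) (J : List (Fin m)) {z₀ : List (Fin m) → ℝ → ℝ}
    (h₀ : ∀ w, Continuous (z₀ w)) (hnil : ∀ v, z₀ [] v = 1)
    (hz : ∀ v q, coeff q (resolvent v (formalProd A J - 1)) = evalWords A (fun w => z₀ w v) q)
    (v x : ℝ) (q : ℕ) :
    coeff q (resolvent v (formalStage A j J x - 1)) =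
      evalWords A (fun w => stageCoeff j z₀ w v x) q := by
  induction q using Nat.strong_induction_on generalizing x with
  | _ q ih =>
    cases q with
    | zero =>
      rw [coeff_zero_eq_constantCoeff_apply, constantCoeff_resolvent]
      simp [evalWords, stageCoeff_nil, hnil]
    | succ q =>
      have hd1 := hasCoeffDeriv_resolvent A j J v (q + 1)
      have hd2 : ∀ y, HasDerivAt (fun y => evalWords A (fun w => stageCoeff j z₀ w v y) (q + 1))
          (evalWords A (riccati j v fun u => stageCoeff j z₀ u v y) (q + 1)) y := fun y =>
        hasDerivAt_evalWords A fun w _ => hasDerivAt_stageCoeff j h₀ w v y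
      have hd : ∀ y, HasDerivAt (fun y => coeff (q + 1) (resolvent v (formalStage A j J y - 1)) -
          evalWords A (fun w => stageCoeff j z₀ w v y) (q + 1)) 0 y := by
        intro y
        refine ((hd1 y).fun_sub (hd2 y)).congr_deriv ?_
        have hs : ∀ Q : R⟦X⟧, coeff (q + 1) ((1 - v) • Q) = (1 - v) • coeff (q + 1) Q :=
          fun _ => rfl
        rw [evalWords_riccati, map_sub, hs, coeff_mul_monomial_one, coeff_mul_monomial_one_mul,
          ih q (by omega) y]
        have : ∑ p ∈ antidiagonal q, coeff p.1 (resolvent v (formalStage A j J y - 1)) *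
            (1 / 2 : ℝ) • A j * coeff p.2 (resolvent v (formalStage A j J y - 1)) =
            (1 / 2 : ℝ) • ∑ p ∈ antidiagonal q, evalWords A (fun w => stageCoeff j z₀ w v y) p.1 *
              A j * evalWords A (fun w => stageCoeff j z₀ w v y) p.2 := by
          rw [smul_sum]
          refine sum_congr rfl fun p hp => ?_
          rw [HasAntidiagonal.mem_antidiagonal] at hp
          rw [ih p.1 (by omega) y, ih p.2 (by omega) y, mul_smul_comm, smul_mul_assoc]
        rw [this, smul_sub, smul_comm (1 - v), mul_smul_comm, sub_self]
      have h := is_const_of_deriv_eq_zero (fun y => (hd y).differentiableAt)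
        (fun y => (hd y).deriv) x 0
      simp only [formalStage_zero, stageCoeff_zero, hz, sub_self] at h
      exact sub_eq_zero.1 h

/-- Half the number of occurrences of a letter: the duration spent on it. -/
def halfCount (J : List (Fin m)) (l : Fin m) : ℝ := (J.count l : ℝ) / 2

lemma halfCount_nonneg (J : List (Fin m)) (l : Fin m) : 0 ≤ halfCount J l := by
  unfold halfCount; positivity

lemma advance_halfCount_one (j : Fin m) (J : List (Fin m)) :
    advance (halfCount J) j 1 = halfCount (j :: J) := by
  funext l
  simp only [advance, halfCount, List.count_cons]
  by_cases h : j = l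
  · subst h; simp; ring
  · simp [h, Ne.symm h]

/-- The coefficients of the resolvent `(1 + v (U - 1))⁻¹` of the formal product at a word are
bounded by the product of the durations of its letters. -/
theorem exists_coeff_resolvent (J : List (Fin m)) :
    ∃ z : List (Fin m) → ℝ → ℝ, (∀ w, Continuous (z w)) ∧ (∀ v, z [] v = 1) ∧
      (∀ v ∈ Set.Icc (0 : ℝ) 1, ∀ w, |z w v| ≤ durations (halfCount J) w) ∧
      ∀ v q, coeff q (resolvent v (formalProd A J - 1)) = evalWords A (fun w => z w v) q := by
  induction J with
  | nil =>
    refine ⟨fun w _ => if w = [] then 1 else 0, fun w => continuous_const, fun v => if_pos rfl,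
      fun v _ w => ?_, fun v q => ?_⟩
    · cases w <;> simp [durations, halfCount]
    · have h1 : resolvent v (formalProd A [] - 1) = (1 : R⟦X⟧) := by
        have h := resolvent_mul v (P := (0 : R⟦X⟧)) (by simp)
        simpa [formalProd] using h
      rw [h1, PowerSeries.coeff_one]
      cases q with
      | zero => simp [evalWords]
      | succ q =>
        simp only [evalWords, Nat.add_eq_zero_iff, one_ne_zero, and_false, if_false, reduceCtorEq]
        symm
        refine sum_eq_zero fun j _ => ?_
        rw [evalWords_zero, mul_zero]
  | cons j J ih =>
    obtain ⟨z₀, h₀, hnil, hb, hz⟩ := ih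
    refine ⟨fun w v => stageCoeff j z₀ w v 1, fun w => ?_, fun v => ?_, fun v hv w => ?_,
      fun v q => ?_⟩
    · exact (continuous_stageCoeff j h₀ w).comp (Continuous.prodMk_left 1)
    · exact (stageCoeff_nil j z₀ v 1).trans (hnil v)
    · rw [← advance_halfCount_one]
      exact abs_stageCoeff_le j hnil (halfCount_nonneg J) hv (hb v hv) w zero_le_one
    · rw [← formalStage_one]
      exact coeff_resolvent_formalStage A j J h₀ hnil hz v 1 q

end Resolvent

/-! ### The logarithm as a combination of nested commutators -/

section Commutators

variable {m : ℕ}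

/-- The right-nested commutator `[A₁, [A₂, …, [A_{q-1}, A_q] ⋯ ]]` in an arbitrary ring. -/
def ncomm {R : Type*} [Ring R] : List R → R
  | [] => 0
  | [A] => A
  | A :: B :: l => A * ncomm (B :: l) - ncomm (B :: l) * A

lemma ncomm_cons {R : Type*} [Ring R] (a : R) {l : List R} (hl : l ≠ []) :
    ncomm (a :: l) = a * ncomm l - ncomm l * a := by
  cases l with
  | nil => exact absurd rfl hl
  | cons b l => rfl

/-- The linear combination `∑_w c_w [A_{w₁}, …, A_{w_q}]` over the words of length `q`. -/
def evalComm {R : Type*} [Ring R] [Module ℝ R] (A : Fin m → R) (c : List (Fin m) → ℝ) (q : ℕ) : R :=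
  ∑ w : Fin q → Fin m, c (List.ofFn w) • ncomm (List.ofFn fun b => A (w b))

variable {R : Type*} [NormedRing R] [NormedAlgebra ℝ R] (A : Fin m → R)

lemma sum_fin_succ {M : Type*} [AddCommMonoid M] {q : ℕ} (f : (Fin (q + 1) → Fin m) → M) :
    ∑ w, f w = ∑ i : Fin m, ∑ w : Fin q → Fin m, f (Fin.cons i w) := by
  rw [← (Fin.consEquiv fun _ => Fin m).sum_comp, Fintype.sum_prod_type]
  rfl

lemma evalComm_succ (c : List (Fin m) → ℝ) (q : ℕ) : evalComm A c (q + 2) =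
    ∑ i, opApply (adCLM (A i)) (evalComm A (fun w => c (i :: w)) (q + 1)) := by
  rw [evalComm, sum_fin_succ]
  refine sum_congr rfl fun i _ => ?_
  rw [evalComm, map_sum]
  refine sum_congr rfl fun w _ => ?_
  rw [map_smul, adCLM_apply, List.ofFn_succ]
  congr 1
  rw [List.ofFn_succ, ncomm_cons]
  · simp
  · simp

/-- A noncommutative polynomial in the adjoint actions, applied to a letter, is a combination of
right-nested commutators that end in this letter. -/
lemma evalWords_adCLM_apply (c : List (Fin m) → ℝ) (q : ℕ) (j : Fin m) :
    opApply (evalWords (fun j => adCLM (A j)) c q) (A j) =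
      evalComm A (fun w => if w.getLast? = some j then c w.dropLast else 0) (q + 1) := by
  induction q generalizing c with
  | zero =>
    rw [evalComm, sum_fin_succ, sum_eq_single j]
    · simp [evalWords, opApply_one, ncomm]
    · intro i _ hi
      simp [hi]
    · simp
  | succ q ih =>
    rw [evalComm_succ, evalWords, map_sum, _root_.sum_apply]
    refine sum_congr rfl fun i _ => ?_
    rw [opApply_mul, ih]
    congr 1
    refine sum_congr rfl fun w _ => ?_
    congr 1
    have hw : List.ofFn w ≠ [] := by simp
    beta_reduce
    rw [List.getLast?_cons_of_ne_nil hw, List.dropLast_cons_of_ne_nil hw]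

lemma evalComm_smul (r : ℝ) (c : List (Fin m) → ℝ) (q : ℕ) :
    evalComm A (fun w => r * c w) q = r • evalComm A c q := by
  simp only [evalComm, smul_sum, mul_smul]

lemma hasDerivAt_evalComm {c c' : List (Fin m) → ℝ → ℝ} {x : ℝ}
    (h : ∀ w, HasDerivAt (c w) (c' w x) x) (q : ℕ) :
    HasDerivAt (fun y => evalComm A (fun w => c w y) q) (evalComm A (fun w => c' w x) q) x :=
  HasDerivAt.fun_sum fun _ _ => (h _).smul_const _

/-- Integration over a parameter acts on the word coefficients. -/
lemma evalWords_integral [CompleteSpace R] {z : List (Fin m) → ℝ → ℝ} (hz : ∀ w, Continuous (z w))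
    (q : ℕ) : Continuous (fun v => evalWords A (fun w => z w v) q) ∧
      ∫ v in (0 : ℝ)..1, evalWords A (fun w => z w v) q =
        evalWords A (fun w => ∫ v in (0 : ℝ)..1, z w v) q := by
  induction q generalizing z with
  | zero =>
    simp only [evalWords]
    exact ⟨(hz []).smul continuous_const, intervalIntegral.integral_smul_const _ _⟩
  | succ q ih =>
    have h := fun j : Fin m => ih (z := fun w => z (j :: w)) fun w => hz (j :: w)
    simp only [evalWords]
    refine ⟨continuous_finsetSum _ fun j _ => continuous_const.mul (h j).1, ?_⟩
    rw [intervalIntegral.integral_finsetSum]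
    swap
    · exact fun j _ => (continuous_const.mul (h j).1).intervalIntegrable _ _
    refine sum_congr rfl fun j _ => ?_
    rw [← (h j).2]
    exact ContinuousLinearMap.intervalIntegral_comp_comm (ContinuousLinearMap.mul ℝ R (A j))
      ((h j).1.intervalIntegrable _ _)

/-- `log (1 + P) / P = ∫₀¹ (1 + v P)⁻¹ dv`. -/
lemma coeff_logQuot_eq_integral [CompleteSpace R] (P : R⟦X⟧) (q : ℕ) :
    coeff q (seriesEval logQuot P) = ∫ v in (0 : ℝ)..1, coeff q (resolvent v P) := by
  simp only [resolvent, seriesEval, coeff_mk, geomSeries, logQuot]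
  rw [intervalIntegral.integral_finsetSum]
  · refine sum_congr rfl fun k _ => ?_
    rw [intervalIntegral.integral_smul_const]
    congr 1
    rw [intervalIntegral.integral_congr (g := fun v => (-1) ^ k * v ^ k) fun v _ => neg_pow v k,
      intervalIntegral.integral_const_mul, integral_pow, one_pow,
      zero_pow k.succ_ne_zero, sub_zero, mul_one_div]
  · intro k _
    exact Continuous.intervalIntegrable (by fun_prop) _ _

/-- The duration spent on the last letter of a word. -/
def lastDuration (J : List (Fin m)) (w : List (Fin m)) : ℝ := w.getLast?.elim 0 (halfCount J)

lemma lastDuration_nonneg (J w : List (Fin m)) : 0 ≤ lastDuration J w := by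
  unfold lastDuration
  cases w.getLast? with
  | none => simp
  | some l => exact halfCount_nonneg J l

lemma lastDuration_le_one {J : List (Fin m)} (hJ : ∀ l, J.count l ≤ 2) (w : List (Fin m)) :
    lastDuration J w ≤ 1 := by
  unfold lastDuration
  cases w.getLast? with
  | none => simp
  | some l =>
    have : (J.count l : ℝ) ≤ 2 := by exact_mod_cast hJ l
    simp only [Option.elim, halfCount]
    linarith

lemma lastDuration_cons (j : Fin m) (J w : List (Fin m)) :
    lastDuration (j :: J) w = lastDuration J w + if w.getLast? = some j then 1 / 2 else 0 := by
  unfold lastDuration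
  rcases h : w.getLast? with _ | l
  · simp
  · simp only [Option.elim, Option.some.injEq, ← advance_halfCount_one, advance]

variable [CompleteSpace R]

instance : CompleteSpace (Op R) := inferInstanceAs (CompleteSpace (R →L[ℝ] R))

/-- Along a stage of letter `j`, the derivative of the logarithm of the formal product is a
combination of right-nested commutators that end in `j`, with coefficients at most `1 / 2`. -/
lemma exists_deriv_log_coeff (j : Fin m) (J : List (Fin m)) (hJ : ∀ l, (j :: J).count l ≤ 2) :
    ∃ d : List (Fin m) → ℝ → ℝ, (∀ w, Continuous (d w)) ∧
      (∀ w, ∀ x ∈ Set.Icc (0 : ℝ) 1, |d w x| ≤ if w.getLast? = some j then 1 / 2 else 0) ∧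
      HasCoeffDeriv (fun x => flog (formalStage A j J x))
        (fun x => mk fun q => evalComm A (fun w => d w x) q) ∧
      ∀ x, dexpSeries (flog (formalStage A j J x)) (mk fun q => evalComm A (fun w => d w x) q) =
        monomial 1 ((1 / 2 : ℝ) • A j) := by
  obtain ⟨z₀, h₀, hnil, hb, hz⟩ := exists_coeff_resolvent (fun j => adCLM (A j)) J
  obtain ⟨Ω', h1, h2, h3, h4⟩ := exists_hasCoeffDeriv_flog_act A j J
  set d : List (Fin m) → ℝ → ℝ := fun w x => (1 / 2) *
    if w.getLast? = some j then ∫ v in (0 : ℝ)..1, stageCoeff j z₀ w.dropLast v x else 0 with hd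
  have hΩ : Ω' = fun x => mk fun q => evalComm A (fun w => d w x) q := by
    funext x
    ext q
    rw [coeff_mk]
    cases q with
    | zero =>
      rw [coeff_zero_eq_constantCoeff_apply, h2]
      simp [evalComm, ncomm]
    | succ q =>
      have hcoef : coeff q (seriesEval logQuot (formalStage (fun j => adCLM (A j)) j J x - 1)) =
          evalWords (fun j => adCLM (A j))
            (fun w => ∫ v in (0 : ℝ)..1, stageCoeff j z₀ w v x) q := by
        rw [coeff_logQuot_eq_integral, ← (evalWords_integral (fun j => adCLM (A j))
          (z := fun w v => stageCoeff j z₀ w v x)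
          (fun w => (continuous_stageCoeff j h₀ w).comp (Continuous.prodMk_left x)) q).2]
        simp only [coeff_resolvent_formalStage (fun j => adCLM (A j)) j J h₀ hnil hz]
      rw [h4, act, coeff_mk, sum_eq_single (q, 1)]
      · rw [coeff_monomial, if_pos rfl, map_smul, hcoef, evalWords_adCLM_apply, ← evalComm_smul]
      · rintro ⟨a, b⟩ hp hne
        rw [HasAntidiagonal.mem_antidiagonal] at hp
        rw [coeff_monomial, if_neg, map_zero]
        rintro rfl
        exact hne (by simp at hp ⊢; omega)
      · intro h; exact absurd (HasAntidiagonal.mem_antidiagonal.2 (by simp)) h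
  refine ⟨d, fun w => ?_, fun w x hx => ?_, hΩ ▸ h1, fun x => ?_⟩
  · refine continuous_const.mul ?_
    by_cases hw : w.getLast? = some j
    · simp only [hw, if_true]
      exact intervalIntegral.continuous_parametric_intervalIntegral_of_continuous'
        (f := fun x v => stageCoeff j z₀ w.dropLast v x)
        ((continuous_stageCoeff j h₀ w.dropLast).comp continuous_swap) 0 1
    · simp only [hw, if_false]
      exact continuous_const
  · rw [hd]
    simp only
    split_ifs with hw
    · rw [abs_mul, abs_of_pos (by norm_num : (0 : ℝ) < 1 / 2)]
      have : ‖∫ v in (0 : ℝ)..1, stageCoeff j z₀ w.dropLast v x‖ ≤ 1 * |(1 : ℝ) - 0| := by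
        refine intervalIntegral.norm_integral_le_of_norm_le_const fun v hv => ?_
        rw [Set.uIoc_of_le zero_le_one] at hv
        have hv' : v ∈ Set.Icc (0 : ℝ) 1 := ⟨hv.1.le, hv.2⟩
        refine (abs_stageCoeff_le j hnil (halfCount_nonneg J) hv' (hb v hv') _ hx.1).trans ?_
        refine durations_le_one (fun l => ?_) (fun l => ?_) _
        · unfold advance
          have := halfCount_nonneg J l
          split_ifs <;> linarith [hx.1]
        · have h5 : (((j :: J).count l : ℕ) : ℝ) ≤ 2 := by exact_mod_cast hJ l
          have h6 : advance (halfCount J) j x l ≤ advance (halfCount J) j 1 l := by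
            unfold advance
            split_ifs <;> linarith [hx.2]
          rw [advance_halfCount_one] at h6
          unfold halfCount at h6
          unfold halfCount
          linarith
      rw [Real.norm_eq_abs] at this
      norm_num at this ⊢
      linarith
    · simp
  · rw [← congrFun hΩ x]
    exact h3 x

/-- Word coefficients of the logarithm at the start of a stage propagate along the stage. -/
lemma exists_log_coeff_stage (j : Fin m) (J : List (Fin m)) (hJ : ∀ l, (j :: J).count l ≤ 2)
    {c₀ : List (Fin m) → ℝ} (hc₀ : ∀ w, |c₀ w| ≤ lastDuration J w)
    (hq₀ : ∀ q, coeff q (flog (formalProd A J)) = evalComm A c₀ q) :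
    ∃ c d : List (Fin m) → ℝ → ℝ,
      (∀ w, ∀ x ∈ Set.Icc (0 : ℝ) 1, |c w x| ≤ lastDuration (j :: J) w) ∧
      (∀ w, ∀ x ∈ Set.Icc (0 : ℝ) 1, |d w x| ≤ if w.getLast? = some j then 1 / 2 else 0) ∧
      (∀ q x, coeff q (flog (formalStage A j J x)) = evalComm A (fun w => c w x) q) ∧
      HasCoeffDeriv (fun x => flog (formalStage A j J x))
        (fun x => mk fun q => evalComm A (fun w => d w x) q) ∧
      ∀ x, dexpSeries (flog (formalStage A j J x)) (mk fun q => evalComm A (fun w => d w x) q) =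
        monomial 1 ((1 / 2 : ℝ) • A j) := by
  obtain ⟨d, hd, hdb, hder, hde⟩ := exists_deriv_log_coeff A j J hJ
  refine ⟨fun w x => c₀ w + ∫ y in (0 : ℝ)..x, d w y, d, fun w x hx => ?_, hdb, fun q x => ?_,
    hder, hde⟩
  · rw [lastDuration_cons]
    refine (abs_add_le _ _).trans (add_le_add (hc₀ w) ?_)
    have := intervalIntegral.norm_integral_le_of_norm_le_const (a := (0 : ℝ)) (b := x)
      (f := d w) (C := if w.getLast? = some j then 1 / 2 else 0) fun y hy => by
        rw [Set.uIoc_of_le hx.1] at hy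
        exact hdb w y ⟨hy.1.le, hy.2.trans hx.2⟩
    rw [sub_zero, abs_of_nonneg hx.1] at this
    refine this.trans (mul_le_of_le_one_right ?_ hx.2)
    split_ifs <;> norm_num
  · have h1 : ∀ x, HasDerivAt (fun y => coeff q (flog (formalStage A j J y)) -
        evalComm A (fun w => c₀ w + ∫ s in (0 : ℝ)..y, d w s) q) 0 x := by
      intro x
      refine ((hder q x).fun_sub (hasDerivAt_evalComm A (c' := d) (fun w => ?_) q)).congr_deriv ?_
      · exact (intervalIntegral.integral_hasDerivAt_right ((hd w).intervalIntegrable _ _)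
          (hd w).aestronglyMeasurable.stronglyMeasurableAtFilter (hd w).continuousAt).const_add _
      · rw [coeff_mk, sub_self]
    have h := is_const_of_deriv_eq_zero (fun y => (h1 y).differentiableAt)
      (fun y => (h1 y).deriv) x 0
    simp only [formalStage_zero, intervalIntegral.integral_same, add_zero, hq₀, sub_self] at h
    exact sub_eq_zero.1 h

/-- The coefficients of the logarithm of a formal product in which every letter occurs at most
twice: combinations of right-nested commutators, the coefficient of a word being at most the
duration of its last letter. -/
theorem exists_log_coeff (J : List (Fin m)) (hJ : ∀ l, J.count l ≤ 2) :
    ∃ c : List (Fin m) → ℝ, (∀ w, |c w| ≤ lastDuration J w) ∧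
      ∀ q, coeff q (flog (formalProd A J)) = evalComm A c q := by
  induction J with
  | nil =>
    refine ⟨fun _ => 0, fun w => by simpa using lastDuration_nonneg _ _, fun q => ?_⟩
    simp [formalProd, flog_one, evalComm]
  | cons j J ih =>
    obtain ⟨c₀, hc₀, hq₀⟩ := ih fun l => (List.count_le_count_cons).trans (hJ l)
    obtain ⟨c, d, hc, -, hq, -⟩ := exists_log_coeff_stage A j J hJ hc₀ hq₀
    refine ⟨fun w => c w 1, fun w => hc w 1 ⟨zero_le_one, le_rfl⟩, fun q => ?_⟩
    rw [← formalStage_one]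
    exact hq q 1

end Commutators

/-! ### Oddness of the logarithm of a palindromic product -/

section Symmetry

variable {R : Type*} [NormedRing R] [NormedAlgebra ℝ R]

/-- The substitution `X ↦ -X`. -/
def negX (P : R⟦X⟧) : R⟦X⟧ := mk fun n => (-1 : ℝ) ^ n • coeff n P

lemma negX_mul (P Q : R⟦X⟧) : negX (P * Q) = negX P * negX Q := by
  ext n
  simp only [negX, coeff_mk, coeff_mul, smul_sum]
  refine sum_congr rfl fun p hp => ?_
  rw [HasAntidiagonal.mem_antidiagonal] at hp
  rw [smul_mul_smul_comm, ← pow_add, hp]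

lemma negX_one : negX (1 : R⟦X⟧) = 1 := by
  ext n
  cases n <;> simp [negX, PowerSeries.coeff_one]

lemma negX_pow (P : R⟦X⟧) (k : ℕ) : negX (P ^ k) = negX P ^ k := by
  induction k with
  | zero => simp [negX_one]
  | succ k ih => rw [pow_succ, pow_succ, negX_mul, ih]

lemma negX_seriesEval (f : ℝ⟦X⟧) (P : R⟦X⟧) : negX (seriesEval f P) = seriesEval f (negX P) := by
  ext n
  simp only [negX, seriesEval, coeff_mk, smul_sum]
  refine sum_congr rfl fun k _ => ?_
  have := congrArg (coeff n) (negX_pow P k)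
  rw [negX, coeff_mk] at this
  rw [smul_comm, this]
  rfl

lemma negX_flog (U : R⟦X⟧) : negX (flog U) = flog (negX U) := by
  rw [flog, flog, negX_seriesEval]
  congr 1
  ext n
  cases n <;> simp [negX, PowerSeries.coeff_one, smul_sub]

lemma negX_expLin (a : R) (x : ℝ) : negX (expLin a x) = expLin (-a) x := by
  ext n
  simp only [negX, expLin, coeff_mk]
  rcases Nat.even_or_odd n with hn | hn
  · rw [hn.neg_pow, hn.neg_pow]; simp
  · rw [hn.neg_pow, hn.neg_pow]; simp

lemma monomial_one_pow (a : R) (k : ℕ) : (monomial 1 a : R⟦X⟧) ^ k = monomial k (a ^ k) := by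
  induction k with
  | zero => simp
  | succ k ih => rw [pow_succ, ih, monomial_mul_monomial, pow_succ]

lemma expLin_one_eq_fexp (a : R) : expLin a 1 = fexp (monomial 1 a) := by
  ext n
  simp only [expLin, seriesEval, coeff_mk, monomial_one_pow, coeff_monomial]
  rw [sum_eq_single n]
  · simp
  · intro k _ hk
    rw [if_neg (Ne.symm hk), smul_zero]
  · simp

lemma expLin_mul_neg (a : R) : expLin a 1 * expLin (-a) 1 = 1 := by
  have h0 : constantCoeff (monomial 1 a : R⟦X⟧) = 0 := by
    rw [← coeff_zero_eq_constantCoeff_apply, coeff_monomial]; simp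
  rw [expLin_one_eq_fexp, expLin_one_eq_fexp, map_neg, fexp_mul_fexp_neg h0]

variable {m : ℕ} (A : Fin m → R)

lemma negX_formalProd (J : List (Fin m)) : negX (formalProd A J) = formalProd (-A) J := by
  induction J with
  | nil => simp [formalProd, negX_one]
  | cons j J ih =>
    simp only [formalProd, List.map_cons, List.prod_cons] at ih ⊢
    rw [negX_mul, ih, negX_expLin, Pi.neg_apply, smul_neg]

lemma formalProd_mul_reverse (J : List (Fin m)) :
    formalProd A J * formalProd (-A) J.reverse = 1 := by
  induction J with
  | nil => simp [formalProd]
  | cons j J ih =>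
    simp only [formalProd, List.map_cons, List.prod_cons, List.reverse_cons, List.map_append,
      List.prod_append, List.map_nil, List.prod_nil, mul_one, Pi.neg_apply, smul_neg] at ih ⊢
    rw [mul_assoc, ← mul_assoc (List.prod _) (List.prod _), ih, one_mul, expLin_mul_neg]

/-- The logarithm of a palindromic product is odd. -/
lemma coeff_flog_formalProd_even {J : List (Fin m)} (hJ : J.reverse = J) {q : ℕ} (hq : Even q) :
    coeff q (flog (formalProd A J)) = 0 := by
  have hc := constantCoeff_flog (formalProd A J)
  have h1 : fexp (-flog (formalProd A J)) = formalProd (-A) J := by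
    have h2 := formalProd_mul_reverse A J
    rw [hJ] at h2
    have h3 := fexp_mul_fexp_neg (P := -flog (formalProd A J)) (by rw [map_neg, hc, neg_zero])
    rw [neg_neg, fexp_flog (constantCoeff_formalProd A J)] at h3
    calc _ = fexp (-flog (formalProd A J)) * (formalProd A J * formalProd (-A) J) := by
          rw [h2, mul_one]
      _ = _ := by rw [← mul_assoc, h3, one_mul]
  have h4 : negX (flog (formalProd A J)) = -flog (formalProd A J) := by
    rw [negX_flog, negX_formalProd, ← h1, flog_fexp (by rw [map_neg, hc, neg_zero])]
  have h5 := congrArg (coeff q) h4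
  rw [negX, coeff_mk, hq.neg_one_pow, one_smul, map_neg] at h5
  have h6 : (2 : ℝ) • coeff q (flog (formalProd A J)) = 0 := by
    rw [two_smul]; nth_rewrite 1 [h5]; simp
  exact (smul_eq_zero.1 h6).resolve_left two_ne_zero

lemma coeff_one_flog_formalProd (J : List (Fin m)) :
    coeff 1 (flog (formalProd A J)) = (J.map fun j => (1 / 2 : ℝ) • A j).sum := by
  have h1 : ∀ U : R⟦X⟧, coeff 1 (flog U) = coeff 1 U := fun U => by
    simp [flog, seriesEval, sum_range_succ, PowerSeries.coeff_one]
  rw [h1]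
  induction J with
  | nil => simp [formalProd, PowerSeries.coeff_one]
  | cons j J ih =>
    have h2 : formalProd A (j :: J) = expLin ((1 / 2 : ℝ) • A j) 1 * formalProd A J := by
      simp [formalProd]
    rw [h2, coeff_mul, Nat.sum_antidiagonal_succ, Nat.antidiagonal_zero, sum_singleton, ih,
      coeff_zero_eq_constantCoeff_apply, constantCoeff_expLin]
    have h3 : coeff 0 (formalProd A J) = 1 := by
      rw [coeff_zero_eq_constantCoeff_apply, constantCoeff_formalProd]
    change 1 * _ + coeff 1 _ * coeff 0 (formalProd A J) = _
    rw [h3]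
    simp [expLin, add_comm]

end Symmetry

end

section

open Finset

/-! ### The derivative of the exponential in a Banach algebra -/

section Dexp

variable {R : Type*} [NormedRing R] [NormedAlgebra ℝ R]

/-- The series `∑ₖ [a, …, [a, b]] / (k + 1)!`, the derivative of the exponential at `a` in
direction `b`, times `e^{-a}`. -/
def dexp (a b : R) : R := ∑' k : ℕ, (1 / ((k + 1).factorial : ℝ)) • adPow a k b

lemma norm_adPow_le (a b : R) (k : ℕ) : ‖adPow a k b‖ ≤ (2 * ‖a‖) ^ k * ‖b‖ := by
  induction k with
  | zero => simp [adPow]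
  | succ k ih =>
    rw [adPow]
    calc ‖a * adPow a k b - adPow a k b * a‖
        ≤ ‖a‖ * ‖adPow a k b‖ + ‖adPow a k b‖ * ‖a‖ :=
          (norm_sub_le _ _).trans (add_le_add (norm_mul_le _ _) (norm_mul_le _ _))
      _ = 2 * ‖a‖ * ‖adPow a k b‖ := by ring
      _ ≤ 2 * ‖a‖ * ((2 * ‖a‖) ^ k * ‖b‖) := by gcongr
      _ = _ := by ring

lemma summable_norm_dexp (a b : R) :
    Summable fun k : ℕ => ‖(1 / ((k + 1).factorial : ℝ)) • adPow a k b‖ := by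
  refine Summable.of_nonneg_of_le (fun _ => norm_nonneg _) (fun k => ?_)
    ((Real.summable_pow_div_factorial (2 * ‖a‖)).mul_right ‖b‖)
  rw [norm_smul, Real.norm_of_nonneg (by positivity)]
  have h1 : (1 : ℝ) / ((k + 1).factorial : ℝ) ≤ 1 / (k.factorial : ℝ) :=
    one_div_le_one_div_of_le (by positivity) (by exact_mod_cast Nat.factorial_le (Nat.le_succ k))
  calc _ ≤ 1 / (k.factorial : ℝ) * ((2 * ‖a‖) ^ k * ‖b‖) := by
        gcongr; exact norm_adPow_le a b k
    _ = _ := by ring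

lemma hasDerivAt_line_pow (a b : R) (n : ℕ) (t : ℝ) :
    HasDerivAt (fun s : ℝ => (a + s • b) ^ n)
      (∑ i ∈ range n, (a + t • b) ^ i * b * (a + t • b) ^ (n - 1 - i)) t := by
  have hl : HasDerivAt (fun s : ℝ => a + s • b) b t := by
    simpa using ((hasDerivAt_id t).smul_const b).const_add a
  induction n with
  | zero => simpa using hasDerivAt_const t (1 : R)
  | succ n ih =>
    have h := ih.mul hl
    have h2 : (fun s : ℝ => (a + s • b) ^ (n + 1)) =
        (fun s : ℝ => (a + s • b) ^ n) * fun s : ℝ => a + s • b := by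
      funext s; exact pow_succ _ _
    rw [h2]
    refine h.congr_deriv ?_
    rw [sum_range_succ, sum_mul]
    simp only [Nat.add_sub_cancel, Nat.sub_self, pow_zero, mul_one]
    congr 1
    refine sum_congr rfl fun i hi => ?_
    have : i < n := by simpa using hi
    rw [show n - i = (n - 1 - i) + 1 by omega, pow_succ, mul_assoc _ _ (a + t • b)]

variable [CompleteSpace R]

lemma hasSum_exp_real (x : R) :
    HasSum (fun n : ℕ => (1 / (n.factorial : ℝ)) • x ^ n) (NormedSpace.exp x) := by
  simpa using NormedSpace.exp_series_hasSum_exp' (𝕂 := ℝ) x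

lemma norm_sum_pow_mul_pow_le [NormOneClass R] {x : R} {M : ℝ} (hM : 1 ≤ M) (hx : ‖x‖ ≤ M) (b : R)
    (n : ℕ) : ‖(1 / (n.factorial : ℝ)) • ∑ i ∈ range n, x ^ i * b * x ^ (n - 1 - i)‖ ≤
      (2 * M) ^ n / n.factorial * ‖b‖ := by
  rw [norm_smul, Real.norm_of_nonneg (by positivity)]
  have h1 : ‖∑ i ∈ range n, x ^ i * b * x ^ (n - 1 - i)‖ ≤ (2 * M) ^ n * ‖b‖ := by
    calc ‖∑ i ∈ range n, x ^ i * b * x ^ (n - 1 - i)‖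
        ≤ ∑ i ∈ range n, M ^ n * ‖b‖ := by
          refine norm_sum_le_of_le _ fun i hi => ?_
          have hi' : i < n := by simpa using hi
          calc ‖x ^ i * b * x ^ (n - 1 - i)‖ ≤ ‖x‖ ^ i * ‖b‖ * ‖x‖ ^ (n - 1 - i) := by
                refine (norm_mul_le _ _).trans ?_
                gcongr
                · refine (norm_mul_le _ _).trans ?_
                  gcongr
                  exact norm_pow_le _ _
                · exact norm_pow_le _ _
            _ ≤ M ^ i * ‖b‖ * M ^ (n - 1 - i) := by gcongr
            _ = M ^ (i + (n - 1 - i)) * ‖b‖ := by rw [pow_add]; ring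
            _ ≤ M ^ n * ‖b‖ := by gcongr; omega
      _ = n * (M ^ n * ‖b‖) := by simp
      _ ≤ 2 ^ n * (M ^ n * ‖b‖) := by gcongr; exact_mod_cast Nat.lt_two_pow_self.le
      _ = _ := by rw [mul_pow]; ring
  calc _ ≤ 1 / (n.factorial : ℝ) * ((2 * M) ^ n * ‖b‖) := by gcongr
    _ = _ := by ring

/-- The derivative of the exponential at `a` in direction `b`, by termwise differentiation of the
exponential series. -/
lemma hasDerivAt_exp_line [NormOneClass R] (a b : R) :
    HasDerivAt (fun s : ℝ => NormedSpace.exp (a + s • b)) (dexp a b * NormedSpace.exp a) 0 := by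
  have hexp : (fun s : ℝ => NormedSpace.exp (a + s • b)) =
      fun s : ℝ => ∑' n : ℕ, (1 / (n.factorial : ℝ)) • (a + s • b) ^ n :=
    funext fun s => (hasSum_exp_real _).tsum_eq.symm
  set M : ℝ := ‖a‖ + ‖b‖ + 1 with hM
  have hM1 : 1 ≤ M := by rw [hM]; linarith [norm_nonneg a, norm_nonneg b]
  have hder := hasDerivAt_tsum_of_isPreconnected (𝕜 := ℝ) (F := R)
    (g := fun n s => (1 / (n.factorial : ℝ)) • (a + s • b) ^ n)
    (g' := fun n s => (1 / (n.factorial : ℝ)) •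
      ∑ i ∈ range n, (a + s • b) ^ i * b * (a + s • b) ^ (n - 1 - i))
    (u := fun n => (2 * M) ^ n / n.factorial * ‖b‖) (y₀ := 0) (y := 0)
    ((Real.summable_pow_div_factorial (2 * M)).mul_right _)
    (Metric.isOpen_ball (x := (0 : ℝ)) (ε := 1)) (convex_ball 0 1).isPreconnected
    (fun n y _ => (hasDerivAt_line_pow a b n y).fun_const_smul _) ?_ (by simp)
    (hasSum_exp_real _).summable (by simp)
  · rw [hexp]
    refine hder.congr_deriv ?_
    simp only [zero_smul, add_zero]
    rw [dexp, ← (hasSum_exp_real a).tsum_eq, tsum_mul_tsum_eq_tsum_sum_antidiagonal_of_summable_norm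
      (summable_norm_dexp a b) ?_]
    · have hs : Summable fun n : ℕ => (1 / (n.factorial : ℝ)) •
          ∑ i ∈ range n, a ^ i * b * a ^ (n - 1 - i) := by
        refine Summable.of_norm_bounded
            ((Real.summable_pow_div_factorial (2 * M)).mul_right _) fun n =>
            norm_sum_pow_mul_pow_le hM1 ?_ b n
        rw [hM]; linarith [norm_nonneg b]
      rw [hs.tsum_eq_zero_add]
      simp only [range_zero, sum_empty, smul_zero, zero_add]
      refine tsum_congr fun n => ?_
      rw [sum_pow_mul_pow_eq, Nat.sum_antidiagonal_eq_sum_range_succ_mk, smul_sum]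
      refine sum_congr rfl fun k hk => ?_
      have hk' : k ≤ n := by simpa [Nat.lt_succ_iff] using hk
      rw [← Nat.cast_smul_eq_nsmul ℝ, smul_smul, Nat.add_sub_cancel, smul_mul_smul_comm]
      congr 1
      have := Nat.choose_mul_factorial_mul_factorial (by omega : k + 1 ≤ n + 1)
      rw [Nat.add_sub_add_right] at this
      have h2 : ((n + 1).choose (k + 1) : ℝ) * ((k + 1).factorial : ℝ) * ((n - k).factorial : ℝ) =
          ((n + 1).factorial : ℝ) := by
        exact_mod_cast this
      have h3 : ((k + 1).factorial : ℝ) ≠ 0 := by positivity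
      have h4 : ((n - k).factorial : ℝ) ≠ 0 := by positivity
      have h5 : ((n + 1).factorial : ℝ) ≠ 0 := by positivity
      field_simp
      linear_combination h2
    · have := NormedSpace.norm_expSeries_summable' (𝕂 := ℝ) a
      simpa using this
  · intro n y hy
    refine norm_sum_pow_mul_pow_le hM1 ?_ b n
    have hy' : |y| < 1 := by simpa using hy
    calc ‖a + y • b‖ ≤ ‖a‖ + |y| * ‖b‖ := (norm_add_le _ _).trans (by rw [norm_smul, Real.norm_eq_abs])
      _ ≤ ‖a‖ + 1 * ‖b‖ := by gcongr
      _ ≤ M := by rw [hM]; linarith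

/-- The derivative of the exponential of a curve. -/
lemma _root_.HasDerivAt.exp_dexp [NormOneClass R] {f : ℝ → R} {f' : R} {x : ℝ}
    (hf : HasDerivAt f f' x) :
    HasDerivAt (fun s => NormedSpace.exp (f s)) (dexp (f x) f' * NormedSpace.exp (f x)) x := by
  have hd : DifferentiableAt ℝ (NormedSpace.exp : R → R) (f x) :=
    (NormedSpace.exp_analytic (𝕂 := ℝ) (f x)).differentiableAt
  have h1 : HasDerivAt (fun s : ℝ => NormedSpace.exp (f x + s • f'))
      (fderiv ℝ (NormedSpace.exp : R → R) (f x) f') 0 := by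
    have hl : HasDerivAt (fun s : ℝ => f x + s • f') f' 0 := by
      simpa using ((hasDerivAt_id (0 : ℝ)).smul_const f').const_add (f x)
    have := hd.hasFDerivAt
    rw [show f x = f x + (0 : ℝ) • f' by simp] at this
    have h2 := this.comp_hasDerivAt (0 : ℝ) hl
    simpa [Function.comp_def] using h2
  have h3 := hd.hasFDerivAt.comp_hasDerivAt x hf
  rw [h1.unique (hasDerivAt_exp_line (f x) f')] at h3
  exact h3

end Dexp

end

section

open PowerSeries Finset

/-! ### Commutators of graded sums -/

section Graded

variable {R : Type*} [Ring R]

/-- The nested commutator `[Ω_{q₀}, …, [Ω_{q_{k-1}}, Ω'_{q_k}] ⋯ ]`. -/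
def gradedComm {k : ℕ} (Ω Ω' : ℕ → R) (q : Fin (k + 1) → ℕ) : R :=
  ncomm (List.ofFn fun i => if i = Fin.last k then Ω' (q i) else Ω (q i))

lemma gradedComm_zero (Ω Ω' : ℕ → R) (q : Fin 1 → ℕ) : gradedComm Ω Ω' q = Ω' (q 0) := by
  simp [gradedComm, ncomm]

lemma gradedComm_cons {k : ℕ} (Ω Ω' : ℕ → R) (a : ℕ) (q : Fin (k + 1) → ℕ) :
    gradedComm Ω Ω' (Fin.cons a q : Fin (k + 2) → ℕ) =
      Ω a * gradedComm Ω Ω' q - gradedComm Ω Ω' q * Ω a := by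
  rw [gradedComm, List.ofFn_succ, ncomm_cons _ (by simp)]
  have h : (0 : Fin (k + 2)) ≠ Fin.last (k + 1) := (Fin.last_pos).ne
  have h' : (List.ofFn fun i : Fin (k + 1) => if i.succ = Fin.last (k + 1) then
      Ω' ((Fin.cons a q : Fin (k + 2) → ℕ) i.succ) else
        Ω ((Fin.cons a q : Fin (k + 2) → ℕ) i.succ)) =
      List.ofFn fun i : Fin (k + 1) => if i = Fin.last k then Ω' (q i) else Ω (q i) := by
    congr 1
    funext i
    rw [← Fin.succ_last]
    simp only [Fin.succ_inj, Fin.cons_succ]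
  rw [if_neg h, Fin.cons_zero, h', gradedComm]

lemma sum_piFinset_succ {M : Type*} [AddCommMonoid M] {k : ℕ} (s : Finset ℕ)
    (f : (Fin (k + 1) → ℕ) → M) :
    ∑ q ∈ Fintype.piFinset (fun _ : Fin (k + 1) => s), f q =
      ∑ a ∈ s, ∑ q ∈ Fintype.piFinset (fun _ : Fin k => s), f (Fin.cons a q) := by
  rw [← sum_product']
  refine (sum_bij' (fun p _ => (Fin.cons p.1 p.2 : Fin (k + 1) → ℕ))
    (fun q _ => (q 0, Fin.tail q)) ?_ ?_ ?_ ?_ ?_).symm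
  · rintro ⟨a, q⟩ h
    simp only [mem_product, Fintype.mem_piFinset] at h ⊢
    exact Fin.cases h.1 h.2
  · intro q h
    simp only [mem_product, Fintype.mem_piFinset] at h ⊢
    exact ⟨h 0, fun i => h i.succ⟩
  · simp
  · simp
  · simp

/-- Expansion of iterated commutators of two graded sums. The grading is given by additive maps
`e q` with `e p x * e q y = e (p + q) (x * y)`. -/
lemma adPow_sum_graded {S : Type*} [Ring S] (e : ℕ → R →+ S)
    (he : ∀ p q x y, e p x * e q y = e (p + q) (x * y)) (Ω Ω' : ℕ → R) (s : Finset ℕ) (k : ℕ) :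
    adPow (∑ q ∈ s, e q (Ω q)) k (∑ q ∈ s, e q (Ω' q)) =
      ∑ q ∈ Fintype.piFinset (fun _ : Fin (k + 1) => s), e (∑ i, q i) (gradedComm Ω Ω' q) := by
  induction k with
  | zero =>
    rw [adPow, sum_piFinset_succ]
    simp [gradedComm_zero]
  | succ k ih =>
    rw [adPow, ih, sum_piFinset_succ s (k := k + 1), sum_mul, mul_sum, ← sum_sub_distrib]
    refine sum_congr rfl fun a _ => ?_
    rw [sum_mul, mul_sum, ← sum_sub_distrib]
    refine sum_congr rfl fun q _ => ?_
    rw [he, he, gradedComm_cons, map_sub, Fin.sum_univ_succ (n := k + 1)]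
    simp [add_comm]

lemma coeff_mul_congr {P P' Q Q' : R⟦X⟧} {N : ℕ} (hP : ∀ i ≤ N, coeff i P = coeff i P')
    (hQ : ∀ i ≤ N, coeff i Q = coeff i Q') : ∀ i ≤ N, coeff i (P * Q) = coeff i (P' * Q') := by
  intro i hi
  rw [coeff_mul, coeff_mul]
  refine sum_congr rfl fun p hp => ?_
  rw [HasAntidiagonal.mem_antidiagonal] at hp
  rw [hP _ (by omega), hQ _ (by omega)]

lemma coeff_adPow_congr {P P' Q Q' : R⟦X⟧} {N : ℕ} (hP : ∀ i ≤ N, coeff i P = coeff i P')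
    (hQ : ∀ i ≤ N, coeff i Q = coeff i Q') (k : ℕ) :
    ∀ i ≤ N, coeff i (adPow P k Q) = coeff i (adPow P' k Q') := by
  induction k with
  | zero => exact hQ
  | succ k ih =>
    intro i hi
    rw [adPow, adPow, map_sub, map_sub, coeff_mul_congr hP ih i hi, coeff_mul_congr ih hP i hi]

lemma coeff_sum_monomial_Icc {P : R⟦X⟧} (h0 : constantCoeff P = 0) (N : ℕ) :
    ∀ i ≤ N, coeff i P = coeff i (∑ q ∈ Icc 1 N, monomial q (coeff q P)) := by
  intro i hi
  rw [map_sum]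
  rcases Nat.eq_zero_or_pos i with rfl | h
  · rw [coeff_zero_eq_constantCoeff_apply, h0, sum_eq_zero]
    intro q hq
    have : 1 ≤ q := (mem_Icc.1 hq).1
    rw [coeff_monomial, if_neg (by omega)]
  · rw [sum_eq_single i]
    · simp
    · intro q _ hq
      rw [coeff_monomial, if_neg (Ne.symm hq)]
    · intro h'
      exact absurd (mem_Icc.2 ⟨h, hi⟩) h'

/-- The coefficients of iterated commutators of series, expanded by the grades of the factors. -/
lemma coeff_adPow_eq_sum {P Q : R⟦X⟧} (hP : constantCoeff P = 0) (hQ : constantCoeff Q = 0)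
    {N i : ℕ} (hi : i ≤ N) (k : ℕ) : coeff i (adPow P k Q) =
      ∑ q ∈ Fintype.piFinset (fun _ : Fin (k + 1) => Icc 1 N) with ∑ a, q a = i,
        gradedComm (fun n => coeff n P) (fun n => coeff n Q) q := by
  rw [coeff_adPow_congr (coeff_sum_monomial_Icc hP N) (coeff_sum_monomial_Icc hQ N) k i hi]
  have := adPow_sum_graded (fun q => ((monomial q : R →ₗ[R] R⟦X⟧) : R →+ R⟦X⟧))
    (fun p q x y => by simp [monomial_mul_monomial]) (fun n => coeff n P) (fun n => coeff n Q)
    (Icc 1 N) k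
  erw [this]
  rw [map_sum, sum_filter]
  refine sum_congr rfl fun q _ => ?_
  refine (coeff_monomial _ _ _).trans ?_
  simp only [eq_comm]

lemma card_le_sum {k N : ℕ} {q : Fin k → ℕ} (hq : q ∈ Fintype.piFinset fun _ : Fin k => Icc 1 N) :
    k ≤ ∑ a, q a := by
  calc k = ∑ _a : Fin k, 1 := by simp
    _ ≤ _ := sum_le_sum fun a _ => (mem_Icc.1 (Fintype.mem_piFinset.1 hq a)).1

end Graded

/-! ### Nested commutators as multilinear maps -/

section Multilinear

variable {R : Type*} [Ring R] [Algebra ℝ R]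

/-- The commutator with `a`, as a linear map. -/
def commLin : R →ₗ[ℝ] R →ₗ[ℝ] R := LinearMap.mul ℝ R - (LinearMap.mul ℝ R).flip

lemma commLin_apply (a b : R) : commLin a b = a * b - b * a := rfl

/-- The right-nested commutator as a multilinear map. -/
def ncommMulti : (n : ℕ) → MultilinearMap ℝ (fun _ : Fin (n + 1) => R) R
  | 0 => MultilinearMap.ofSubsingleton ℝ R R (0 : Fin 1) LinearMap.id
  | n + 1 => LinearMap.uncurryLeft (M := fun _ : Fin (n + 2) => R)
      { toFun := fun a => (commLin a).compMultilinearMap (ncommMulti n)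
        map_add' := fun a b => by ext v; simp
        map_smul' := fun c a => by ext v; simp }

lemma ncommMulti_apply (n : ℕ) (v : Fin (n + 1) → R) :
    ncommMulti n v = ncomm (List.ofFn v) := by
  induction n with
  | zero => simp [ncommMulti, ncomm]
  | succ n ih =>
    rw [List.ofFn_succ, ncomm_cons _ (by simp), ← ih, ← commLin_apply]
    rfl

lemma ncomm_ofFn_sum_smul {n : ℕ} {α : Fin (n + 1) → Type*} [∀ i, Fintype (α i)]
    (c : (i : Fin (n + 1)) → α i → ℝ) (v : (i : Fin (n + 1)) → α i → R) :
    ncomm (List.ofFn fun i => ∑ x, c i x • v i x) =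
      ∑ x : (i : Fin (n + 1)) → α i, (∏ i, c i (x i)) • ncomm (List.ofFn fun i => v i (x i)) := by
  classical
  rw [← ncommMulti_apply, MultilinearMap.map_sum]
  refine sum_congr rfl fun x _ => ?_
  rw [MultilinearMap.map_smul_univ, ncommMulti_apply]

end Multilinear

/-! ### Norms of nested commutators -/

section Norms

variable {R : Type*} [NormedRing R]

lemma norm_ncomm_le (l : List R) : ‖ncomm l‖ ≤ (l.map fun a => 2 * ‖a‖).prod := by
  induction l with
  | nil => simp [ncomm]
  | cons a l ih =>
    rcases eq_or_ne l [] with rfl | hl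
    · simp only [ncomm, List.map_cons, List.map_nil, List.prod_cons, List.prod_nil]
      linarith [norm_nonneg a]
    · rw [ncomm_cons a hl, List.map_cons, List.prod_cons]
      calc ‖a * ncomm l - ncomm l * a‖ ≤ ‖a‖ * ‖ncomm l‖ + ‖ncomm l‖ * ‖a‖ :=
            (norm_sub_le _ _).trans (add_le_add (norm_mul_le _ _) (norm_mul_le _ _))
        _ = 2 * ‖a‖ * ‖ncomm l‖ := by ring
        _ ≤ _ := by gcongr

end Norms

/-! ### Commutators of total grade above the truncation -/

section Tails

variable {m : ℕ} {R : Type*} [NormedRing R]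

/-- The sum of the norms of the right-nested commutators of `q` letters. -/
def gradeNorm (A : Fin m → R) (q : ℕ) : ℝ :=
  ∑ w : Fin q → Fin m, ‖ncomm (List.ofFn fun b => A (w b))‖

/-- The weighted sum of the norms of the doubly right-nested commutators of grades `q`; the weight
depends on the last inner word. -/
def weightedCommNorm (A : Fin m → R) (W : List (Fin m) → ℝ) {k : ℕ} (q : Fin (k + 1) → ℕ) : ℝ :=
  ∑ w : (a : Fin (k + 1)) → Fin (q a) → Fin m, W (List.ofFn (w (Fin.last k))) *
    ‖ncomm (List.ofFn fun a => ncomm (List.ofFn fun b => A (w a b)))‖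

/-- The term with `k + 1` inner commutators of the series `weightedTail`. -/
def tailTerm (A : Fin m → R) (W : List (Fin m) → ℝ) (q₀ : ℕ) (τ : ℝ) (k : ℕ) : ℝ :=
  1 / ((k + 1).factorial : ℝ) *
    ∑ q ∈ (Fintype.piFinset fun _ : Fin (k + 1) => Icc 1 q₀) with q₀ + 1 ≤ ∑ a, q a,
      weightedCommNorm A W q * τ ^ (∑ a, q a)

/-- The weighted version of the series `alphaTrunc`. -/
def weightedTail (A : Fin m → R) (W : List (Fin m) → ℝ) (q₀ : ℕ) (τ : ℝ) : ℝ :=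
  ∑' k, tailTerm A W q₀ τ k

lemma gradeNorm_nonneg (A : Fin m → R) (q : ℕ) : 0 ≤ gradeNorm A q :=
  sum_nonneg fun _ _ => norm_nonneg _

lemma weightedCommNorm_nonneg (A : Fin m → R) {W : List (Fin m) → ℝ} (hW : ∀ w, 0 ≤ W w) {k : ℕ}
    (q : Fin (k + 1) → ℕ) : 0 ≤ weightedCommNorm A W q :=
  sum_nonneg fun _ _ => mul_nonneg (hW _) (norm_nonneg _)

lemma weightedCommNorm_mono (A : Fin m → R) {W W' : List (Fin m) → ℝ} (h : ∀ w, W w ≤ W' w)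
    {k : ℕ} (q : Fin (k + 1) → ℕ) : weightedCommNorm A W q ≤ weightedCommNorm A W' q :=
  sum_le_sum fun _ _ => mul_le_mul_of_nonneg_right (h _) (norm_nonneg _)

lemma weightedCommNorm_add (A : Fin m → R) (W W' : List (Fin m) → ℝ) {k : ℕ}
    (q : Fin (k + 1) → ℕ) : weightedCommNorm A (fun w => W w + W' w) q =
      weightedCommNorm A W q + weightedCommNorm A W' q := by
  simp only [weightedCommNorm, add_mul, sum_add_distrib]

lemma weightedCommNorm_one_le (A : Fin m → R) {k : ℕ} (q : Fin (k + 1) → ℕ) :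
    weightedCommNorm A (fun _ => 1) q ≤ ∏ a, (2 * gradeNorm A (q a)) := by
  simp only [gradeNorm, mul_sum]
  rw [prod_univ_sum, Fintype.piFinset_univ]
  refine sum_le_sum fun w _ => ?_
  rw [one_mul]
  refine (norm_ncomm_le _).trans_eq ?_
  rw [List.map_ofFn, List.prod_ofFn]
  rfl

lemma tailTerm_nonneg (A : Fin m → R) {W : List (Fin m) → ℝ} (hW : ∀ w, 0 ≤ W w) (q₀ : ℕ)
    {τ : ℝ} (hτ : 0 ≤ τ) (k : ℕ) : 0 ≤ tailTerm A W q₀ τ k :=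
  mul_nonneg (by positivity) (sum_nonneg fun _ _ =>
    mul_nonneg (weightedCommNorm_nonneg A hW _) (by positivity))

lemma tailTerm_mono (A : Fin m → R) {W W' : List (Fin m) → ℝ} (h : ∀ w, W w ≤ W' w) (q₀ : ℕ)
    {τ : ℝ} (hτ : 0 ≤ τ) (k : ℕ) : tailTerm A W q₀ τ k ≤ tailTerm A W' q₀ τ k := by
  unfold tailTerm
  gcongr
  exact weightedCommNorm_mono A h _

lemma tailTerm_add (A : Fin m → R) (W W' : List (Fin m) → ℝ) (q₀ : ℕ) (τ : ℝ) (k : ℕ) :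
    tailTerm A (fun w => W w + W' w) q₀ τ k = tailTerm A W q₀ τ k + tailTerm A W' q₀ τ k := by
  simp only [tailTerm, weightedCommNorm_add, add_mul, sum_add_distrib, mul_add]

/-- The sum over all grades, without the constraint on their total, factorizes. -/
lemma sum_weightedCommNorm_one_le (A : Fin m → R) (q₀ : ℕ) {τ : ℝ} (hτ : 0 ≤ τ) (k : ℕ) :
    ∑ q ∈ Fintype.piFinset fun _ : Fin (k + 1) => Icc 1 q₀,
      weightedCommNorm A (fun _ => 1) q * τ ^ (∑ a, q a) ≤
      (∑ q ∈ Icc 1 q₀, 2 * gradeNorm A q * τ ^ q) ^ (k + 1) := by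
  have h : (∑ q ∈ Icc 1 q₀, 2 * gradeNorm A q * τ ^ q) ^ (k + 1) =
      ∏ _a : Fin (k + 1), ∑ q ∈ Icc 1 q₀, 2 * gradeNorm A q * τ ^ q := by simp
  rw [h, prod_univ_sum]
  refine sum_le_sum fun q _ => ?_
  rw [prod_mul_distrib, prod_pow_eq_pow_sum]
  gcongr
  exact weightedCommNorm_one_le A q

lemma summable_tailTerm (A : Fin m → R) {W : List (Fin m) → ℝ} (hW : ∀ w, 0 ≤ W w)
    (hW1 : ∀ w, W w ≤ 1) (q₀ : ℕ) {τ : ℝ} (hτ : 0 ≤ τ) : Summable (tailTerm A W q₀ τ) := by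
  set c := ∑ q ∈ Icc 1 q₀, 2 * gradeNorm A q * τ ^ q
  refine Summable.of_nonneg_of_le (tailTerm_nonneg A hW q₀ hτ) (fun k => ?_)
    ((summable_nat_add_iff 1).2 (Real.summable_pow_div_factorial c))
  calc tailTerm A W q₀ τ k ≤ tailTerm A (fun _ => 1) q₀ τ k := tailTerm_mono A hW1 q₀ hτ k
    _ ≤ 1 / ((k + 1).factorial : ℝ) * c ^ (k + 1) := by
        unfold tailTerm
        gcongr
        refine le_trans (sum_le_sum_of_subset_of_nonneg (filter_subset _ _) fun q _ _ => ?_)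
          (sum_weightedCommNorm_one_le A q₀ hτ k)
        exact mul_nonneg (weightedCommNorm_nonneg A (fun _ => zero_le_one) _) (by positivity)
    _ = _ := by ring

lemma weightedTail_nonneg (A : Fin m → R) {W : List (Fin m) → ℝ} (hW : ∀ w, 0 ≤ W w)
    (q₀ : ℕ) {τ : ℝ} (hτ : 0 ≤ τ) : 0 ≤ weightedTail A W q₀ τ :=
  tsum_nonneg (tailTerm_nonneg A hW q₀ hτ)

lemma weightedTail_mono (A : Fin m → R) {W W' : List (Fin m) → ℝ} (hW : ∀ w, 0 ≤ W w)
    (h : ∀ w, W w ≤ W' w) (hW1 : ∀ w, W' w ≤ 1) (q₀ : ℕ) {τ : ℝ} (hτ : 0 ≤ τ) :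
    weightedTail A W q₀ τ ≤ weightedTail A W' q₀ τ :=
  (summable_tailTerm A hW (fun w => (h w).trans (hW1 w)) q₀ hτ).tsum_le_tsum
    (tailTerm_mono A h q₀ hτ) (summable_tailTerm A (fun w => (hW w).trans (h w)) hW1 q₀ hτ)

lemma weightedTail_add (A : Fin m → R) {W W' : List (Fin m) → ℝ} (hW : ∀ w, 0 ≤ W w)
    (hW' : ∀ w, 0 ≤ W' w) (hW1 : ∀ w, W w + W' w ≤ 1) (q₀ : ℕ) {τ : ℝ} (hτ : 0 ≤ τ) :
    weightedTail A (fun w => W w + W' w) q₀ τ =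
      weightedTail A W q₀ τ + weightedTail A W' q₀ τ := by
  simp only [weightedTail, tailTerm_add]
  exact Summable.tsum_add
    (summable_tailTerm A hW (fun w => by linarith [hW1 w, hW' w]) q₀ hτ)
    (summable_tailTerm A hW' (fun w => by linarith [hW1 w, hW w]) q₀ hτ)

variable [NormedAlgebra ℝ R]

/-- Expand each grade into right-nested commutators; the innermost factor carries the weight. -/
lemma norm_gradedComm_le (A : Fin m → R) {c d W : List (Fin m) → ℝ} (hc : ∀ w, |c w| ≤ 1)
    (hd : ∀ w, |d w| ≤ W w) {k : ℕ} (q : Fin (k + 1) → ℕ) :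
    ‖gradedComm (evalComm A c) (evalComm A d) q‖ ≤ weightedCommNorm A W q := by
  have h : gradedComm (evalComm A c) (evalComm A d) q = ncomm (List.ofFn fun i : Fin (k + 1) =>
      ∑ w : Fin (q i) → Fin m, (if i = Fin.last k then d (List.ofFn w) else c (List.ofFn w)) •
        ncomm (List.ofFn fun b => A (w b))) := by
    rw [gradedComm]
    congr 2
    funext i
    split_ifs <;> rfl
  rw [h, ncomm_ofFn_sum_smul (R := R) (α := fun i => Fin (q i) → Fin m)
    (fun i w => if i = Fin.last k then d (List.ofFn w) else c (List.ofFn w))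
    (fun i w => ncomm (List.ofFn fun b => A (w b)))]
  refine norm_sum_le_of_le _ fun w _ => ?_
  rw [norm_smul]
  gcongr
  rw [Real.norm_eq_abs, Fin.prod_univ_castSucc, abs_mul, if_pos rfl]
  calc _ ≤ 1 * W (List.ofFn (w (Fin.last k))) := by
        gcongr
        · rw [abs_prod]
          refine prod_le_one (fun _ _ => abs_nonneg _) fun i _ => ?_
          rw [if_neg (Fin.castSucc_lt_last i).ne]
          exact hc _
        · exact hd _
    _ = _ := one_mul _

lemma sum_piFinset_filter_le {M : Type*} [AddCommMonoid M] (k q₀ : ℕ)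
    (f : (Fin (k + 1) → ℕ) → M) :
    ∑ q ∈ (Fintype.piFinset fun _ : Fin (k + 1) => Icc 1 q₀) with ¬ q₀ + 1 ≤ ∑ a, q a, f q =
      ∑ g ∈ range (q₀ + 1),
        ∑ q ∈ (Fintype.piFinset fun _ : Fin (k + 1) => Icc 1 q₀) with ∑ a, q a = g, f q := by
  rw [← sum_fiberwise_of_maps_to (g := fun q : Fin (k + 1) → ℕ => ∑ a, q a)
    (t := range (q₀ + 1))]
  · refine sum_congr rfl fun g hg => ?_
    rw [filter_filter]
    refine sum_congr (filter_congr fun q _ => ?_) fun _ _ => rfl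
    have : g < q₀ + 1 := by simpa using hg
    constructor
    · exact fun h => h.2
    · rintro rfl; exact ⟨by omega, rfl⟩
  · intro q hq
    simpa using (mem_filter.1 hq).2

variable [CompleteSpace R]

/-- If the logarithm `Ω` of a formal curve and its derivative `Ω'` satisfy `dexp(Ω) Ω' = a X`
formally, then their truncations at grade `q₀`, evaluated at `τ`, satisfy this up to the
commutators of total grade above `q₀`. -/
lemma norm_dexp_truncation_sub_le (A : Fin m → R) {c d W : List (Fin m) → ℝ}
    (hc : ∀ w, |c w| ≤ 1) (hW : ∀ w, 0 ≤ W w) (hW1 : ∀ w, W w ≤ 1)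
    (hd : ∀ w, |d w| ≤ W w) {Ω : R⟦X⟧} (h0 : constantCoeff Ω = 0)
    (hΩ : ∀ q, coeff q Ω = evalComm A c q) {a : R}
    (h : dexpSeries Ω (mk fun q => evalComm A d q) = monomial 1 a)
    {q₀ : ℕ} (hq₀ : 1 ≤ q₀) {τ : ℝ} (hτ : 0 ≤ τ) :
    ‖dexp (∑ q ∈ Icc 1 q₀, τ ^ q • coeff q Ω) (∑ q ∈ Icc 1 q₀, τ ^ q • evalComm A d q) - τ • a‖ ≤
      weightedTail A W q₀ τ := by
  set Ω' : R⟦X⟧ := mk fun q => evalComm A d q with hΩ'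
  have h0' : constantCoeff Ω' = 0 := by
    rw [← coeff_zero_eq_constantCoeff_apply, hΩ', coeff_mk, evalComm]
    simp [ncomm]
  set G : (k : ℕ) → (Fin (k + 1) → ℕ) → R := fun k q =>
    gradedComm (evalComm A c) (evalComm A d) q with hG
  have hexp : ∀ k, adPow (∑ q ∈ Icc 1 q₀, τ ^ q • coeff q Ω) k
      (∑ q ∈ Icc 1 q₀, τ ^ q • evalComm A d q) =
      ∑ q ∈ Fintype.piFinset (fun _ : Fin (k + 1) => Icc 1 q₀), τ ^ (∑ i, q i) • G k q := by
    intro k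
    have := adPow_sum_graded (fun q => DistribSMul.toAddMonoidHom R (τ ^ q))
      (fun p q x y => by
        simp only [DistribSMul.toAddMonoidHom_apply]
        rw [smul_mul_smul_comm, pow_add]) (evalComm A c) (evalComm A d) (Icc 1 q₀) k
    simp only [DistribSMul.toAddMonoidHom_apply] at this
    rw [← this]
    simp only [hΩ]
  -- the part of total grade at most `q₀`
  set L : ℕ → R := fun k => (1 / ((k + 1).factorial : ℝ)) •
    ∑ q ∈ (Fintype.piFinset fun _ : Fin (k + 1) => Icc 1 q₀) with ¬ q₀ + 1 ≤ ∑ a, q a,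
      τ ^ (∑ i, q i) • G k q with hL
  set T : ℕ → R := fun k => (1 / ((k + 1).factorial : ℝ)) •
    ∑ q ∈ (Fintype.piFinset fun _ : Fin (k + 1) => Icc 1 q₀) with q₀ + 1 ≤ ∑ a, q a,
      τ ^ (∑ i, q i) • G k q with hT
  have hTle : ∀ k, ‖T k‖ ≤ tailTerm A W q₀ τ k := by
    intro k
    rw [hT, norm_smul, Real.norm_of_nonneg (by positivity), tailTerm]
    gcongr
    refine norm_sum_le_of_le _ fun q _ => ?_
    rw [norm_smul, Real.norm_of_nonneg (by positivity), mul_comm]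
    gcongr
    exact norm_gradedComm_le A hc hd q
  have hTs : Summable T := Summable.of_norm_bounded (summable_tailTerm A hW hW1 q₀ hτ) hTle
  have hL0 : ∀ k ∉ range q₀, L k = 0 := by
    intro k hk
    have hk' : q₀ ≤ k := by simpa using hk
    rw [hL]
    simp only
    rw [filter_eq_empty_iff.2, sum_empty, smul_zero]
    intro q hq
    have := card_le_sum hq
    omega
  have hLsum : ∑' k, L k = τ • a := by
    rw [tsum_eq_sum (s := range q₀) fun k hk => hL0 k hk]
    have h1 : ∀ k, L k = ∑ g ∈ range (q₀ + 1), τ ^ g •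
        ((1 / ((k + 1).factorial : ℝ)) • coeff g (adPow Ω k Ω')) := by
      intro k
      rw [hL]
      simp only
      rw [sum_piFinset_filter_le, smul_sum]
      refine sum_congr rfl fun g hg => ?_
      have hg' : g ≤ q₀ := by simpa [Nat.lt_succ_iff] using hg
      rw [coeff_adPow_eq_sum h0 h0' hg' k, smul_sum, smul_sum, smul_sum]
      refine sum_congr rfl fun q hq => ?_
      rw [(mem_filter.1 hq).2, smul_comm, hG]
      simp only [hΩ, hΩ', coeff_mk]
    simp only [h1]
    rw [sum_comm]
    have h2 : ∀ g ∈ range (q₀ + 1), ∑ k ∈ range q₀, τ ^ g •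
        ((1 / ((k + 1).factorial : ℝ)) • coeff g (adPow Ω k Ω')) =
        τ ^ g • coeff g (monomial 1 a) := by
      intro g hg
      have hg' : g ≤ q₀ := by simpa [Nat.lt_succ_iff] using hg
      rw [← h, coeff_dexpSeries h0 h0' (N := q₀ + 1) (by omega), sum_range_succ,
        coeff_adPow_of_lt h0 h0' (n := g) (k := q₀) (by omega), smul_zero, add_zero, smul_sum]
    rw [sum_congr rfl h2, sum_eq_single 1]
    · simp
    · intro g _ hg
      rw [coeff_monomial, if_neg hg, smul_zero]
    · intro h'
      exact absurd (mem_range.2 (by omega)) h'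
  have hsplit : dexp (∑ q ∈ Icc 1 q₀, τ ^ q • coeff q Ω)
      (∑ q ∈ Icc 1 q₀, τ ^ q • evalComm A d q) = ∑' k, T k + ∑' k, L k := by
    rw [← hTs.tsum_add (summable_of_ne_finset_zero hL0), dexp]
    refine tsum_congr fun k => ?_
    rw [hexp, hT, hL]
    simp only
    rw [← smul_add, sum_filter_add_sum_filter_not]
  rw [hsplit, hLsum, add_sub_cancel_right]
  exact tsum_of_norm_bounded (summable_tailTerm A hW hW1 q₀ hτ).hasSum hTle

end Tails

end

section

open PowerSeries Finset Filter Topology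

/-! ### Dissipative elements and Grönwall's inequality -/

section Dissipative

variable {R : Type*} [NormedRing R] [NormedAlgebra ℝ R]

/-- Dissipative elements of a Banach algebra: `‖1 + h a‖ ≤ 1 + O(h²)` for `h ≥ 0`. These generate
contraction semigroups. -/
def Dissipative (a : R) : Prop := ∃ K : ℝ, ∀ h : ℝ, 0 ≤ h → ‖1 + h • a‖ ≤ 1 + K * h ^ 2

lemma Dissipative.smul {a : R} (ha : Dissipative a) {c : ℝ} (hc : 0 ≤ c) : Dissipative (c • a) := by
  obtain ⟨K, hK⟩ := ha
  refine ⟨K * c ^ 2, fun h hh => ?_⟩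
  rw [smul_smul]
  refine (hK (h * c) (by positivity)).trans_eq ?_
  ring

lemma Dissipative.add {a b : R} (ha : Dissipative a) (hb : Dissipative b) :
    Dissipative (a + b) := by
  obtain ⟨K, hK⟩ := ha
  obtain ⟨K', hK'⟩ := hb
  refine ⟨2 * K + 2 * K', fun h hh => ?_⟩
  have h1 : 1 + h • (a + b) = (1 / 2 : ℝ) • (1 + (2 * h) • a) + (1 / 2 : ℝ) • (1 + (2 * h) • b) := by
    module
  rw [h1]
  refine (norm_add_le _ _).trans ?_
  rw [norm_smul, norm_smul, Real.norm_of_nonneg (by norm_num)]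
  have := hK (2 * h) (by positivity)
  have := hK' (2 * h) (by positivity)
  nlinarith

lemma Dissipative.zero [NormOneClass R] : Dissipative (0 : R) := ⟨0, fun h _ => by simp⟩

lemma Dissipative.sum [NormOneClass R] {ι : Type*} (s : Finset ι) {f : ι → R}
    (hf : ∀ i ∈ s, Dissipative (f i)) : Dissipative (∑ i ∈ s, f i) := by
  classical
  induction s using Finset.induction_on with
  | empty => simpa using Dissipative.zero
  | insert i s hi ih =>
    rw [sum_insert hi]
    exact (hf i (mem_insert_self _ _)).add (ih fun j hj => hf j (mem_insert_of_mem hj))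

/-- Grönwall's inequality for the inhomogeneous equation `u' = a u + g` with dissipative `a`. -/
lemma Dissipative.norm_le_gronwallBound {a : R} (ha : Dissipative a) {u g : ℝ → R} {r ε : ℝ}
    (hu : ∀ x ∈ Set.Icc (0 : ℝ) 1, HasDerivAt u (a * u x + g x) x)
    (hg : ∀ x ∈ Set.Icc (0 : ℝ) 1, ‖g x‖ ≤ r * ‖u x‖ + ε) :
    ‖u 1‖ ≤ gronwallBound ‖u 0‖ r ε 1 := by
  obtain ⟨K, hK⟩ := ha
  have := le_gronwallBound_of_liminf_deriv_right_le (f := fun x => ‖u x‖) (f' := fun x => ‖g x‖)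
    (δ := ‖u 0‖) (K := r) (ε := ε) (a := 0) (b := 1)
    (fun x hx => (hu x hx).continuousAt.norm.continuousWithinAt) ?_ le_rfl
    (fun x hx => hg x ⟨hx.1, hx.2.le⟩) 1 ⟨zero_le_one, le_rfl⟩
  · simpa using this
  intro x hx s hs
  refine Eventually.frequently ?_
  have hd := (hu x ⟨hx.1, hx.2.le⟩).tendsto_slope
  have hd' : Tendsto (slope u x) (𝓝[>] x) (𝓝 (a * u x + g x)) :=
    hd.mono_left (nhdsWithin_mono _ fun y hy => (ne_of_gt hy : y ≠ x))
  -- the slope of the norm is at most `‖slope u - a u‖ + K h ‖u‖`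
  have hlim : Tendsto (fun z => ‖slope u x z - a * u x‖ + K * (z - x) * ‖u x‖) (𝓝[>] x)
      (𝓝 (‖g x‖)) := by
    have h1 : Tendsto (fun z : ℝ => K * (z - x) * ‖u x‖) (𝓝[>] x) (𝓝 0) := by
      have : ContinuousAt (fun z : ℝ => K * (z - x) * ‖u x‖) x := by fun_prop
      have h := this.tendsto.mono_left (nhdsWithin_le_nhds (s := Set.Ioi x))
      simpa using h
    have h2 := (hd'.sub_const (a * u x)).norm.add h1
    simpa using h2
  filter_upwards [hlim.eventually_lt_const hs, self_mem_nhdsWithin] with z hz hzx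
  refine lt_of_le_of_lt ?_ hz
  have hpos : 0 < z - x := sub_pos.2 hzx
  have hdec : u z = (1 + (z - x) • a) * u x + (z - x) • (slope u x z - a * u x) := by
    rw [smul_sub, sub_smul_slope, vsub_eq_sub, add_mul, one_mul, smul_mul_assoc]
    abel
  have hle : ‖u z‖ ≤ (1 + K * (z - x) ^ 2) * ‖u x‖ + (z - x) * ‖slope u x z - a * u x‖ := by
    calc ‖u z‖ ≤ ‖1 + (z - x) • a‖ * ‖u x‖ + (z - x) * ‖slope u x z - a * u x‖ := by
          conv_lhs => rw [hdec]
          refine (norm_add_le _ _).trans (add_le_add (norm_mul_le _ _) ?_)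
          rw [norm_smul, Real.norm_of_nonneg hpos.le]
      _ ≤ _ := by gcongr; exact hK _ hpos.le
  rw [inv_mul_le_iff₀ hpos]
  nlinarith

variable [CompleteSpace R] [NormOneClass R]

/-- Perturbation of a contraction semigroup. -/
lemma Dissipative.norm_exp_add_le {a : R} (ha : Dissipative a) (b : R) :
    ‖NormedSpace.exp (a + b)‖ ≤ Real.exp ‖b‖ := by
  have h := ha.norm_le_gronwallBound (u := fun x : ℝ => NormedSpace.exp (x • (a + b)))
    (g := fun x : ℝ => b * NormedSpace.exp (x • (a + b))) (r := ‖b‖) (ε := 0)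
    (fun x _ => by
      have := hasDerivAt_exp_smul_const' (𝕂 := ℝ) (a + b) x
      rwa [add_mul] at this)
    (fun x _ => by rw [add_zero]; exact norm_mul_le _ _)
  simpa [gronwallBound_ε0] using h

lemma Dissipative.norm_exp_le {a : R} (ha : Dissipative a) : ‖NormedSpace.exp a‖ ≤ 1 := by
  simpa using ha.norm_exp_add_le 0

/-- Two curves with the generators `a` and `a + ρ x`, where `‖ρ x‖ ≤ r`. -/
lemma Dissipative.norm_sub_add_one_le {a : R} (ha : Dissipative a) {Y U ρ : ℝ → R} {r : ℝ}
    (hY : ∀ x ∈ Set.Icc (0 : ℝ) 1, HasDerivAt Y ((a + ρ x) * Y x) x)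
    (hU : ∀ x ∈ Set.Icc (0 : ℝ) 1, HasDerivAt U (a * U x) x)
    (hρ : ∀ x ∈ Set.Icc (0 : ℝ) 1, ‖ρ x‖ ≤ r) (hU1 : ∀ x ∈ Set.Icc (0 : ℝ) 1, ‖U x‖ ≤ 1) :
    ‖Y 1 - U 1‖ + 1 ≤ (‖Y 0 - U 0‖ + 1) * Real.exp r := by
  have h := ha.norm_le_gronwallBound (u := fun x => Y x - U x) (g := fun x => ρ x * Y x)
    (r := r) (ε := r)
    (fun x hx => by
      refine ((hY x hx).fun_sub (hU x hx)).congr_deriv ?_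
      rw [add_mul, mul_sub]; abel)
    (fun x hx => by
      have hr : 0 ≤ r := (norm_nonneg _).trans (hρ x hx)
      calc ‖ρ x * Y x‖ ≤ ‖ρ x‖ * ‖Y x‖ := norm_mul_le _ _
        _ ≤ r * (‖Y x - U x‖ + ‖U x‖) := by
            gcongr
            · exact hρ x hx
            · simpa using norm_add_le (Y x - U x) (U x)
        _ ≤ r * (‖Y x - U x‖ + 1) := by gcongr; exact hU1 x hx
        _ = _ := by ring)
  rcases eq_or_ne r 0 with rfl | hr
  · simp only [gronwallBound_K0] at h
    simp only [Real.exp_zero]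
    linarith
  · rw [gronwallBound_of_K_ne_0 hr] at h
    simp only [mul_one, div_self hr, one_mul] at h
    linarith

end Dissipative

/-! ### The effective generator of the product formula -/

section Stages

variable {m : ℕ} {R : Type*} [NormedRing R] [NormedAlgebra ℝ R] [CompleteSpace R]

/-- The product of the exponentials of `(τ/2) A_j`, `j` running through the list `J`. -/
def stageProd (A : Fin m → R) (τ : ℝ) (J : List (Fin m)) : R :=
  (J.map fun j => NormedSpace.exp ((τ / 2) • A j)).prod

/-- The logarithm of the product formula, truncated at grade `q₀`. -/
def truncLog (A : Fin m → R) (q₀ : ℕ) (τ : ℝ) (J : List (Fin m)) : R :=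
  ∑ q ∈ Icc 1 q₀, τ ^ q • coeff q (flog (formalProd A J))

variable [NormOneClass R]

lemma norm_stageProd_le {A : Fin m → R} (hA : ∀ j, Dissipative (A j)) {τ : ℝ} (hτ : 0 ≤ τ)
    (J : List (Fin m)) : ‖stageProd A τ J‖ ≤ 1 := by
  induction J with
  | nil => simp [stageProd]
  | cons j J ih =>
    rw [stageProd, List.map_cons, List.prod_cons]
    refine (norm_mul_le _ _).trans (mul_le_one₀ ?_ (norm_nonneg _) ih)
    exact ((hA j).smul (by positivity)).norm_exp_le

/-- The error of the truncated logarithm, accumulated one stage at a time: a stage of letter `j`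
adds the commutators whose last inner word ends in `j`, with weight `1 / 2`, and these weights add
up to the duration of the last letter. -/
theorem norm_exp_truncLog_sub_le {A : Fin m → R} (hA : ∀ j, Dissipative (A j)) {q₀ : ℕ}
    (hq₀ : 1 ≤ q₀) {τ : ℝ} (hτ : 0 ≤ τ) (J : List (Fin m)) (hJ : ∀ l, J.count l ≤ 2) :
    ‖NormedSpace.exp (truncLog A q₀ τ J) - stageProd A τ J‖ + 1 ≤
      Real.exp (weightedTail A (lastDuration J) q₀ τ) := by
  induction J with
  | nil =>
    have : truncLog A q₀ τ [] = 0 := by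
      simp [truncLog, formalProd, flog_one]
    rw [this, stageProd]
    simp only [NormedSpace.exp_zero, List.map_nil, List.prod_nil, sub_self, norm_zero, zero_add]
    exact Real.one_le_exp (weightedTail_nonneg A (lastDuration_nonneg _) q₀ hτ)
  | cons j J ih =>
    have hJ' : ∀ l, J.count l ≤ 2 := fun l => List.count_le_count_cons.trans (hJ l)
    have ih := ih hJ'
    obtain ⟨c₀, hc₀, hq⟩ := exists_log_coeff A J hJ'
    obtain ⟨c, d, hc, hd, hcq, hder, hde⟩ := exists_log_coeff_stage A j J hJ hc₀ hq
    set W : List (Fin m) → ℝ := fun w => if w.getLast? = some j then 1 / 2 else 0 with hW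
    have hW0 : ∀ w, 0 ≤ W w := fun w => by rw [hW]; positivity
    have hW1 : ∀ w, lastDuration J w + W w ≤ 1 := fun w => by
      rw [hW, ← lastDuration_cons]; exact lastDuration_le_one hJ w
    -- the truncated logarithm along the stage; its exponential is compared with the exact flow
    set Z : ℝ → R := fun x => ∑ q ∈ Icc 1 q₀, τ ^ q • coeff q (flog (formalStage A j J x)) with hZ
    set Z' : ℝ → R := fun x => ∑ q ∈ Icc 1 q₀, τ ^ q • evalComm A (fun w => d w x) q with hZ'
    have hZd : ∀ x, HasDerivAt Z (Z' x) x := by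
      intro x
      refine HasDerivAt.fun_sum fun q _ => ?_
      have := (hder q x).fun_const_smul (τ ^ q)
      simpa using this
    set a : R := (τ / 2) • A j with ha
    have hρ : ∀ x ∈ Set.Icc (0 : ℝ) 1, ‖dexp (Z x) (Z' x) - a‖ ≤ weightedTail A W q₀ τ := by
      intro x hx
      have := norm_dexp_truncation_sub_le A (c := fun w => c w x) (d := fun w => d w x) (W := W)
        (fun w => (hc w x hx).trans (lastDuration_le_one hJ w)) hW0
        (fun w => by linarith [hW1 w, lastDuration_nonneg J w]) (fun w => hd w x hx)
        (Ω := flog (formalStage A j J x))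
        (constantCoeff_flog _) (fun q => hcq q x) (hde x) hq₀ hτ
      rwa [smul_smul, mul_one_div] at this
    have e1 : Z 1 = truncLog A q₀ τ (j :: J) := by rw [hZ]; simp only [formalStage_one]; rfl
    have e0 : Z 0 = truncLog A q₀ τ J := by rw [hZ]; simp only [formalStage_zero]; rfl
    have hY : ∀ x, HasDerivAt (fun x => NormedSpace.exp (Z x))
        (dexp (Z x) (Z' x) * NormedSpace.exp (Z x)) x := fun x => (hZd x).exp_dexp
    clear_value Z Z'
    have hdis : Dissipative a := (hA j).smul (by positivity)
    have hUd : ∀ x : ℝ, HasDerivAt (fun x : ℝ => NormedSpace.exp (x • a) * stageProd A τ J)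
        (a * (NormedSpace.exp (x • a) * stageProd A τ J)) x := fun x => by
      rw [← mul_assoc]
      exact (hasDerivAt_exp_smul_const' (𝕂 := ℝ) a x).mul_const (stageProd A τ J)
    have hU1 : ∀ x ∈ Set.Icc (0 : ℝ) 1, ‖NormedSpace.exp (x • a) * stageProd A τ J‖ ≤ 1 :=
      fun x hx => (norm_mul_le _ _).trans (mul_le_one₀ (hdis.smul hx.1).norm_exp_le (norm_nonneg _)
        (norm_stageProd_le hA hτ J))
    have hYd : ∀ x, HasDerivAt (fun x => NormedSpace.exp (Z x))
        ((a + (dexp (Z x) (Z' x) - a)) * NormedSpace.exp (Z x)) x := fun x => by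
      rw [add_sub_cancel]; exact hY x
    have key := hdis.norm_sub_add_one_le (fun x _ => hYd x) (fun x _ => hUd x) hρ hU1
    have eU : NormedSpace.exp a * stageProd A τ J = stageProd A τ (j :: J) := by
      rw [stageProd, stageProd, List.map_cons, List.prod_cons]
    simp only [e1, e0, one_smul, eU, zero_smul, NormedSpace.exp_zero, one_mul] at key
    refine key.trans ?_
    have : lastDuration (j :: J) = fun w => lastDuration J w + W w := by
      funext w; rw [lastDuration_cons]
    rw [this, weightedTail_add A (lastDuration_nonneg J) hW0 hW1 q₀ hτ, Real.exp_add]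
    gcongr

/-- The list of stages of the second-order product formula. -/
def palindrome (m : ℕ) : List (Fin m) := (List.finRange m).reverse ++ List.finRange m

lemma reverse_palindrome (m : ℕ) : (palindrome m).reverse = palindrome m := by
  simp [palindrome]

lemma count_palindrome (m : ℕ) (l : Fin m) : (palindrome m).count l = 2 := by
  simp [palindrome, List.count_append, List.count_reverse,
    List.count_eq_one_of_mem (List.nodup_finRange m) (List.mem_finRange l)]

/-- The second-order product formula of dissipative generators is, up to the commutators of total
grade above `q₀`, the exponential of an odd polynomial in `τ`, whose coefficients are bounded by
the right-nested commutators. -/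
theorem exists_odd_generator (A : Fin m → R) (hA : ∀ j, Dissipative (A j)) :
    ∃ E : ℕ → R, E 1 = ∑ j, A j ∧ (∀ q, Even q → E q = 0) ∧ (∀ q, ‖E q‖ ≤ gradeNorm A q) ∧
      ∀ q₀, 1 ≤ q₀ → ∀ τ : ℝ, 0 ≤ τ →
        ‖NormedSpace.exp (∑ q ∈ Icc 1 q₀, τ ^ q • E q) - stageProd A τ (palindrome m)‖ ≤
          Real.exp (weightedTail A (fun _ => 1) q₀ τ) - 1 := by
  refine ⟨fun q => coeff q (flog (formalProd A (palindrome m))), ?_, fun q hq =>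
    coeff_flog_formalProd_even A (reverse_palindrome m) hq, fun q => ?_, fun q₀ hq₀ τ hτ => ?_⟩
  · simp only
    rw [coeff_one_flog_formalProd, palindrome, List.map_append, List.sum_append, List.map_reverse,
      List.sum_reverse, ← List.ofFn_eq_map, List.sum_ofFn, ← sum_add_distrib]
    refine sum_congr rfl fun j _ => ?_
    module
  · obtain ⟨c, hc, hq⟩ := exists_log_coeff A (palindrome m) fun l => (count_palindrome m l).le
    simp only
    rw [hq, evalComm]
    refine norm_sum_le_of_le _ fun w _ => ?_
    rw [norm_smul, Real.norm_eq_abs]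
    refine mul_le_of_le_one_left (norm_nonneg _) ((hc _).trans ?_)
    exact lastDuration_le_one (fun l => (count_palindrome m l).le) _
  · have h := norm_exp_truncLog_sub_le hA hq₀ hτ (palindrome m) fun l => (count_palindrome m l).le
    refine le_sub_iff_add_le.2 (h.trans (Real.exp_le_exp.2 ?_))
    exact weightedTail_mono A (lastDuration_nonneg _)
      (fun w => lastDuration_le_one (fun l => (count_palindrome m l).le) w) (fun _ => le_rfl) q₀ hτ

end Stages

end

section

open Finset Filter Topology

/-! ### Extrapolation of entire functions -/

section Extrapolation

/-- Linear combinations that annihilate the powers `w, …, w^{p-1}` extrapolate an analytic function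
to `0`, up to a remainder that is exponentially small in `p`. -/
lemma norm_sum_mul_sub_le {h : ℂ → ℂ} (hd : Differentiable ℂ h) {B ρ r : ℝ} (hρ : 0 < ρ)
    (hB : ∀ z : ℂ, ‖z‖ = ρ → ‖h z‖ ≤ B) {ι : Type*} (s : Finset ι) (b w : ι → ℝ) {p : ℕ}
    (hp : 1 ≤ p) (hb1 : ∑ i ∈ s, b i = 1)
    (hbk : ∀ k, 1 ≤ k → k < p → ∑ i ∈ s, b i * w i ^ k = 0) (hw0 : ∀ i ∈ s, 0 ≤ w i)
    (hw : ∀ i ∈ s, w i ≤ ρ * r) (hr0 : 0 ≤ r) (hr : r < 1) :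
    ‖∑ i ∈ s, (b i : ℂ) * h (w i) - h 0‖ ≤ (∑ i ∈ s, |b i|) * (B * r ^ p / (1 - r)) := by
  set a : ℕ → ℂ := fun n => (n.factorial : ℂ)⁻¹ * iteratedDeriv n h 0 with ha
  have hsum : ∀ z : ℂ, HasSum (fun n => a n * z ^ n) (h z) := fun z => by
    have := Complex.hasSum_taylorSeries_of_entire hd 0 z
    refine this.congr_fun fun n => ?_
    simp only [smul_eq_mul, sub_zero, ha]
    ring
  have han : ∀ n, ‖a n‖ ≤ B / ρ ^ n := fun n => by
    have := Complex.norm_iteratedDeriv_le_of_forall_mem_sphere_norm_le n hρ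
      (f := h) (c := 0) (C := B) hd.diffContOnCl (fun z hz => hB z (by simpa using hz))
    rw [ha, norm_mul, norm_inv, Complex.norm_natCast]
    rw [inv_mul_le_iff₀ (by positivity), ← mul_div_assoc]
    exact this
  have hB0 : 0 ≤ B := (norm_nonneg _).trans (hB ρ (by simp [abs_of_pos hρ]))
  have hS : HasSum (fun n => a n * ((∑ i ∈ s, b i * w i ^ n : ℝ) : ℂ))
      (∑ i ∈ s, (b i : ℂ) * h (w i)) := by
    have := hasSum_sum fun i (_ : i ∈ s) => (hsum (w i)).mul_left (b i : ℂ)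
    refine this.congr_fun fun n => ?_
    push_cast
    rw [mul_sum]
    exact sum_congr rfl fun i _ => by ring
  have hS' := (hasSum_nat_add_iff' p).2 hS
  have hfin : ∑ n ∈ range p, a n * ((∑ i ∈ s, b i * w i ^ n : ℝ) : ℂ) = h 0 := by
    obtain ⟨p, rfl⟩ := Nat.exists_eq_add_of_le' hp
    rw [sum_range_succ', sum_eq_zero, zero_add]
    · simp [ha, hb1]
    · intro n hn
      rw [hbk (n + 1) (by omega) (by simpa using hn)]
      simp
  rw [hfin] at hS'
  have hg : HasSum (fun n : ℕ => (∑ i ∈ s, |b i|) * (B * r ^ p) * r ^ n)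
      ((∑ i ∈ s, |b i|) * (B * r ^ p) * (1 - r)⁻¹) :=
    (hasSum_geometric_of_lt_one hr0 hr).mul_left _
  rw [← hS'.tsum_eq]
  refine (tsum_of_norm_bounded hg fun n => ?_).trans_eq (by rw [div_eq_mul_inv]; ring)
  rw [norm_mul, Complex.norm_real, Real.norm_eq_abs]
  calc ‖a (n + p)‖ * |∑ i ∈ s, b i * w i ^ (n + p)|
      ≤ B / ρ ^ (n + p) * ((∑ i ∈ s, |b i|) * (ρ * r) ^ (n + p)) := by
        gcongr
        · exact han _
        · refine (abs_sum_le_sum_abs _ _).trans ?_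
          rw [sum_mul]
          refine sum_le_sum fun i hi => ?_
          rw [abs_mul, abs_of_nonneg (pow_nonneg (hw0 i hi) _)]
          gcongr
          · exact hw0 i hi
          · exact hw i hi
    _ = _ := by
        rw [mul_pow]
        field_simp
        ring

end Extrapolation

/-! ### The bias of extrapolated product formulas -/

section Bias

/-- Accumulation of errors over `N` steps. -/
lemma norm_pow_sub_pow_le {R : Type*} [NormedRing R] [NormOneClass R] {Y S : R} {x : ℝ}
    (hS : ‖S‖ ≤ 1) (h : ‖Y - S‖ ≤ Real.exp x - 1) (N : ℕ) :
    ‖Y ^ N - S ^ N‖ ≤ Real.exp (N * x) - 1 := by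
  induction N with
  | zero => simp
  | succ N ih =>
    have hY : ‖Y‖ ≤ Real.exp x := by
      have := norm_add_le (Y - S) S
      rw [sub_add_cancel] at this
      linarith
    have h1 : Y ^ (N + 1) - S ^ (N + 1) = Y * (Y ^ N - S ^ N) + (Y - S) * S ^ N := by
      rw [pow_succ', pow_succ']; noncomm_ring
    have hSN : ‖S ^ N‖ ≤ 1 := (norm_pow_le _ _).trans (pow_le_one₀ (norm_nonneg _) hS)
    have h0 : 0 ≤ Real.exp (N * x) - 1 := (norm_nonneg _).trans ih
    rw [h1]
    calc _ ≤ ‖Y‖ * ‖Y ^ N - S ^ N‖ + ‖Y - S‖ * ‖S ^ N‖ :=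
          (norm_add_le _ _).trans (add_le_add (norm_mul_le _ _) (norm_mul_le _ _))
      _ ≤ Real.exp x * (Real.exp (N * x) - 1) + (Real.exp x - 1) * 1 := by
          gcongr
          exact (norm_nonneg _).trans h
      _ = _ := by
          rw [show ((N + 1 : ℕ) : ℝ) * x = x + N * x by push_cast; ring, Real.exp_add]; ring

lemma sum_half_pow_le (q₀ : ℕ) :
    ∑ q ∈ Icc 1 q₀, (if 3 ≤ q then (1 / 2 : ℝ) ^ q else 0) ≤ 1 / 4 := by
  rcases Nat.lt_or_ge q₀ 2 with h | h
  · interval_cases q₀ <;> norm_num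
  · have : ∑ q ∈ Icc 1 q₀, (if 3 ≤ q then (1 / 2 : ℝ) ^ q else 0) = 1 / 4 - (1 / 2) ^ q₀ := by
      induction q₀, h using Nat.le_induction with
      | base => norm_num [sum_Icc_succ_top]
      | succ n hn ih =>
        rw [sum_Icc_succ_top (by omega), ih, if_pos (by omega), pow_succ]
        ring
    rw [this]
    linarith [show (0 : ℝ) < (1 / 2) ^ q₀ by positivity]

variable {m : ℕ} {R : Type*} [NormedRing R] [NormedAlgebra ℂ R]

/-- The generator of the effective dynamics of product formulas with step size `s`, as a polynomial
in `w = s²`. -/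
def effGen (E : ℕ → R) (q₀ : ℕ) (t : ℝ) (w : ℂ) : R :=
  ∑ q ∈ Icc 1 q₀, (w ^ ((q - 1) / 2) * (t : ℂ) ^ q) • E q

/-- The effective generator at vanishing step size is the exact one. -/
lemma effGen_zero {E : ℕ → R} (hE : ∀ q, Even q → E q = 0) {q₀ : ℕ} (hq₀ : 1 ≤ q₀) (t : ℝ) :
    effGen E q₀ t 0 = (t : ℂ) • E 1 := by
  rw [effGen, sum_eq_single 1]
  · simp
  · intro q hq hq1
    have : 1 ≤ q := (mem_Icc.1 hq).1
    rcases Nat.even_or_odd q with h | h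
    · rw [hE q h, smul_zero]
    · obtain ⟨k, rfl⟩ := h
      rw [show (2 * k + 1 - 1) / 2 = k by omega, zero_pow (by omega), zero_mul, zero_smul]
  · intro h
    exact absurd (mem_Icc.2 ⟨le_rfl, hq₀⟩) h

/-- The generator of `N` steps of length `t / N` is the effective generator at `w = 1 / N²`, since
even grades vanish. -/
lemma nsmul_sum_pow_smul_eq_effGen {E : ℕ → R} (hE : ∀ q, Even q → E q = 0) (q₀ : ℕ) (t : ℝ)
    {N : ℕ} (hN : 1 ≤ N) : N • ∑ q ∈ Icc 1 q₀, (t / N) ^ q • E q =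
      effGen E q₀ t ((((1 / N : ℝ) ^ 2 : ℝ)) : ℂ) := by
  rw [effGen, smul_sum]
  refine sum_congr rfl fun q hq => ?_
  rcases Nat.even_or_odd q with h | h
  · rw [hE q h]; simp
  · obtain ⟨k, rfl⟩ := h
    rw [show (2 * k + 1 - 1) / 2 = k by omega, ← Nat.cast_smul_eq_nsmul ℝ, smul_smul,
      ← Complex.coe_smul]
    congr 1
    have : (N : ℂ) ≠ 0 := by exact_mod_cast (by omega : N ≠ 0)
    push_cast
    rw [div_pow, one_div, inv_pow, inv_pow, ← pow_mul, pow_succ (N : ℂ)]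
    field_simp

lemma differentiable_effGen (E : ℕ → R) (q₀ : ℕ) (t : ℝ) : Differentiable ℂ (effGen E q₀ t) := by
  unfold effGen
  fun_prop

/-- On the circle of radius `y²` the effective generator is a bounded perturbation of the exact one.
In the application `y` is `e` times the largest step size. -/
lemma norm_effGen_sub_le {E : ℕ → R} (hE : ∀ q, Even q → E q = 0) {q₀ : ℕ} (hq₀ : 1 ≤ q₀)
    {t μ y : ℝ} (ht : 0 < t) (hy : 0 < y) (hy1 : y ≤ 1) (hμ : 0 ≤ μ)
    (hEμ : ∀ q, Odd q → 3 ≤ q → q ≤ q₀ → ‖E q‖ ≤ μ ^ q)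
    (hyμ : y ^ 2 * (2 * μ * t) ^ 3 ≤ 1) {w : ℂ} (hw : ‖w‖ = y ^ 2) :
    ‖effGen E q₀ t w - (t : ℂ) • E 1‖ ≤ 1 / 4 := by
  have h0 := effGen_zero hE hq₀ t
  rw [← h0, effGen, effGen, ← sum_sub_distrib]
  refine (norm_sum_le_of_le _ fun q hq => ?_).trans (sum_half_pow_le q₀)
  rcases Nat.even_or_odd q with h | h
  · rw [hE q h]; simp; positivity
  · split_ifs with h3
    · have hq2 := (mem_Icc.1 hq).2
      have hEq := hEμ q h h3 hq2
      obtain ⟨k, rfl⟩ := h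
      rw [show (2 * k + 1 - 1) / 2 = k by omega, zero_pow (by omega), zero_mul, zero_smul, sub_zero,
        norm_smul, norm_mul, norm_pow, norm_pow, hw, Complex.norm_real, Real.norm_of_nonneg ht.le]
      have hX : 0 ≤ 2 * μ * t := by positivity
      -- the third power is a product of a power of the hypothesis `hyμ` and a power of `y ≤ 1`
      have key : (y ^ 2) ^ k * (2 * μ * t) ^ (2 * k + 1) ≤ 1 := by
        by_contra! hlt
        refine absurd (one_lt_pow₀ hlt three_ne_zero) (not_lt.2 ?_)
        have e : ((y ^ 2) ^ k * (2 * μ * t) ^ (2 * k + 1)) ^ 3 =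
            (y ^ 2 * (2 * μ * t) ^ 3) ^ (2 * k + 1) * y ^ (2 * (k - 1)) := by
          obtain ⟨k, rfl⟩ := Nat.exists_eq_add_of_le' (show 1 ≤ k by omega)
          generalize 2 * μ * t = X
          simp only [Nat.add_sub_cancel]
          ring
        rw [e]
        exact mul_le_one₀ (pow_le_one₀ (by positivity) hyμ) (by positivity)
          (pow_le_one₀ hy.le hy1)
      calc (y ^ 2) ^ k * t ^ (2 * k + 1) * ‖E (2 * k + 1)‖
          ≤ (y ^ 2) ^ k * t ^ (2 * k + 1) * μ ^ (2 * k + 1) := by gcongr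
        _ = (y ^ 2) ^ k * (2 * μ * t) ^ (2 * k + 1) * (1 / 2) ^ (2 * k + 1) := by
            rw [mul_pow, mul_pow, one_div, inv_pow]
            field_simp
        _ ≤ 1 * (1 / 2) ^ (2 * k + 1) := by gcongr
        _ = _ := one_mul _
    · have : q = 1 := by
        have := (mem_Icc.1 hq).1
        obtain ⟨k, rfl⟩ := h
        omega
      subst this
      simp

variable [CompleteSpace R] [NormOneClass R]

/-- The bias of the extrapolated estimate: the remainder of the extrapolation plus the error of
the effective generators truncated at grade `q₀`. -/
theorem norm_extrapolation_bias_le (A : Fin m → R) (hA : ∀ j, Dissipative (A j)) {q₀ : ℕ}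
    (hq₀ : 1 ≤ q₀) {t μ σ x M : ℝ} (ht : 0 < t) (hσ : 0 < σ) (hσ1 : Real.exp 1 * σ ≤ 1)
    (hμ : 0 ≤ μ) (hAμ : ∀ q, Odd q → 3 ≤ q → q ≤ q₀ → gradeNorm A q ≤ μ ^ q)
    (hσμ : (Real.exp 1 * σ) ^ 2 * (2 * μ * t) ^ 3 ≤ 1) (φ : R →L[ℂ] ℂ)
    (hM : 0 ≤ M) (hφ : ∀ a, ‖φ a‖ ≤ M * ‖a‖) {ι : Type*} (s : Finset ι) (b : ι → ℝ) (N : ι → ℕ)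
    (hN : ∀ i ∈ s, 1 ≤ N i) (hNσ : ∀ i ∈ s, 1 / (N i : ℝ) ≤ σ)
    (hx : ∀ i ∈ s, N i * weightedTail A (fun _ => 1) q₀ (t / N i) ≤ x)
    {p : ℕ} (hp : 1 ≤ p) (hb1 : ∑ i ∈ s, b i = 1)
    (hbk : ∀ k, 1 ≤ k → k < p → ∑ i ∈ s, b i * ((1 / N i : ℝ) ^ 2) ^ k = 0) :
    ‖∑ i ∈ s, (b i : ℂ) * φ (stageProd A (t / N i) (palindrome m) ^ N i) -
        φ (NormedSpace.exp ((t : ℂ) • ∑ j, A j))‖ ≤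
      (∑ i ∈ s, |b i|) * (M * (Real.exp (1 / 4) * Real.exp (-2) ^ p / (1 - Real.exp (-2)) +
        (Real.exp x - 1))) := by
  obtain ⟨E, hE1, hE, hEn, hES⟩ := exists_odd_generator A hA
  set h : ℂ → ℂ := fun w => φ (NormedSpace.exp (effGen E q₀ t w)) with hh
  have hd : Differentiable ℂ h := by
    refine φ.differentiable.comp (Differentiable.comp (g := NormedSpace.exp) (fun a => ?_)
      (differentiable_effGen E q₀ t))
    exact (NormedSpace.exp_analytic (𝕂 := ℂ) a).differentiableAt
  have hT : Dissipative ((t : ℂ) • E 1) := by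
    rw [hE1, Complex.coe_smul]
    exact (Dissipative.sum _ fun j _ => hA j).smul ht.le
  have hB : ∀ z : ℂ, ‖z‖ = (Real.exp 1 * σ) ^ 2 → ‖h z‖ ≤ M * Real.exp (1 / 4) := by
    intro z hz
    refine (hφ _).trans ?_
    gcongr
    have h1 := hT.norm_exp_add_le (effGen E q₀ t z - (t : ℂ) • E 1)
    rw [add_sub_cancel] at h1
    refine h1.trans (Real.exp_le_exp.2 ?_)
    exact norm_effGen_sub_le hE hq₀ ht (by positivity) hσ1 hμ
      (fun q h1 h2 h3 => (hEn q).trans (hAμ q h1 h2 h3)) hσμ hz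
  have h1 := norm_sum_mul_sub_le hd (ρ := (Real.exp 1 * σ) ^ 2) (by positivity) hB s b
    (fun i => (1 / N i : ℝ) ^ 2) hp hb1 hbk (fun i _ => by positivity)
    (r := Real.exp (-2)) (fun i hi => by
      calc (1 / N i : ℝ) ^ 2 ≤ σ ^ 2 := by gcongr; exact hNσ i hi
        _ = (Real.exp 1 * σ) ^ 2 * Real.exp (-2) := by
          have : Real.exp (-2) = (Real.exp 1 ^ 2)⁻¹ := by
            rw [← Real.exp_nat_mul, ← Real.exp_neg]; norm_num
          rw [this]; field_simp)
    (Real.exp_pos _).le (by rw [Real.exp_lt_one_iff]; norm_num)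
  have h0 : h 0 = φ (NormedSpace.exp ((t : ℂ) • ∑ j, A j)) := by
    rw [hh]; simp only; rw [effGen_zero hE hq₀, hE1]
  have h2 : ∀ i ∈ s, ‖φ (stageProd A (t / N i) (palindrome m) ^ N i) -
      h (((1 / N i : ℝ) ^ 2 : ℝ) : ℂ)‖ ≤ M * (Real.exp x - 1) := by
    intro i hi
    rw [hh]
    simp only
    rw [← map_sub]
    refine (hφ _).trans ?_
    gcongr
    let : NormedAlgebra ℚ R := NormedAlgebra.restrictScalars ℚ ℂ R
    rw [← nsmul_sum_pow_smul_eq_effGen hE q₀ t (hN i hi), NormedSpace.exp_nsmul, norm_sub_rev]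
    have hpos : 0 ≤ t / N i := by positivity
    refine (norm_pow_sub_pow_le (norm_stageProd_le hA hpos _) (hES q₀ hq₀ _ hpos) (N i)).trans ?_
    gcongr
    exact hx i hi
  have h3 : ∑ i ∈ s, (b i : ℂ) * φ (stageProd A (t / N i) (palindrome m) ^ N i) - h 0 =
      ∑ i ∈ s, (b i : ℂ) * (φ (stageProd A (t / N i) (palindrome m) ^ N i) -
        h (((1 / N i : ℝ) ^ 2 : ℝ) : ℂ)) +
      (∑ i ∈ s, (b i : ℂ) * h (((1 / N i : ℝ) ^ 2 : ℝ) : ℂ) - h 0) := by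
    simp only [mul_sub, sum_sub_distrib]; ring
  rw [← h0, h3]
  refine (norm_add_le _ _).trans ?_
  have h4 : ‖∑ i ∈ s, (b i : ℂ) * (φ (stageProd A (t / N i) (palindrome m) ^ N i) -
        h (((1 / N i : ℝ) ^ 2 : ℝ) : ℂ))‖ ≤ (∑ i ∈ s, |b i|) * (M * (Real.exp x - 1)) := by
    rw [sum_mul]
    refine norm_sum_le_of_le _ fun i hi => ?_
    rw [norm_mul, Complex.norm_real, Real.norm_eq_abs]
    gcongr
    exact h2 i hi
  refine (add_le_add h4 h1).trans_eq ?_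
  ring

end Bias

end

section

open Finset
open scoped ComplexOrder

/-! ### The trace norm and its dual -/

section TraceNorm

variable {κ : Type} [Fintype κ] [DecidableEq κ]

/-- A matrix as a continuous linear map of the Euclidean space. -/
abbrev mop (A : Matrix κ κ ℂ) : EuclideanSpace ℂ κ →L[ℂ] EuclideanSpace ℂ κ :=
  Matrix.toEuclideanCLM (n := κ) (𝕜 := ℂ) A

lemma opNorm_nonneg (A : Matrix κ κ ℂ) : 0 ≤ opNorm A := norm_nonneg _

lemma norm_mop_le (A : Matrix κ κ ℂ) (x : EuclideanSpace ℂ κ) : ‖mop A x‖ ≤ opNorm A * ‖x‖ :=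
  (mop A).le_opNorm x

lemma mop_mul (A B : Matrix κ κ ℂ) (x : EuclideanSpace ℂ κ) :
    mop (A * B) x = mop A (mop B x) := by
  have : mop (A * B) = mop A * mop B := map_mul _ A B
  rw [this]; rfl

lemma inner_self_eq_ofReal (x : EuclideanSpace ℂ κ) : inner ℂ x x = ((‖x‖ ^ 2 : ℝ) : ℂ) := by
  rw [inner_self_eq_norm_sq_to_K]; push_cast; rfl

lemma trace_eq_sum_inner (A : Matrix κ κ ℂ) {α : Type*} [Fintype α]
    (b : OrthonormalBasis α ℂ (EuclideanSpace ℂ κ)) : A.trace = ∑ k, inner ℂ (b k) (mop A (b k)) := by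
  have h := LinearMap.trace_eq_sum_inner (mop A : _ →ₗ[ℂ] _) b
  rw [← Matrix.trace_toLin_eq A (EuclideanSpace.basisFun κ ℂ).toBasis]
  exact h

lemma inner_mop_right (A : Matrix κ κ ℂ) (x y : EuclideanSpace ℂ κ) :
    inner ℂ x (mop A y) = inner ℂ (mop A.conjTranspose x) y := by
  have : mop A.conjTranspose = ContinuousLinearMap.adjoint (mop A) := by
    rw [← ContinuousLinearMap.star_eq_adjoint, ← map_star]; rfl
  rw [this, ContinuousLinearMap.adjoint_inner_left]

/-- An orthonormal eigenbasis of `X† X`. -/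
def singularBasis (X : Matrix κ κ ℂ) : OrthonormalBasis κ ℂ (EuclideanSpace ℂ κ) :=
  (Matrix.isHermitian_conjTranspose_mul_self X).eigenvectorBasis

lemma mop_singularBasis (X : Matrix κ κ ℂ) (k : κ) :
    mop (X.conjTranspose * X) (singularBasis X k) =
      ((Matrix.isHermitian_conjTranspose_mul_self X).eigenvalues k : ℂ) • singularBasis X k := by
  apply (WithLp.equiv 2 _).injective
  have := (Matrix.isHermitian_conjTranspose_mul_self X).mulVec_eigenvectorBasis k
  simpa using! this

lemma inner_mop_singularBasis (X : Matrix κ κ ℂ) (k l : κ) :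
    inner ℂ (mop X (singularBasis X k)) (mop X (singularBasis X l)) =
      if k = l then ((Matrix.isHermitian_conjTranspose_mul_self X).eigenvalues l : ℂ) else 0 := by
  rw [← Matrix.conjTranspose_conjTranspose X, ← inner_mop_right, Matrix.conjTranspose_conjTranspose,
    ← mop_mul, mop_singularBasis, inner_smul_right,
    orthonormal_iff_ite.1 (singularBasis X).orthonormal]
  split_ifs <;> simp

lemma norm_mop_singularBasis (X : Matrix κ κ ℂ) (k : κ) :
    ‖mop X (singularBasis X k)‖ =
      Real.sqrt ((Matrix.isHermitian_conjTranspose_mul_self X).eigenvalues k) := by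
  have h := inner_mop_singularBasis X k k
  rw [if_pos rfl, inner_self_eq_ofReal] at h
  have h' : ‖mop X (singularBasis X k)‖ ^ 2 =
      (Matrix.isHermitian_conjTranspose_mul_self X).eigenvalues k := by exact_mod_cast h
  rw [← h', Real.sqrt_sq (norm_nonneg _)]

lemma traceNorm_eq_sum_norm (X : Matrix κ κ ℂ) :
    traceNorm X = ∑ k, ‖mop X (singularBasis X k)‖ := by
  simp only [norm_mop_singularBasis]; rfl

lemma traceNorm_nonneg (X : Matrix κ κ ℂ) : 0 ≤ traceNorm X :=
  sum_nonneg fun _ _ => Real.sqrt_nonneg _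

/-- Trace duality. -/
lemma norm_trace_mul_le (B X : Matrix κ κ ℂ) : ‖(B * X).trace‖ ≤ opNorm B * traceNorm X := by
  rw [trace_eq_sum_inner _ (singularBasis X), traceNorm_eq_sum_norm, mul_sum]
  refine norm_sum_le_of_le _ fun k _ => ?_
  rw [mop_mul]
  refine (norm_inner_le_norm _ _).trans ?_
  rw [(singularBasis X).norm_eq_one, one_mul]
  exact norm_mop_le _ _

/-- The supremum in trace duality is attained: by the adjoint of the partial isometry in the polar
decomposition. -/
lemma exists_trace_mul_eq (X : Matrix κ κ ℂ) :
    ∃ B : Matrix κ κ ℂ, opNorm B ≤ 1 ∧ (B * X).trace = traceNorm X := by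
  set v := singularBasis X with hv
  set σ : κ → ℝ := fun k => ‖mop X (v k)‖ with hσ
  set S : Finset κ := univ.filter fun k => σ k ≠ 0 with hS
  -- the normalized images of the right singular vectors are orthonormal, and `T` maps them back
  set e : S → EuclideanSpace ℂ κ := fun k => ((σ k)⁻¹ : ℂ) • mop X (v k) with he
  have hort : Orthonormal ℂ e := by
    rw [orthonormal_iff_ite]
    rintro ⟨k, hk⟩ ⟨l, hl⟩
    have hk' : σ k ≠ 0 := (mem_filter.1 hk).2
    rw [he]
    simp only [Subtype.mk.injEq]
    rw [inner_smul_left, inner_smul_right, inner_mop_singularBasis]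
    split_ifs with hkl
    · subst hkl
      have h := inner_mop_singularBasis X k k
      rw [if_pos rfl, inner_self_eq_ofReal] at h
      rw [← h]
      have : ((σ k : ℝ) : ℂ) ≠ 0 := by exact_mod_cast hk'
      rw [map_inv₀, Complex.conj_ofReal]
      change (σ k : ℂ)⁻¹ * ((σ k : ℂ)⁻¹ * ((σ k ^ 2 : ℝ) : ℂ)) = 1
      push_cast
      field_simp
    · simp
  set T : EuclideanSpace ℂ κ →L[ℂ] EuclideanSpace ℂ κ :=
    ∑ k : S, (innerSL ℂ (e k)).smulRight (v k) with hT
  have hTx : ∀ x, T x = ∑ k : S, inner ℂ (e k) x • v k := fun x => by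
    rw [hT, _root_.sum_apply]; rfl
  have hT1 : ‖T‖ ≤ 1 := by
    refine ContinuousLinearMap.opNorm_le_bound _ zero_le_one fun x => ?_
    rw [one_mul, ← sq_le_sq₀ (norm_nonneg _) (norm_nonneg _), hTx]
    have hvo : Orthonormal ℂ fun k : S => v k := v.orthonormal.comp _ Subtype.val_injective
    have h1 : ‖∑ k : S, inner ℂ (e k) x • v k‖ ^ 2 = ∑ k : S, ‖inner ℂ (e k) x‖ ^ 2 := by
      have := hvo.inner_sum (fun k => inner ℂ (e k) x) (fun k => inner ℂ (e k) x) univ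
      rw [inner_self_eq_ofReal] at this
      have h2 : ∀ z : ℂ, (starRingEnd ℂ) z * z = ((‖z‖ ^ 2 : ℝ) : ℂ) := fun z => by
        rw [Complex.conj_mul']; push_cast; rfl
      simp only [h2] at this
      exact_mod_cast this
    rw [h1]
    exact hort.sum_inner_products_le x
  refine ⟨(Matrix.toEuclideanCLM (n := κ) (𝕜 := ℂ)).symm T, ?_, ?_⟩
  · rw [opNorm]; simpa using hT1
  · rw [trace_eq_sum_inner _ v, traceNorm_eq_sum_norm]
    push_cast
    refine sum_congr rfl fun k _ => ?_
    rw [mop_mul]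
    have : mop ((Matrix.toEuclideanCLM (n := κ) (𝕜 := ℂ)).symm T) = T := by simp [mop]
    rw [this, hTx, inner_sum]
    by_cases hk : σ k = 0
    · have h0 : mop X (v k) = 0 := norm_eq_zero.1 hk
      rw [← hv, h0]
      simp
    · have hkS : k ∈ S := mem_filter.2 ⟨mem_univ _, hk⟩
      have h3 : ((σ k : ℝ) : ℂ) ≠ 0 := by exact_mod_cast hk
      rw [sum_eq_single (⟨k, hkS⟩ : S)]
      · rw [inner_smul_right, inner_self_eq_ofReal, v.norm_eq_one, he]
        simp only
        rw [inner_smul_left, inner_self_eq_ofReal, map_inv₀, Complex.conj_ofReal]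
        change (σ k : ℂ)⁻¹ * ((σ k ^ 2 : ℝ) : ℂ) * _ = (σ k : ℂ)
        push_cast
        field_simp
      · intro l _ hl
        rw [inner_smul_right, orthonormal_iff_ite.1 v.orthonormal, if_neg, mul_zero]
        rintro rfl
        exact hl rfl
      · simp

/-- Trace duality: bounds on `Tr (B X)` for all contractions `B` bound the trace norm. -/
lemma traceNorm_le {X : Matrix κ κ ℂ} {c : ℝ}
    (h : ∀ B : Matrix κ κ ℂ, opNorm B ≤ 1 → ‖(B * X).trace‖ ≤ c) : traceNorm X ≤ c := by
  obtain ⟨B, hB, hBX⟩ := exists_trace_mul_eq X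
  have := h B hB
  rwa [hBX, Complex.norm_real, Real.norm_of_nonneg (traceNorm_nonneg X)] at this

lemma norm_trace_mul_le_of_le_one {B X : Matrix κ κ ℂ} (hB : opNorm B ≤ 1) :
    ‖(B * X).trace‖ ≤ traceNorm X :=
  (norm_trace_mul_le B X).trans (mul_le_of_le_one_left (traceNorm_nonneg X) hB)

lemma traceNorm_add_le (X Y : Matrix κ κ ℂ) : traceNorm (X + Y) ≤ traceNorm X + traceNorm Y :=
  traceNorm_le fun B hB => by
    rw [mul_add, Matrix.trace_add]
    exact (norm_add_le _ _).trans
      (add_le_add (norm_trace_mul_le_of_le_one hB) (norm_trace_mul_le_of_le_one hB))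

lemma traceNorm_smul_le (c : ℂ) (X : Matrix κ κ ℂ) : traceNorm (c • X) ≤ ‖c‖ * traceNorm X :=
  traceNorm_le fun B hB => by
    rw [mul_smul_comm, Matrix.trace_smul, norm_smul]
    exact mul_le_mul_of_nonneg_left (norm_trace_mul_le_of_le_one hB) (norm_nonneg _)

lemma traceNorm_smul (c : ℂ) (X : Matrix κ κ ℂ) : traceNorm (c • X) = ‖c‖ * traceNorm X := by
  refine le_antisymm (traceNorm_smul_le c X) ?_
  rcases eq_or_ne c 0 with rfl | hc
  · simpa using traceNorm_nonneg _
  · have h := traceNorm_smul_le c⁻¹ (c • X)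
    rw [smul_smul, inv_mul_cancel₀ hc, one_smul, norm_inv] at h
    rwa [← le_inv_mul_iff₀ (norm_pos_iff.2 hc)]

lemma traceNorm_eq_zero_iff (X : Matrix κ κ ℂ) : traceNorm X = 0 ↔ X = 0 := by
  constructor
  · intro h
    have := norm_trace_mul_le X.conjTranspose X
    rw [h, mul_zero] at this
    exact Matrix.trace_conjTranspose_mul_self_eq_zero_iff.1 (norm_le_zero_iff.1 this)
  · rintro rfl
    simpa using traceNorm_smul 0 (0 : Matrix κ κ ℂ)

/-- Square matrices with the trace norm. -/
def TraceClass (κ : Type) : Type := Matrix κ κ ℂ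

instance : AddCommGroup (TraceClass κ) := inferInstanceAs (AddCommGroup (Matrix κ κ ℂ))
instance : Module ℂ (TraceClass κ) := inferInstanceAs (Module ℂ (Matrix κ κ ℂ))
instance : FiniteDimensional ℂ (TraceClass κ) :=
  inferInstanceAs (FiniteDimensional ℂ (Matrix κ κ ℂ))
instance : Norm (TraceClass κ) := ⟨traceNorm (ι := κ)⟩

lemma traceClass_core : NormedSpace.Core ℂ (TraceClass κ) where
  norm_nonneg := traceNorm_nonneg (κ := κ)
  norm_smul := traceNorm_smul (κ := κ)
  norm_triangle := traceNorm_add_le (κ := κ)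
  norm_eq_zero_iff := traceNorm_eq_zero_iff (κ := κ)

instance : NormedAddCommGroup (TraceClass κ) := NormedAddCommGroup.ofCore traceClass_core
instance : NormedSpace ℂ (TraceClass κ) := NormedSpace.ofCore traceClass_core
instance : CompleteSpace (TraceClass κ) := FiniteDimensional.complete ℂ _
instance [Nonempty κ] : Nontrivial (TraceClass κ) :=
  inferInstanceAs (Nontrivial (Matrix κ κ ℂ))

/-- The algebra of bounded superoperators on the trace class. -/
abbrev BSuperop (κ : Type) [Fintype κ] [DecidableEq κ] : Type := TraceClass κ →L[ℂ] TraceClass κ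

instance [Nonempty κ] : NormOneClass (BSuperop κ) := inferInstance

/-- Superoperators as bounded operators on the trace class. -/
def bsup : Superop κ ≃ₐ[ℂ] BSuperop κ :=
  Module.End.toContinuousLinearMap (TraceClass κ)

end TraceNorm

end

section

open Finset
open scoped ComplexOrder Kronecker

/-! ### Dissipativity of Lindblad generators -/

section Contraction

variable {κ : Type} [Fintype κ] [DecidableEq κ]

lemma norm_sq_mop (A : Matrix κ κ ℂ) (x : EuclideanSpace ℂ κ) :
    ((‖mop A x‖ ^ 2 : ℝ) : ℂ) = inner ℂ x (mop (A.conjTranspose * A) x) := by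
  rw [mop_mul, inner_mop_right, Matrix.conjTranspose_conjTranspose, inner_self_eq_ofReal]

/-- The trace norm bound for completely positive maps in Kraus form. -/
lemma traceNorm_sum_conj_le {α : Type*} [Fintype α] (K : α → Matrix κ κ ℂ) {c : ℝ} (hc : 0 ≤ c)
    (hK : ∀ x, ∑ a, ‖mop (K a) x‖ ^ 2 ≤ c * ‖x‖ ^ 2) (X : Matrix κ κ ℂ) :
    traceNorm (∑ a, K a * X * (K a).conjTranspose) ≤ c * traceNorm X := by
  refine traceNorm_le fun B hB => ?_
  set v := singularBasis X with hv
  have h1 : (B * ∑ a, K a * X * (K a).conjTranspose).trace =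
      ∑ k, ∑ a, inner ℂ (mop (K a) (v k)) (mop B (mop (K a) (mop X (v k)))) := by
    rw [mul_sum, Matrix.trace_sum, sum_comm]
    refine sum_congr rfl fun a _ => ?_
    rw [← mul_assoc, Matrix.trace_mul_comm, trace_eq_sum_inner _ v]
    refine sum_congr rfl fun k _ => ?_
    rw [mop_mul, inner_mop_right, Matrix.conjTranspose_conjTranspose, mop_mul, mop_mul]
  rw [h1, traceNorm_eq_sum_norm, mul_sum]
  refine norm_sum_le_of_le _ fun k _ => ?_
  calc ‖∑ a, inner ℂ (mop (K a) (v k)) (mop B (mop (K a) (mop X (v k))))‖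
      ≤ ∑ a, ‖mop (K a) (v k)‖ * ‖mop (K a) (mop X (v k))‖ := by
        refine norm_sum_le_of_le _ fun a _ => (norm_inner_le_norm _ _).trans ?_
        gcongr
        exact (norm_mop_le _ _).trans (mul_le_of_le_one_left (norm_nonneg _) hB)
    _ ≤ √(∑ a, ‖mop (K a) (v k)‖ ^ 2) * √(∑ a, ‖mop (K a) (mop X (v k))‖ ^ 2) :=
        Real.sum_mul_le_sqrt_mul_sqrt _ _ _
    _ ≤ √(c * ‖v k‖ ^ 2) * √(c * ‖mop X (v k)‖ ^ 2) := by
        gcongr <;> exact hK _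
    _ = c * ‖mop X (v k)‖ := by
        rw [v.norm_eq_one, one_pow, mul_one, Real.sqrt_mul hc, Real.sqrt_sq (norm_nonneg _),
          ← mul_assoc, Real.mul_self_sqrt hc]

/-- Lindblad generators are dissipative for the trace norm: `1 + hΦ` is a completely positive map
which increases the trace by `O(h²)`, up to a term of order `h²`. -/
lemma IsLindbladian.dissipative {Φ : Superop κ} (hΦ : IsLindbladian Φ) :
    Dissipative (bsup Φ : BSuperop κ) := by
  obtain ⟨H, n, J, hH, hΦ⟩ := hΦ
  set P : Matrix κ κ ℂ := ∑ ν, (J ν).conjTranspose * J ν with hP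
  set G : Matrix κ κ ℂ := -Complex.I • H - (1 / 2 : ℂ) • P with hG
  have hPc : P.conjTranspose = P := by
    rw [hP, Matrix.conjTranspose_sum]
    simp
  have hGc : G.conjTranspose = Complex.I • H - (1 / 2 : ℂ) • P := by
    rw [hG, Matrix.conjTranspose_sub, Matrix.conjTranspose_smul, Matrix.conjTranspose_smul, hPc, hH.eq]
    simp
  have hΦ' : ∀ X, Φ X = G * X + X * G.conjTranspose + ∑ ν, J ν * X * (J ν).conjTranspose := by
    intro X
    rw [hΦ, hGc, hG, sum_sub_distrib, ← smul_sum, sum_add_distrib, ← sum_mul, ← mul_sum, ← hP]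
    simp only [sub_mul, mul_sub, smul_mul_assoc, mul_smul_comm]
    module
  refine ⟨2 * opNorm G ^ 2, fun h hh => ?_⟩
  refine ContinuousLinearMap.opNorm_le_bound _ (by positivity) fun (X : Matrix κ κ ℂ) => ?_
  -- Kraus operators `1 + hG` and `√h J_ν` of `1 + hΦ`, up to the term `-h² G X G†`
  set K : Option (Fin n) → Matrix κ κ ℂ := fun a => a.elim (1 + (h : ℂ) • G) fun ν =>
    ((√h : ℝ) : ℂ) • J ν with hK
  have hsq : ((√h : ℝ) : ℂ) * ((√h : ℝ) : ℂ) = h := by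
    rw [← Complex.ofReal_mul, Real.mul_self_sqrt hh]
  have hX : X + (h : ℂ) • Φ X = ∑ a, K a * X * (K a).conjTranspose +
      (-(h : ℂ) ^ 2) • ∑ _a : Unit, G * X * G.conjTranspose := by
    rw [hΦ', Fintype.sum_option]
    simp only [hK, Option.elim, Matrix.conjTranspose_add, Matrix.conjTranspose_one,
      Matrix.conjTranspose_smul, Complex.star_def, Complex.conj_ofReal, smul_mul_assoc,
      mul_smul_comm, smul_smul, hsq, add_mul, mul_add, one_mul, mul_one, univ_unique, sum_const,
      card_singleton, one_smul, smul_add, smul_sum]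
    module
  have hKle : ∀ x, ∑ a, ‖mop (K a) x‖ ^ 2 ≤ (1 + opNorm G ^ 2 * h ^ 2) * ‖x‖ ^ 2 := by
    intro x
    have h1 : ∑ a, ‖mop (K a) x‖ ^ 2 = ‖x‖ ^ 2 + h ^ 2 * ‖mop G x‖ ^ 2 := by
      -- the term of first order `G + G† + ∑ J_ν† J_ν` vanishes: `Φ` preserves the trace
      have h2 : ∑ a, (K a).conjTranspose * K a = 1 + ((h ^ 2 : ℝ) : ℂ) • (G.conjTranspose * G) := by
        have hGP : G + G.conjTranspose + P = 0 := by rw [hGc, hG]; module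
        have h3 : ∑ a, (K a).conjTranspose * K a = 1 + ((h ^ 2 : ℝ) : ℂ) • (G.conjTranspose * G) +
            (h : ℂ) • (G + G.conjTranspose + P) := by
          rw [Fintype.sum_option, hP]
          simp only [hK, Option.elim, Matrix.conjTranspose_add, Matrix.conjTranspose_one,
            Matrix.conjTranspose_smul, Complex.star_def, Complex.conj_ofReal, smul_mul_assoc,
            mul_smul_comm, smul_smul, hsq, add_mul, mul_add, one_mul, mul_one, smul_add, smul_sum]
          push_cast
          module
        rw [h3, hGP, smul_zero, add_zero]
      apply Complex.ofReal_injective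
      push_cast
      simp only [← Complex.ofReal_pow, norm_sq_mop]
      rw [← inner_sum, ← _root_.sum_apply, ← map_sum, h2, map_add, map_smul, map_one]
      rw [_root_.add_apply, _root_.smul_apply, inner_add_right, inner_smul_right,
        ← inner_self_eq_ofReal]
      rfl
    have h4 : ‖mop G x‖ ^ 2 ≤ opNorm G ^ 2 * ‖x‖ ^ 2 := by
      rw [← mul_pow]
      gcongr
      exact norm_mop_le _ _
    rw [h1]
    nlinarith [mul_le_mul_of_nonneg_left h4 (sq_nonneg h)]
  have hGle : ∀ x, ∑ _a : Unit, ‖mop G x‖ ^ 2 ≤ opNorm G ^ 2 * ‖x‖ ^ 2 := by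
    intro x
    rw [← mul_pow]
    simp only [univ_unique, sum_const, card_singleton, one_smul]
    gcongr
    exact norm_mop_le _ _
  have happ : (1 + h • (bsup Φ : BSuperop κ)) X = (X + (h : ℂ) • Φ X : Matrix κ κ ℂ) := by
    rw [← Complex.coe_smul]; rfl
  rw [happ]
  change traceNorm (X + (h : ℂ) • Φ X) ≤ _ * traceNorm X
  rw [hX]
  refine (traceNorm_add_le _ _).trans ?_
  rw [traceNorm_smul]
  have e1 := traceNorm_sum_conj_le K (by positivity) hKle X
  have e2 := traceNorm_sum_conj_le (fun _ : Unit => G) (by positivity) hGle X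
  have e3 : ‖-(h : ℂ) ^ 2‖ = h ^ 2 := by
    rw [norm_neg, norm_pow, Complex.norm_real, Real.norm_of_nonneg hh]
  rw [e3]
  calc _ ≤ (1 + opNorm G ^ 2 * h ^ 2) * traceNorm X + h ^ 2 * (opNorm G ^ 2 * traceNorm X) := by
        gcongr
    _ = _ := by ring

end Contraction

/-! ### Amplification and the diamond norm -/

section Amplification

variable {ι : Type} [Fintype ι] [DecidableEq ι]

/-- The block of an operator on `ℂ^ι ⊗ ℂ^ι` with the indices `u`, `v` of the second factor. -/
def block (X : Matrix (ι × ι) (ι × ι) ℂ) (u v : ι) : Matrix ι ι ℂ :=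
  Matrix.of fun c d => X (c, u) (d, v)

lemma block_ext {X Y : Matrix (ι × ι) (ι × ι) ℂ} (h : ∀ u v, block X u v = block Y u v) : X = Y := by
  ext ⟨a, u⟩ ⟨b, v⟩
  exact congrFun (congrFun (h u v) a) b

lemma block_add (X Y : Matrix (ι × ι) (ι × ι) ℂ) (u v : ι) :
    block (X + Y) u v = block X u v + block Y u v := rfl

lemma block_sub (X Y : Matrix (ι × ι) (ι × ι) ℂ) (u v : ι) :
    block (X - Y) u v = block X u v - block Y u v := rfl

lemma block_smul (c : ℂ) (X : Matrix (ι × ι) (ι × ι) ℂ) (u v : ι) :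
    block (c • X) u v = c • block X u v := rfl

lemma block_sum {α : Type*} (s : Finset α) (X : α → Matrix (ι × ι) (ι × ι) ℂ) (u v : ι) :
    block (∑ a ∈ s, X a) u v = ∑ a ∈ s, block (X a) u v := by
  ext a b
  simp [block, Matrix.sum_apply]

lemma block_ampliation (Φ : Superop ι) (X : Matrix (ι × ι) (ι × ι) ℂ) (u v : ι) :
    block (ampliation Φ X) u v = Φ (block X u v) := rfl

lemma block_kronecker_one_mul (A : Matrix ι ι ℂ) (X : Matrix (ι × ι) (ι × ι) ℂ) (u v : ι) :
    block (A ⊗ₖ (1 : Matrix ι ι ℂ) * X) u v = A * block X u v := by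
  ext a b
  simp [block, Matrix.mul_apply, Fintype.sum_prod_type, Matrix.kroneckerMap_apply, Matrix.one_apply]

lemma block_mul_kronecker_one (A : Matrix ι ι ℂ) (X : Matrix (ι × ι) (ι × ι) ℂ) (u v : ι) :
    block (X * A ⊗ₖ (1 : Matrix ι ι ℂ)) u v = block X u v * A := by
  ext a b
  simp [block, Matrix.mul_apply, Fintype.sum_prod_type, Matrix.kroneckerMap_apply, Matrix.one_apply]

/-- Amplification `Φ ↦ Φ ⊗ id`, as a homomorphism of algebras. -/
def ampHom : Superop ι →ₐ[ℂ] Superop (ι × ι) where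
  toFun Φ :=
    { toFun := ampliation Φ
      map_add' := fun X Y => block_ext fun u v => by
        simp only [block_ampliation, block_add, map_add]
      map_smul' := fun c X => block_ext fun u v => by
        simp only [block_ampliation, block_smul, map_smul, RingHom.id_apply] }
  map_one' := rfl
  map_mul' _ _ := rfl
  map_zero' := rfl
  map_add' _ _ := rfl
  commutes' _ := rfl

lemma ampHom_apply (Φ : Superop ι) (X : Matrix (ι × ι) (ι × ι) ℂ) :
    ampHom Φ X = ampliation Φ X := rfl

lemma IsLindbladian.ampHom {Φ : Superop ι} (hΦ : IsLindbladian Φ) :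
    IsLindbladian (ampHom Φ) := by
  obtain ⟨H, n, J, hH, hΦ⟩ := hΦ
  refine ⟨H ⊗ₖ 1, n, fun ν => J ν ⊗ₖ 1, ?_, fun X => block_ext fun u v => ?_⟩
  · rw [Matrix.IsHermitian, Matrix.conjTranspose_kronecker, hH.eq, Matrix.conjTranspose_one]
  · have hc : ∀ A : Matrix ι ι ℂ, (A ⊗ₖ (1 : Matrix ι ι ℂ)).conjTranspose = A.conjTranspose ⊗ₖ 1 :=
      fun A => by rw [Matrix.conjTranspose_kronecker, Matrix.conjTranspose_one]
    have hm : ∀ A B : Matrix ι ι ℂ, A ⊗ₖ (1 : Matrix ι ι ℂ) * B ⊗ₖ 1 = (A * B) ⊗ₖ 1 :=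
      fun A B => by rw [← Matrix.mul_kronecker_mul, mul_one]
    rw [ampHom_apply, block_ampliation, hΦ]
    simp only [hc, hm, block_add, block_sub, block_smul, block_sum, block_kronecker_one_mul,
      block_mul_kronecker_one]

/-- The matrix `A ⊗ 1` acts on each column of a vector of the tensor product by `A`. -/
lemma opNorm_kronecker_one_le (A : Matrix ι ι ℂ) :
    opNorm (A ⊗ₖ (1 : Matrix ι ι ℂ)) ≤ opNorm A := by
  refine ContinuousLinearMap.opNorm_le_bound _ (opNorm_nonneg A) fun x => ?_
  refine (sq_le_sq₀ (norm_nonneg _) (mul_nonneg (opNorm_nonneg A) (norm_nonneg _))).1 ?_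
  have h1 : ‖mop (A ⊗ₖ (1 : Matrix ι ι ℂ)) x‖ ^ 2 =
      ∑ j, ‖mop A (WithLp.toLp 2 fun i => x (i, j))‖ ^ 2 := by
    simp only [EuclideanSpace.norm_sq_eq, Fintype.sum_prod_type]
    rw [sum_comm]
    refine sum_congr rfl fun j _ => sum_congr rfl fun i _ => ?_
    congr 2
    simp [Matrix.ofLp_toEuclideanCLM, Matrix.mulVec, dotProduct, Fintype.sum_prod_type,
      Matrix.kroneckerMap_apply, Matrix.one_apply]
  have h2 : ‖x‖ ^ 2 = ∑ j, ‖(WithLp.toLp 2 fun i => x (i, j) : EuclideanSpace ℂ ι)‖ ^ 2 := by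
    simp only [EuclideanSpace.norm_sq_eq, Fintype.sum_prod_type]
    rw [sum_comm]
  change ‖mop (A ⊗ₖ (1 : Matrix ι ι ℂ)) x‖ ^ 2 ≤ _
  rw [h1, mul_pow, h2, mul_sum]
  refine sum_le_sum fun j _ => ?_
  rw [← mul_pow]
  gcongr
  exact norm_mop_le _ _

/-- Superoperators, amplified, as bounded operators on the trace class. -/
def amp : Superop ι →ₐ[ℂ] BSuperop (ι × ι) := (bsup : Superop (ι × ι) ≃ₐ[ℂ] _).toAlgHom.comp ampHom

/-- The diamond norm is the operator norm of the amplification with respect to the trace norm. -/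
lemma diamondNorm_eq (Φ : Superop ι) : diamondNorm Φ = ‖amp Φ‖ := by
  rw [← ContinuousLinearMap.sSup_unitClosedBall_eq_norm, diamondNorm]
  congr 1
  ext c
  constructor
  · rintro ⟨X, hX, rfl⟩
    exact ⟨X, mem_closedBall_zero_iff.2 hX, rfl⟩
  · rintro ⟨X, hX, rfl⟩
    exact ⟨X, mem_closedBall_zero_iff.1 hX, rfl⟩

end Amplification

/-! ### The commutator quantities in the Banach algebra -/

section Exponential

variable {ι : Type} [Fintype ι] [DecidableEq ι]

/-- Algebra homomorphisms from matrices commute with the exponential: they are continuous since the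
matrices form a finite-dimensional space. -/
lemma map_exp_matrix {κ : Type} [Fintype κ] [DecidableEq κ] {B : Type*} [NormedRing B]
    [NormedAlgebra ℂ B] (F : Matrix κ κ ℂ →ₐ[ℂ] B) (M : Matrix κ κ ℂ) :
    F (NormedSpace.exp M) = NormedSpace.exp (F M) := by
  set E := (Matrix.toEuclideanCLM (n := κ) (𝕜 := ℂ)).toAlgEquiv
  have hsum := NormedSpace.exp_series_hasSum_exp' (𝕂 := ℂ) (E M)
  have h1 := hsum.map E.symm.toLinearMap E.symm.toLinearMap.continuous_of_finiteDimensional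
  have h2 := hsum.map (F.toLinearMap ∘ₗ E.symm.toLinearMap)
    (F.toLinearMap ∘ₗ E.symm.toLinearMap).continuous_of_finiteDimensional
  rw [NormedSpace.exp_eq_tsum ℂ, NormedSpace.exp_eq_tsum ℂ]
  have e1 := h1.tsum_eq
  have e2 := h2.tsum_eq
  simp only [Function.comp_def, LinearMap.comp_apply, AlgEquiv.toLinearMap_apply,
    AlgHom.toLinearMap_apply, map_smul, map_pow, E.symm_apply_apply] at e1 e2
  beta_reduce
  rw [e1, e2]

/-- Homomorphisms to Banach algebras map `superExp` to the exponential. -/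
lemma map_superExp {B : Type*} [NormedRing B] [NormedAlgebra ℂ B] (F : Superop ι →ₐ[ℂ] B)
    (Φ : Superop ι) : F (superExp Φ) = NormedSpace.exp (F Φ) := by
  have h := map_exp_matrix
    (F.comp ((LinearMap.toMatrixAlgEquiv (Matrix.stdBasis ℂ ι ι)).symm.toAlgHom))
    (LinearMap.toMatrixAlgEquiv (Matrix.stdBasis ℂ ι ι) Φ)
  simpa [superExp] using h

lemma map_productFormula {m : ℕ} {B : Type*} [NormedRing B] [NormedAlgebra ℂ B]
    (F : Superop ι →ₐ[ℂ] B) (L : Fin m → Superop ι) (τ : ℝ) :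
    F (productFormula L τ) = stageProd (fun j => F (L j)) τ (palindrome m) := by
  rw [productFormula, stageProd, palindrome, List.map_append, List.prod_append, map_mul,
    map_list_prod, map_list_prod, List.map_reverse, List.map_reverse, List.map_ofFn,
    List.ofFn_eq_map]
  have : (fun j => NormedSpace.exp ((τ / 2) • F (L j))) =
      F ∘ fun j => superExp (((τ / 2 : ℝ) : ℂ) • L j) := by
    funext j
    simp only [Function.comp_apply]
    rw [map_superExp, map_smul, Complex.coe_smul]
  rw [this]

lemma map_nestedComm {B : Type*} [Ring B] [Algebra ℂ B] (F : Superop ι →ₐ[ℂ] B)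
    (l : List (Superop ι)) : F (nestedComm l) = ncomm (l.map F) := by
  induction l with
  | nil => simp [nestedComm, ncomm]
  | cons a l ih =>
    cases l with
    | nil => simp [nestedComm, ncomm]
    | cons b l =>
      simp only [nestedComm, map_sub, map_mul, ih, List.map_cons, ncomm]

lemma alphaGrade_eq {m : ℕ} (L : Fin m → Superop ι) (q : ℕ) :
    alphaGrade L q = gradeNorm (fun j => amp (L j)) q := by
  simp only [alphaGrade, gradeNorm, diamondNorm_eq, map_nestedComm, List.map_ofFn]
  rfl

lemma alphaComm_eq {m : ℕ} (L : Fin m → Superop ι) {k : ℕ} (q : Fin (k + 1) → ℕ) :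
    alphaComm L q = weightedCommNorm (fun j => amp (L j)) (fun _ => 1) q := by
  simp only [alphaComm, weightedCommNorm, diamondNorm_eq, map_nestedComm, List.map_ofFn, one_mul]
  refine sum_congr rfl fun w _ => ?_
  congr 3
  funext a
  simp only [Function.comp_apply, map_nestedComm, List.map_ofFn]
  rfl

/-- The term of `alphaTrunc` with `d = 0` factors vanishes, as its sum over grades is empty; the
remaining ones are those of `weightedTail`. -/
lemma alphaTrunc_eq {m : ℕ} (L : Fin m → Superop ι) (q₀ : ℕ) {τ : ℝ} (hτ : 0 ≤ τ) :
    alphaTrunc L q₀ τ = weightedTail (fun j => amp (L j)) (fun _ => 1) q₀ τ := by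
  have hs := summable_tailTerm (fun j => amp (L j)) (fun _ => zero_le_one) (fun _ => le_rfl) q₀ hτ
  rw [alphaTrunc, weightedTail]
  rw [Summable.tsum_eq_zero_add]
  · rw [filter_eq_empty_iff.2, sum_empty, mul_zero, zero_add]
    · simp only [alphaComm_eq, tailTerm]
    · intro q _
      simp
  · rw [← summable_nat_add_iff 1]
    simp only [alphaComm_eq]
    exact hs

end Exponential

/-! ### Evolution of states and expectation values -/

section States

variable {ι : Type} [Fintype ι] [DecidableEq ι]

/-- The trace as a continuous functional. -/
def traceFunctional (κ : Type) [Fintype κ] [DecidableEq κ] : TraceClass κ →L[ℂ] ℂ :=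
  LinearMap.toContinuousLinearMap (Matrix.traceLinearMap κ ℂ ℂ : Matrix κ κ ℂ →ₗ[ℂ] ℂ)

lemma trace_lindbladian {Φ : Superop ι} (hΦ : IsLindbladian Φ) (X : Matrix ι ι ℂ) :
    (Φ X).trace = 0 := by
  obtain ⟨H, n, J, hH, hΦ⟩ := hΦ
  rw [hΦ, Matrix.trace_add, Matrix.trace_smul, Matrix.trace_sub, Matrix.trace_mul_comm X H, sub_self,
    smul_zero, zero_add, Matrix.trace_sum]
  refine sum_eq_zero fun ν _ => ?_
  rw [Matrix.trace_sub, Matrix.trace_smul, Matrix.trace_add, Matrix.trace_mul_comm X,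
    Matrix.trace_mul_cycle, ← two_smul ℂ, smul_smul]
  norm_num

lemma trace_exp_apply {A : BSuperop ι} (hA : ∀ X, traceFunctional ι (A X) = 0) (X : TraceClass ι) :
    traceFunctional ι (NormedSpace.exp A X) = traceFunctional ι X := by
  have h := NormedSpace.exp_series_hasSum_exp' (𝕂 := ℂ) A
  have h2 := ((traceFunctional ι).comp (ContinuousLinearMap.apply ℂ (TraceClass ι) X)).hasSum h
  refine h2.unique ?_
  have h3 : ∀ n ≠ 0, ((traceFunctional ι).comp (ContinuousLinearMap.apply ℂ (TraceClass ι) X))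
      (((n.factorial : ℂ)⁻¹) • A ^ n) = 0 := by
    intro n hn
    obtain ⟨n, rfl⟩ := Nat.exists_eq_succ_of_ne_zero hn
    rw [map_smul]
    have : ((traceFunctional ι).comp (ContinuousLinearMap.apply ℂ (TraceClass ι) X)) (A ^ (n + 1)) =
        traceFunctional ι (A ((A ^ n) X)) := by rw [pow_succ']; rfl
    rw [this, hA, smul_zero]
  have h4 := hasSum_single 0 h3
  simpa using! h4

/-- Stage products of trace-annihilating generators preserve the trace. -/
lemma trace_stageProd_apply {m : ℕ} {A : Fin m → BSuperop ι}
    (hA : ∀ j X, traceFunctional ι (A j X) = 0) (τ : ℝ) (J : List (Fin m)) (X : TraceClass ι) :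
    traceFunctional ι (stageProd A τ J X) = traceFunctional ι X := by
  induction J with
  | nil => rfl
  | cons j J ih =>
    rw [stageProd, List.map_cons, List.prod_cons]
    refine Eq.trans (trace_exp_apply (fun Y => ?_) _) ih
    have : ((τ / 2) • A j) Y = ((τ / 2 : ℝ) : ℂ) • A j Y := by rw [← Complex.coe_smul]; rfl
    rw [this, map_smul, hA, smul_zero]

/-- The trace norm of a positive semidefinite matrix is at most its trace. -/
lemma traceNorm_le_trace_re {X : Matrix ι ι ℂ} (hX : X.PosSemidef) :
    traceNorm X ≤ X.trace.re := by
  refine traceNorm_le fun B hB => ?_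
  set u := hX.1.eigenvectorBasis with hu
  have hXu : ∀ k, mop X (u k) = (hX.1.eigenvalues k : ℂ) • u k := fun k => by
    apply (WithLp.equiv 2 _).injective
    have := hX.1.mulVec_eigenvectorBasis k
    simpa using! this
  rw [trace_eq_sum_inner _ u, hX.1.trace_eq_sum_eigenvalues, Complex.re_sum]
  refine norm_sum_le_of_le _ fun k _ => ?_
  rw [mop_mul, hXu, map_smul, inner_smul_right, norm_mul, Complex.norm_real,
    Real.norm_of_nonneg (hX.eigenvalues_nonneg k)]
  refine mul_le_of_le_one_right (hX.eigenvalues_nonneg k) ((norm_inner_le_norm _ _).trans ?_)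
  refine mul_le_one₀ (u.norm_eq_one k).le (norm_nonneg _) ((norm_mop_le _ _).trans ?_)
  rwa [u.norm_eq_one, mul_one]

/-- Trace duality with the operator that is diagonal in the given basis and cancels the phases of
the diagonal entries of `Y`. -/
lemma sum_norm_inner_le_traceNorm (Y : Matrix ι ι ℂ) {α : Type*} [Fintype α]
    (b : OrthonormalBasis α ℂ (EuclideanSpace ℂ ι)) :
    ∑ k, ‖(inner ℂ (b k) (mop Y (b k)) : ℂ)‖ ≤ traceNorm Y := by
  classical
  set z : α → ℂ := fun k => inner ℂ (b k) (mop Y (b k)) with hz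
  -- for `z k = 0` the phase is `0`, by the convention for division by zero
  set β : α → ℂ := fun k => (starRingEnd ℂ) (z k) * ((‖z k‖⁻¹ : ℝ) : ℂ) with hβ
  have hβ1 : ∀ k, ‖β k‖ ≤ 1 := fun k => by
    rw [hβ]
    simp only [norm_mul, RCLike.norm_conj, Complex.norm_real, norm_inv, norm_norm]
    exact mul_inv_le_one
  have hβz : ∀ k, β k * z k = ((‖z k‖ : ℝ) : ℂ) := fun k => by
    rw [hβ]
    simp only
    rw [mul_right_comm, Complex.conj_mul', ← Complex.ofReal_pow, ← Complex.ofReal_mul]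
    congr 1
    rcases eq_or_ne ‖z k‖ 0 with h | h
    · simp [h]
    · field_simp
  set T : EuclideanSpace ℂ ι →L[ℂ] EuclideanSpace ℂ ι :=
    ∑ k, (β k) • (innerSL ℂ (b k)).smulRight (b k) with hT
  have hTx : ∀ x k, inner ℂ (b k) (T x) = β k * inner ℂ (b k) x := fun x k => by
    have : T x = ∑ l, β l • (inner ℂ (b l) x • b l) := by rw [hT, _root_.sum_apply]; rfl
    rw [this, inner_sum, sum_eq_single k]
    · rw [inner_smul_right, inner_smul_right, orthonormal_iff_ite.1 b.orthonormal]; simp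
    · intro l _ hl
      rw [inner_smul_right, inner_smul_right, orthonormal_iff_ite.1 b.orthonormal, if_neg hl.symm]
      simp
    · simp
  have hT1 : ‖T‖ ≤ 1 := by
    refine ContinuousLinearMap.opNorm_le_bound _ zero_le_one fun x => ?_
    rw [one_mul, ← sq_le_sq₀ (norm_nonneg _) (norm_nonneg _), ← b.sum_sq_norm_inner_right (T x),
      ← b.sum_sq_norm_inner_right x]
    refine sum_le_sum fun k _ => ?_
    rw [hTx, norm_mul]
    gcongr
    exact mul_le_of_le_one_left (norm_nonneg _) (hβ1 k)
  have hBT : mop ((Matrix.toEuclideanCLM (n := ι) (𝕜 := ℂ)).symm T) = T := by simp [mop]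
  have h := norm_trace_mul_le_of_le_one
    (B := (Matrix.toEuclideanCLM (n := ι) (𝕜 := ℂ)).symm T) (X := Y) (by
      rw [opNorm]; simpa using hT1)
  rw [trace_eq_sum_inner _ b] at h
  have h2 : ∑ k, inner ℂ (b k) (mop ((Matrix.toEuclideanCLM (n := ι) (𝕜 := ℂ)).symm T * Y) (b k)) =
      ((∑ k, ‖z k‖ : ℝ) : ℂ) := by
    push_cast
    refine sum_congr rfl fun k _ => ?_
    rw [mop_mul, hBT, hTx, ← hβz]
  rw [h2, Complex.norm_real] at h
  exact (le_abs_self _).trans h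

/-- A matrix of trace one and trace norm at most one has nonnegative expectations in orthonormal
bases. -/
lemma inner_nonneg_of_traceNorm_le {Y : Matrix ι ι ℂ} (h1 : Y.trace = 1) (h : traceNorm Y ≤ 1)
    {α : Type*} [Fintype α] (b : OrthonormalBasis α ℂ (EuclideanSpace ℂ ι)) (k : α) :
    (inner ℂ (b k) (mop Y (b k)) : ℂ).im = 0 ∧ 0 ≤ (inner ℂ (b k) (mop Y (b k)) : ℂ).re := by
  set z : α → ℂ := fun k => inner ℂ (b k) (mop Y (b k)) with hz
  have hs : ∑ k, (z k).re = 1 := by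
    rw [← Complex.re_sum, hz, ← trace_eq_sum_inner, h1, Complex.one_re]
  have hle : ∑ k, (‖z k‖ - (z k).re) ≤ 0 := by
    rw [sum_sub_distrib, hs]
    linarith [sum_norm_inner_le_traceNorm Y b]
  have h0 : ∀ k ∈ univ, 0 ≤ ‖z k‖ - (z k).re := fun k _ => sub_nonneg.2 (Complex.re_le_norm _)
  have hk := (sum_eq_zero_iff_of_nonneg h0).1 (le_antisymm hle (sum_nonneg h0)) k (mem_univ k)
  have hre : (z k).re = ‖z k‖ := by linarith
  have := Complex.abs_re_eq_norm.1 (by rw [hre, abs_of_nonneg (norm_nonneg _)] : |(z k).re| = ‖z k‖)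
  exact ⟨this, by change 0 ≤ (z k).re; rw [hre]; exact norm_nonneg _⟩

lemma nonempty_of_isDensity {ρ : Matrix ι ι ℂ} (hρ : IsDensity ρ) : Nonempty ι := by
  by_contra h
  rw [not_nonempty_iff] at h
  have := hρ.2
  simp [Matrix.trace] at this

variable {m : ℕ}

lemma trace_trotterState {L : Fin m → Superop ι} (hL : ∀ j, IsLindbladian (L j)) (t : ℝ) (N : ℕ)
    (ρ : Matrix ι ι ℂ) : (trotterState L t N ρ).trace = ρ.trace := by
  have h : ∀ k, ((productFormula L (t / N) ^ k) ρ).trace = ρ.trace := by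
    intro k
    induction k with
    | zero => rfl
    | succ k ih =>
      rw [pow_succ', ← ih, Module.End.mul_apply]
      have := trace_stageProd_apply (A := fun j => bsup (L j))
        (fun j X => trace_lindbladian (hL j) X) (t / N) (palindrome m)
        ((productFormula L (t / N) ^ k) ρ : Matrix ι ι ℂ)
      have e : (bsup (productFormula L (t / N)) : BSuperop ι) =
          stageProd (fun j => bsup (L j)) (t / N) (palindrome m) :=
        map_productFormula (bsup : Superop ι ≃ₐ[ℂ] BSuperop ι).toAlgHom L _
      rw [← e] at this
      exact this
  exact h N

/-- Trotter steps do not increase the trace norm. -/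
lemma traceNorm_trotterState_le {L : Fin m → Superop ι} (hL : ∀ j, IsLindbladian (L j)) {t : ℝ}
    (ht : 0 ≤ t) (N : ℕ) {ρ : Matrix ι ι ℂ} (hρ : IsDensity ρ) :
    traceNorm (trotterState L t N ρ) ≤ 1 := by
  have := nonempty_of_isDensity hρ
  have h1 : traceNorm ρ ≤ 1 := by
    have := traceNorm_le_trace_re hρ.1
    rwa [hρ.2, Complex.one_re] at this
  set F : BSuperop ι := stageProd (fun j => bsup (L j)) (t / N) (palindrome m)
  have hF : ‖F‖ ≤ 1 := norm_stageProd_le (fun j => (hL j).dissipative) (by positivity) _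
  have hFN : ‖F ^ N‖ ≤ 1 := (norm_pow_le _ _).trans (pow_le_one₀ (norm_nonneg _) hF)
  have h2 : (bsup (productFormula L (t / N) ^ N) : BSuperop ι) = F ^ N := by
    rw [map_pow]
    congr 1
    exact map_productFormula (bsup : Superop ι ≃ₐ[ℂ] BSuperop ι).toAlgHom L _
  have h3 := (F ^ N).le_of_opNorm_le hFN (ρ : TraceClass ι)
  rw [← h2, one_mul] at h3
  exact le_trans h3 h1

/-- The expectation of `O ⊗ 1` after the application of an amplified superoperator to
`ρ ⊗ |i⟩⟨i|`. -/
def expectation (O ρ : Matrix ι ι ℂ) (i : ι) : BSuperop (ι × ι) →L[ℂ] ℂ :=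
  ((traceFunctional (ι × ι)).comp (bsup (LinearMap.mulLeft ℂ (O ⊗ₖ (1 : Matrix ι ι ℂ))))).comp
    (ContinuousLinearMap.apply ℂ (TraceClass (ι × ι)) (ρ ⊗ₖ Matrix.single i i (1 : ℂ)))

lemma norm_expectation_le (O : Matrix ι ι ℂ) {ρ : Matrix ι ι ℂ} (hρ : IsDensity ρ) (i : ι)
    (a : BSuperop (ι × ι)) : ‖expectation O ρ i a‖ ≤ opNorm O * ‖a‖ := by
  have h1 : traceNorm (ρ ⊗ₖ Matrix.single i i (1 : ℂ)) ≤ 1 := by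
    have hs : (Matrix.single i i (1 : ℂ)).PosSemidef := by
      rw [← Matrix.diagonal_single]
      refine Matrix.PosSemidef.diagonal fun j => ?_
      by_cases h : j = i
      · subst h; simp
      · simp [h]
    have := traceNorm_le_trace_re (hρ.1.kronecker hs)
    rwa [Matrix.trace_kronecker, hρ.2, Matrix.trace_single_eq_same, one_mul, Complex.one_re] at this
  refine (norm_trace_mul_le (κ := ι × ι) (O ⊗ₖ (1 : Matrix ι ι ℂ))
    (a (ρ ⊗ₖ Matrix.single i i (1 : ℂ) : Matrix (ι × ι) (ι × ι) ℂ))).trans ?_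
  have h2 := a.le_opNorm (ρ ⊗ₖ Matrix.single i i (1 : ℂ) : Matrix (ι × ι) (ι × ι) ℂ)
  have h3 : traceNorm (ι := ι × ι) (a (ρ ⊗ₖ Matrix.single i i (1 : ℂ) : Matrix (ι × ι) (ι × ι) ℂ)) ≤ ‖a‖ :=
    h2.trans (mul_le_of_le_one_right (norm_nonneg _) h1)
  exact mul_le_mul (opNorm_kronecker_one_le O) h3 (traceNorm_nonneg _) (opNorm_nonneg _)

/-- Tracing out the ancilla, which remains in the state `|i⟩⟨i|`. -/
lemma expectation_amp (O ρ : Matrix ι ι ℂ) (i : ι) (Φ : Superop ι) :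
    expectation O ρ i (amp Φ) = (O * Φ ρ).trace := by
  have hb : ∀ u v, block (ρ ⊗ₖ Matrix.single i i (1 : ℂ)) u v = if u = i ∧ v = i then ρ else 0 := by
    intro u v
    ext a b
    by_cases h : u = i ∧ v = i
    · simp [block, Matrix.kroneckerMap_apply, h]
    · have h' : ¬ (i = u ∧ i = v) := fun h2 => h ⟨h2.1.symm, h2.2.symm⟩
      simp [block, Matrix.kroneckerMap_apply, h, h']
  have ht : ∀ Y : Matrix (ι × ι) (ι × ι) ℂ, Y.trace = ∑ u, (block Y u u).trace := by
    intro Y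
    simp only [Matrix.trace, Matrix.diag, Fintype.sum_prod_type, block, Matrix.of_apply]
    exact sum_comm
  change (O ⊗ₖ (1 : Matrix ι ι ℂ) * ampliation Φ (ρ ⊗ₖ Matrix.single i i (1 : ℂ))).trace = _
  rw [ht, sum_eq_single i]
  · rw [block_kronecker_one_mul, block_ampliation, hb, if_pos ⟨rfl, rfl⟩]
  · intro u _ hu
    rw [block_kronecker_one_mul, block_ampliation, hb, if_neg fun h => hu h.1, map_zero, mul_zero,
      Matrix.trace_zero]
  · simp

end States

end

section

open Finset MeasureTheory ProbabilityTheory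

/-! ### Chebyshev's inequality with probability two thirds -/

section Chebyshev

/-- Chebyshev's inequality, including the degenerate case `c = 0`. -/
lemma two_thirds_le_real_abs_sub_le {Ω : Type*} [MeasurableSpace Ω] {μ : Measure Ω}
    [IsProbabilityMeasure μ] {X : Ω → ℝ} (hXm : Measurable X) (hX : MemLp X 2 μ) {c : ℝ}
    (hc : 0 ≤ c) (hv : 3 * variance X μ ≤ c ^ 2) : 2 / 3 ≤ μ.real {ω | |X ω - ∫ ω, X ω ∂μ| ≤ c} := by
  rcases hc.eq_or_lt with rfl | hc
  · -- Chebyshev's inequality does not apply, but the variable is almost surely constant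
    have h0 : variance X μ = 0 := le_antisymm (by linarith) (variance_nonneg _ _)
    have h1 : evariance X μ = 0 := by
      rw [← hX.ofReal_variance_eq, h0, ENNReal.ofReal_zero]
    have h2 := (evariance_eq_zero_iff hX.1.aemeasurable).1 h1
    have h3 : μ {ω | |X ω - ∫ ω, X ω ∂μ| ≤ 0} = 1 := by
      rw [measure_congr (Filter.eventuallyEq_univ.2 (h2.mono fun ω hω => by simp [hω])),
        measure_univ]
    rw [Measure.real, h3]
    norm_num
  · have hcheb := meas_ge_le_variance_div_sq hX hc
    have hms : MeasurableSet {ω | c ≤ |X ω - ∫ ω, X ω ∂μ|} :=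
      measurableSet_le measurable_const (by fun_prop)
    have h1 : μ.real {ω | c ≤ |X ω - ∫ ω, X ω ∂μ|} ≤ 1 / 3 := by
      rw [Measure.real]
      refine (ENNReal.toReal_mono ENNReal.ofReal_ne_top hcheb).trans ?_
      rw [ENNReal.toReal_ofReal (div_nonneg (variance_nonneg _ _) (sq_nonneg _)),
        div_le_iff₀ (by positivity)]
      linarith
    have h2 : μ.real {ω | c ≤ |X ω - ∫ ω, X ω ∂μ|}ᶜ = 1 - μ.real {ω | c ≤ |X ω - ∫ ω, X ω ∂μ|} :=
      probReal_compl_eq_one_sub hms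
    have h3 : μ.real {ω | c ≤ |X ω - ∫ ω, X ω ∂μ|}ᶜ ≤ μ.real {ω | |X ω - ∫ ω, X ω ∂μ| ≤ c} :=
      measureReal_mono fun ω hω => (not_le.1 (Set.notMem_ofPred_iff.1 hω)).le
    linarith

end Chebyshev

/-! ### Outcomes of a measurement -/

section Law

variable {ι : Type} [Fintype ι] [DecidableEq ι] {O : Matrix ι ι ℂ} (hO : O.IsHermitian)

/-- The probabilities of the outcomes of a measurement. -/
def outcomeWeight (ρ : Matrix ι ι ℂ) (k : ι) : ℝ :=
  (inner ℂ (hO.eigenvectorBasis k) (mop ρ (hO.eigenvectorBasis k)) : ℂ).re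

lemma measurementLaw_eq (ρ : Matrix ι ι ℂ) : measurementLaw hO ρ =
    ∑ k, ENNReal.ofReal (outcomeWeight hO ρ k) • Measure.dirac (hO.eigenvalues k) := by
  rw [measurementLaw]
  refine sum_congr rfl fun k _ => ?_
  congr 2
  rw [outcomeWeight, EuclideanSpace.inner_eq_star_dotProduct, dotProduct_comm]
  rfl

lemma abs_eigenvalues_le (k : ι) : |hO.eigenvalues k| ≤ opNorm O := by
  have h : mop O (hO.eigenvectorBasis k) = (hO.eigenvalues k : ℂ) • hO.eigenvectorBasis k := by
    apply (WithLp.equiv 2 _).injective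
    have := hO.mulVec_eigenvectorBasis k
    simpa using! this
  have h2 := norm_mop_le O (hO.eigenvectorBasis k)
  rwa [h, norm_smul, (hO.eigenvectorBasis).norm_eq_one, mul_one, mul_one, Complex.norm_real] at h2

variable {ρ : Matrix ι ι ℂ} (h1 : ρ.trace = 1) (h : traceNorm ρ ≤ 1)
include h1 h

lemma outcomeWeight_nonneg (k : ι) : 0 ≤ outcomeWeight hO ρ k :=
  (inner_nonneg_of_traceNorm_le h1 h hO.eigenvectorBasis k).2

lemma outcomeWeight_eq (k : ι) : ((outcomeWeight hO ρ k : ℝ) : ℂ) =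
    inner ℂ (hO.eigenvectorBasis k) (mop ρ (hO.eigenvectorBasis k)) :=
  Complex.ext rfl (inner_nonneg_of_traceNorm_le h1 h hO.eigenvectorBasis k).1.symm

lemma sum_outcomeWeight : ∑ k, outcomeWeight hO ρ k = 1 := by
  have := trace_eq_sum_inner ρ hO.eigenvectorBasis
  rw [h1] at this
  apply Complex.ofReal_injective
  push_cast
  simp only [outcomeWeight_eq hO h1 h, this]

lemma isProbabilityMeasure_measurementLaw : IsProbabilityMeasure (measurementLaw hO ρ) := by
  refine ⟨?_⟩
  rw [measurementLaw_eq, Measure.finsetSum_apply]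
  simp only [Measure.smul_apply, measure_univ, smul_eq_mul, mul_one]
  rw [← ENNReal.ofReal_sum_of_nonneg fun k _ => outcomeWeight_nonneg hO h1 h k,
    sum_outcomeWeight hO h1 h, ENNReal.ofReal_one]

lemma integral_measurementLaw (f : ℝ → ℝ) :
    ∫ x, f x ∂measurementLaw hO ρ = ∑ k, outcomeWeight hO ρ k * f (hO.eigenvalues k) := by
  rw [measurementLaw_eq, integral_finsetSum_measure]
  · refine sum_congr rfl fun k _ => ?_
    rw [integral_smul_measure, integral_dirac, ENNReal.toReal_ofReal (outcomeWeight_nonneg hO h1 h k),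
      smul_eq_mul]
  · intro k _
    exact (integrable_dirac (by simp)).smul_measure ENNReal.ofReal_ne_top

/-- The mean outcome is the expectation value of the observable. -/
lemma integral_id_measurementLaw :
    ((∫ x, x ∂measurementLaw hO ρ : ℝ) : ℂ) = (O * ρ).trace := by
  rw [integral_measurementLaw hO h1 h fun x => x, Matrix.trace_mul_comm,
    trace_eq_sum_inner _ hO.eigenvectorBasis]
  push_cast
  refine sum_congr rfl fun k _ => ?_
  have h2 : mop O (hO.eigenvectorBasis k) = (hO.eigenvalues k : ℂ) • hO.eigenvectorBasis k := by
    apply (WithLp.equiv 2 _).injective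
    have := hO.mulVec_eigenvectorBasis k
    simpa using! this
  rw [outcomeWeight_eq hO h1 h, mop_mul, h2, map_smul, inner_smul_right, mul_comm]

lemma memLp_measurementLaw : MemLp (fun x : ℝ => x) 2 (measurementLaw hO ρ) := by
  have := isProbabilityMeasure_measurementLaw hO h1 h
  refine MemLp.of_bound measurable_id.aestronglyMeasurable (opNorm O) ?_
  have hms : MeasurableSet {x : ℝ | ¬ ‖x‖ ≤ opNorm O} :=
    (measurableSet_le measurable_norm measurable_const).compl
  rw [ae_iff, measurementLaw_eq, Measure.finsetSum_apply]
  refine sum_eq_zero fun k _ => ?_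
  rw [Measure.smul_apply, Measure.dirac_apply' _ hms]
  simp [abs_eigenvalues_le hO k]

lemma variance_measurementLaw_le :
    variance (fun x : ℝ => x) (measurementLaw hO ρ) ≤ opNorm O ^ 2 := by
  have := isProbabilityMeasure_measurementLaw hO h1 h
  refine (variance_le_expectation_sq (X := fun x : ℝ => x) measurable_id.aestronglyMeasurable).trans ?_
  have e : ∫ x, ((fun x : ℝ => x) ^ 2) x ∂measurementLaw hO ρ =
      ∑ k, outcomeWeight hO ρ k * (hO.eigenvalues k) ^ 2 :=
    integral_measurementLaw hO h1 h fun x => x ^ 2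
  rw [e]
  calc _ ≤ ∑ k, outcomeWeight hO ρ k * opNorm O ^ 2 := by
        refine sum_le_sum fun k _ => mul_le_mul_of_nonneg_left ?_ (outcomeWeight_nonneg hO h1 h k)
        rw [← sq_abs]
        gcongr
        exact abs_eigenvalues_le hO k
    _ = _ := by rw [← sum_mul, sum_outcomeWeight hO h1 h, one_mul]

end Law

/-! ### The statistical error of the estimate -/

section Estimate

/-- With probability at least `2/3` the estimate from `S` runs for each of `p` states is within `c`
of its mean, if three times its variance is at most `c²`. -/
lemma estimate_deviation {ι : Type} [Fintype ι] [DecidableEq ι] {O : Matrix ι ι ℂ}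
    (hO : O.IsHermitian) {p S : ℕ} (hS : 1 ≤ S) (ρ : Fin p → Matrix ι ι ℂ)
    (h1 : ∀ i, (ρ i).trace = 1) (h : ∀ i, traceNorm (ρ i) ≤ 1) {c : ℝ} (hc : 0 ≤ c)
    (hcS : 3 * (opNorm O ^ 2 * (∑ i : Fin p, richCoeff p (i + 1) ^ 2) / S) ≤ c ^ 2) :
    2 / 3 ≤ (Measure.pi fun ij : Fin p × Fin S => measurementLaw hO (ρ ij.1)).real
      {μ | ‖((estimate p S μ : ℝ) : ℂ) -
        ∑ i : Fin p, (richCoeff p (i + 1) : ℂ) * (O * ρ i).trace‖ ≤ c} := by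
  have hprob : ∀ i, IsProbabilityMeasure (measurementLaw hO (ρ i)) := fun i =>
    isProbabilityMeasure_measurementLaw hO (h1 i) (h i)
  have hS0 : (S : ℝ) ≠ 0 := by positivity
  set P := Measure.pi fun ij : Fin p × Fin S => measurementLaw hO (ρ ij.1) with hP
  set X : Fin p × Fin S → ℝ → ℝ := fun ij x => (richCoeff p (ij.1 + 1) / S) * x with hX
  have hest : estimate p S = fun μ => ∑ ij, X ij (μ ij) := by
    funext μ
    rw [estimate, Fintype.sum_prod_type]
    refine sum_congr rfl fun i _ => ?_
    simp only [hX]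
    rw [← mul_sum]
    ring
  have hXL : ∀ ij, MemLp (X ij) 2 (measurementLaw hO (ρ ij.1)) := fun ij =>
    (memLp_measurementLaw hO (h1 ij.1) (h ij.1)).const_mul _
  have hcomp : ∀ ij, MemLp (fun μ : Fin p × Fin S → ℝ => X ij (μ ij)) 2 P := fun ij =>
    (hXL ij).comp_measurePreserving (measurePreserving_eval _ ij)
  have hL : MemLp (estimate p S) 2 P := by
    rw [hest]
    exact memLp_finsetSum _ fun ij _ => hcomp ij
  have hm : Measurable (estimate p S) := by
    rw [hest]
    fun_prop
  have hmean : ((∫ μ, estimate p S μ ∂P : ℝ) : ℂ) =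
      ∑ i : Fin p, (richCoeff p (i + 1) : ℂ) * (O * ρ i).trace := by
    rw [hest, integral_finsetSum _ fun ij _ => (hcomp ij).integrable one_le_two]
    have h2 : ∀ ij : Fin p × Fin S, ∫ μ : Fin p × Fin S → ℝ, X ij (μ ij) ∂P =
        (richCoeff p (ij.1 + 1) / S) * ∫ x, x ∂measurementLaw hO (ρ ij.1) := fun ij => by
      rw [hP, integral_comp_eval (μ := fun ij : Fin p × Fin S => measurementLaw hO (ρ ij.1))
        (hXL ij).1, hX]
      exact integral_const_mul _ _
    simp only [h2]
    rw [Fintype.sum_prod_type]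
    push_cast
    refine sum_congr rfl fun i _ => ?_
    simp only [integral_id_measurementLaw hO (h1 i) (h i), sum_const, card_univ, Fintype.card_fin,
      nsmul_eq_mul]
    have : (S : ℂ) ≠ 0 := by exact_mod_cast hS0
    field_simp
  have hvar : variance (estimate p S) P ≤
      opNorm O ^ 2 * (∑ i : Fin p, richCoeff p (i + 1) ^ 2) / S := by
    have h3 := variance_sum_pi hXL
    have h4 : (∑ ij, fun μ : Fin p × Fin S → ℝ => X ij (μ ij)) = estimate p S := by
      rw [hest]; funext μ; simp
    rw [h4] at h3
    rw [hP, h3, Fintype.sum_prod_type]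
    calc _ ≤ ∑ i : Fin p, ∑ _j : Fin S, (richCoeff p (i + 1) / S) ^ 2 * opNorm O ^ 2 := by
          refine sum_le_sum fun i _ => sum_le_sum fun j _ => ?_
          rw [hX]
          simp only
          rw [variance_const_mul]
          gcongr
          exact variance_measurementLaw_le hO (h1 i) (h i)
      _ = _ := by
          simp only [sum_const, card_univ, Fintype.card_fin, nsmul_eq_mul]
          rw [mul_sum, sum_div]
          refine sum_congr rfl fun i _ => ?_
          field_simp
  have key := two_thirds_le_real_abs_sub_le hm hL hc (by linarith)
  refine key.trans (measureReal_mono fun μ hμ => ?_)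
  simp only [Set.mem_ofPred_eq] at hμ ⊢
  rwa [← hmean, ← Complex.ofReal_sub, Complex.norm_real]

end Estimate

end

section

open Finset

/-! ### Repetition numbers and their gaps -/

section Sine

/-- The half-angles `θ_j` of the Chebyshev nodes. -/
def theta (p j : ℕ) : ℝ := Real.pi * (2 * (j : ℝ) - 1) / (8 * p)

/-- The repetition numbers before rounding. -/
def preRep (p j : ℕ) : ℝ := Real.sqrt 8 * p / (Real.pi * Real.sin (theta p j))

lemma repNum_eq (p j : ℕ) : repNum p j = ⌈preRep p j⌉₊ := rfl

variable {p j l : ℕ}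

lemma theta_pos (hj : 1 ≤ j) (hjp : j ≤ p) : 0 < theta p j := by
  have h1 : (1 : ℝ) ≤ j := by exact_mod_cast hj
  have h2 : (1 : ℝ) ≤ p := by exact_mod_cast hj.trans hjp
  have := Real.pi_pos
  unfold theta
  have : 0 < 2 * (j : ℝ) - 1 := by linarith
  positivity

lemma theta_le (hj : 1 ≤ j) (hjp : j ≤ p) : theta p j ≤ Real.pi / 4 * (j / p) := by
  have h2 : (1 : ℝ) ≤ p := by exact_mod_cast hj.trans hjp
  have := Real.pi_pos
  unfold theta
  rw [div_mul_div_comm, div_le_div_iff₀ (by positivity) (by positivity)]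
  nlinarith [mul_pos this (show (0 : ℝ) < p by linarith)]

lemma theta_le_pi_div_four (hj : 1 ≤ j) (hjp : j ≤ p) : theta p j ≤ Real.pi / 4 := by
  refine (theta_le hj hjp).trans (mul_le_of_le_one_right (by positivity) ?_)
  have h2 : (0 : ℝ) < p := by exact_mod_cast hj.trans hjp
  rw [div_le_one h2]
  exact_mod_cast hjp

lemma theta_sub (hp : 1 ≤ p) : theta p l - theta p j = Real.pi / (4 * p) * ((l : ℝ) - j) := by
  have h2 : (p : ℝ) ≠ 0 := by positivity
  unfold theta
  field_simp
  ring

lemma sin_theta_pos (hj : 1 ≤ j) (hjp : j ≤ p) : 0 < Real.sin (theta p j) :=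
  Real.sin_pos_of_pos_of_lt_pi (theta_pos hj hjp)
    ((theta_le_pi_div_four hj hjp).trans_lt (by linarith [Real.pi_pos]))

lemma sin_theta_sq_le (hj : 1 ≤ j) (hjp : j ≤ p) : Real.sin (theta p j) ^ 2 ≤ 1 / 2 := by
  have h : Real.sin (theta p j) ≤ √2 / 2 := by
    rw [← Real.sin_pi_div_four]
    exact Real.sin_le_sin_of_le_of_le_pi_div_two (by linarith [theta_pos hj hjp, Real.pi_pos])
      (by linarith [Real.pi_pos]) (theta_le_pi_div_four hj hjp)
  calc Real.sin (theta p j) ^ 2 ≤ (√2 / 2) ^ 2 := by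
        gcongr
        exact (sin_theta_pos hj hjp).le
    _ = 1 / 2 := by rw [div_pow, Real.sq_sqrt (by norm_num)]; norm_num

lemma sin_mul_sin_theta_le (hj : 1 ≤ j) (hjp : j ≤ p) (hl : 1 ≤ l) (hlp : l ≤ p) :
    Real.sin (theta p j) * Real.sin (theta p l) ≤ 1 / 2 := by
  nlinarith [sin_theta_sq_le hj hjp, sin_theta_sq_le hl hlp,
    sq_nonneg (Real.sin (theta p j) - Real.sin (theta p l))]

lemma sub_div_sqrt_two_le_sin_sub_sin {a b : ℝ} (ha : 0 ≤ a) (hab : a ≤ b) (hb : b ≤ Real.pi / 4) :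
    √2 / 2 * (b - a) ≤ Real.sin b - Real.sin a := by
  refine Convex.mul_sub_le_image_sub_of_le_deriv (convex_Icc (0 : ℝ) (Real.pi / 4))
    Real.continuous_sin.continuousOn Real.differentiable_sin.differentiableOn (fun x hx => ?_)
    a ⟨ha, hab.trans hb⟩ b ⟨ha.trans hab, hb⟩ hab
  rw [interior_Icc] at hx
  rw [Real.deriv_sin, ← Real.cos_pi_div_four]
  exact Real.cos_le_cos_of_nonneg_of_le_pi hx.1.le (by linarith [Real.pi_pos]) hx.2.le

lemma preRep_pos (hj : 1 ≤ j) (hjp : j ≤ p) : 0 < preRep p j := by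
  have h2 : (0 : ℝ) < p := by exact_mod_cast hj.trans hjp
  have := sin_theta_pos hj hjp
  have := Real.pi_pos
  unfold preRep
  positivity

/-- The gaps of the repetition numbers before rounding. -/
lemma le_preRep_sub (hj : 1 ≤ j) (hjl : j < l) (hlp : l ≤ p) :
    ((l : ℝ) - j) / (2 * (Real.sin (theta p j) * Real.sin (theta p l))) ≤
      preRep p j - preRep p l := by
  have hp : 1 ≤ p := hj.trans (hjl.le.trans hlp)
  have h2 : (0 : ℝ) < p := by exact_mod_cast hp
  have hs := sin_theta_pos hj (hjl.le.trans hlp)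
  have hs' := sin_theta_pos (hj.trans hjl.le) hlp
  have hpi := Real.pi_pos
  have hle : theta p j ≤ theta p l := by
    have := theta_sub (l := l) (j := j) hp
    have h3 : (0 : ℝ) ≤ (l : ℝ) - j := sub_nonneg.2 (by exact_mod_cast hjl.le)
    have h4 : 0 ≤ Real.pi / (4 * p) * ((l : ℝ) - j) := by positivity
    linarith
  have h := sub_div_sqrt_two_le_sin_sub_sin (theta_pos hj (hjl.le.trans hlp)).le hle
    (theta_le_pi_div_four (hj.trans hjl.le) hlp)
  rw [theta_sub hp] at h
  have e : preRep p j - preRep p l = Real.sqrt 8 * p / Real.pi *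
      (Real.sin (theta p l) - Real.sin (theta p j)) /
        (Real.sin (theta p j) * Real.sin (theta p l)) := by
    unfold preRep
    field_simp
  rw [e, mul_comm 2, ← div_div, div_right_comm]
  gcongr
  have h8 : Real.sqrt 8 = 2 * √2 := by
    rw [show (8 : ℝ) = 2 ^ 2 * 2 by norm_num, Real.sqrt_mul (by norm_num), Real.sqrt_sq (by norm_num)]
  calc ((l : ℝ) - j) / 2 = Real.sqrt 8 * p / Real.pi *
        (√2 / 2 * (Real.pi / (4 * p) * ((l : ℝ) - j))) := by
        rw [h8]
        field_simp
        rw [Real.sq_sqrt (by norm_num)]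
        ring
    _ ≤ _ := by gcongr

/-- Repetition numbers decrease by at least `1` per index, also after rounding, so that they are
distinct. -/
lemma repNum_add_le (hj : 1 ≤ j) (hjl : j < l) (hlp : l ≤ p) :
    repNum p l + (l - j) ≤ repNum p j := by
  have h := le_preRep_sub hj hjl hlp
  have hs := sin_theta_pos hj (hjl.le.trans hlp)
  have hs' := sin_theta_pos (hj.trans hjl.le) hlp
  have hu := sin_mul_sin_theta_le hj (hjl.le.trans hlp) (hj.trans hjl.le) hlp
  have h3 : (0 : ℝ) ≤ (l : ℝ) - j := sub_nonneg.2 (by exact_mod_cast hjl.le)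
  have h1 : (l : ℝ) - j ≤ preRep p j - preRep p l := by
    refine le_trans ?_ h
    rw [le_div_iff₀ (by positivity)]
    nlinarith
  rw [repNum_eq, repNum_eq, ← Nat.ceil_add_natCast (preRep_pos (hj.trans hjl.le) hlp).le]
  refine Nat.ceil_le_ceil ?_
  rw [Nat.cast_sub hjl.le]
  linarith

lemma repNum_pos (hj : 1 ≤ j) (hjp : j ≤ p) : 1 ≤ repNum p j :=
  Nat.ceil_pos.2 (preRep_pos hj hjp)

lemma repNum_le_of_le (hj : 1 ≤ j) (hjl : j ≤ l) (hlp : l ≤ p) : repNum p l ≤ repNum p j := by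
  rcases hjl.eq_or_lt with rfl | h
  · exact le_rfl
  · have := repNum_add_le hj h hlp
    omega

lemma repNum_injOn : Set.InjOn (repNum p) (Icc 1 p : Finset ℕ) := by
  intro a ha b hb h
  rw [coe_Icc, Set.mem_Icc] at ha hb
  rcases lt_trichotomy a b with hab | hab | hab
  · have := repNum_add_le ha.1 hab hb.2; omega
  · exact hab
  · have := repNum_add_le hb.1 hab ha.2; omega

end Sine

/-! ### The effect of rounding on the Richardson coefficients -/

section Rounding

/-- Rounding two numbers with a gap `g ≥ D / (2u)` up changes the gap by a factor of at most
`e^{4u/D}`. -/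
lemma div_le_exp_of_gap {g d D u : ℝ} (hD : 1 ≤ D) (hu : 0 < u) (hg : D / (2 * u) ≤ g)
    (hDg : D ≤ g) (hd : D ≤ d) (hdg : g - 1 ≤ d) : g / d ≤ Real.exp (4 * u / D) := by
  have hg' : 2 / g ≤ 4 * u / D := by
    rw [div_le_iff₀ (by positivity)] at hg
    rw [div_le_div_iff₀ (by linarith) (by linarith)]
    linarith
  have hd0 : 0 < d := by linarith
  refine le_trans ?_ (Real.exp_le_exp.2 hg')
  have h1 := Real.add_one_le_exp (2 / g)
  rcases le_or_gt 2 g with h | h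
  · refine le_trans ?_ h1
    rw [div_le_iff₀ hd0]
    have h2 : (2 / g + 1) * (g - 1) ≤ (2 / g + 1) * d := by gcongr
    refine le_trans ?_ h2
    have : 2 / g * g = 2 := by field_simp
    have h3 : 2 / g ≤ 1 := by rw [div_le_one (by linarith)]; exact h
    nlinarith
  · have h2 : 1 ≤ 2 / g := by rw [le_div_iff₀ (by linarith)]; linarith
    calc g / d ≤ g / 1 := by gcongr <;> linarith
      _ ≤ _ := by linarith

/-- The factors of the Richardson coefficients, compared with those before rounding. -/
lemma factor_le {a b A B D u : ℝ} (ha : 0 < a) (hb : 0 < b) (haA : a ≤ A) (hAa : A ≤ a + 1)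
    (hbB : b ≤ B) (hBb : B ≤ b + 1) (hD : 1 ≤ D) (hu : 0 < u) (hg : D / (2 * u) ≤ |a - b|)
    (hDg : D ≤ |a - b|) (hd : D ≤ |A - B|) :
    |1 / (1 - B ^ 2 / A ^ 2)| ≤
      a ^ 2 / |a ^ 2 - b ^ 2| * Real.exp (2 / a) * Real.exp (4 * u / D) := by
  have hA : 0 < A := by linarith
  have hB : 0 < B := by linarith
  have hdg : |a - b| - 1 ≤ |A - B| := by
    rcases abs_cases (a - b) with h | h <;> rcases abs_cases (A - B) with h' | h' <;> linarith
  have h1 := div_le_exp_of_gap hD hu hg hDg hd hdg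
  -- rounding enlarges the denominator `A + B` and the numerator by at most `(1 + 1/a)²`
  have hd0 : 0 < |A - B| := by linarith
  have hg0 : 0 < |a - b| := by linarith
  have e1 : |1 / (1 - B ^ 2 / A ^ 2)| = A ^ 2 / ((A + B) * |A - B|) := by
    have : 1 - B ^ 2 / A ^ 2 = (A + B) * (A - B) / A ^ 2 := by field_simp; ring
    rw [this, one_div_div, abs_div, abs_mul, abs_of_pos (show 0 < A + B by linarith),
      abs_of_pos (show 0 < A ^ 2 by positivity)]
  have e2 : a ^ 2 / |a ^ 2 - b ^ 2| = a ^ 2 / ((a + b) * |a - b|) := by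
    have : a ^ 2 - b ^ 2 = (a + b) * (a - b) := by ring
    rw [this, abs_mul, abs_of_pos (show 0 < a + b by linarith)]
  have h2 : (A / a) ^ 2 ≤ Real.exp (2 / a) := by
    have h3 : A / a ≤ Real.exp (1 / a) := by
      refine le_trans ?_ (Real.add_one_le_exp _)
      rw [div_le_iff₀ ha, add_mul, div_mul_cancel₀ _ ha.ne']
      linarith
    calc (A / a) ^ 2 ≤ Real.exp (1 / a) ^ 2 := by gcongr
      _ = _ := by rw [← Real.exp_nat_mul]; congr 1; push_cast; ring
  rw [e1, e2]
  calc A ^ 2 / ((A + B) * |A - B|) ≤ A ^ 2 / ((a + b) * |A - B|) := by gcongr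
    _ = a ^ 2 / ((a + b) * |a - b|) * (A / a) ^ 2 * (|a - b| / |A - B|) := by
        field_simp
    _ ≤ _ := by gcongr

end Rounding

/-! ### From sines to linear nodes -/

section SineCorrection

lemma sin_sub_mul_cos_le {x : ℝ} (hx : 0 ≤ x) : Real.sin x - x * Real.cos x ≤ x ^ 3 / 2 := by
  have h1 := Real.sin_le hx
  have h2 := Real.one_sub_sq_div_two_le_cos (x := x)
  nlinarith [mul_le_mul_of_nonneg_left h2 hx]

/-- The function `(sin x / x)²` decreases, but no faster than `-x² / 2`. -/
lemma monotoneOn_sin_sq_div : MonotoneOn (fun x : ℝ => Real.sin x ^ 2 / x ^ 2 + x ^ 2 / 2)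
    (Set.Ioc 0 (Real.pi / 4)) := by
  have hder : ∀ x : ℝ, 0 < x → HasDerivAt (fun x : ℝ => Real.sin x ^ 2 / x ^ 2 + x ^ 2 / 2)
      ((2 * Real.sin x * Real.cos x * x ^ 2 - Real.sin x ^ 2 * (2 * x)) / (x ^ 2) ^ 2 + x) x := by
    intro x hx
    have h1 := ((Real.hasDerivAt_sin x).pow 2).div ((hasDerivAt_id x).pow 2) (by simp; exact hx.ne')
    have h2 := ((hasDerivAt_id x).pow 2).div_const 2
    refine (h1.add h2).congr_deriv ?_
    simp
  refine monotoneOn_of_deriv_nonneg (convex_Ioc _ _) ?_ ?_ ?_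
  · exact fun x hx => (hder x hx.1).continuousAt.continuousWithinAt
  · intro x hx
    exact (hder x (interior_subset hx).1).differentiableAt.differentiableWithinAt
  · intro x hx
    have hx' := interior_subset hx
    have hx0 : 0 < x := hx'.1
    rw [(hder x hx0).deriv]
    have hs0 : 0 ≤ Real.sin x := Real.sin_nonneg_of_nonneg_of_le_pi hx0.le
      (hx'.2.trans (by linarith [Real.pi_pos]))
    have h1 := Real.sin_le hx0.le
    have h2 := sin_sub_mul_cos_le hx0.le
    have h3 : Real.sin x * (Real.sin x - x * Real.cos x) ≤ x * (x ^ 3 / 2) := by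
      calc _ ≤ Real.sin x * (x ^ 3 / 2) := by gcongr
        _ ≤ _ := by gcongr
    have h4 : (2 * Real.sin x * Real.cos x * x ^ 2 - Real.sin x ^ 2 * (2 * x)) / (x ^ 2) ^ 2 + x =
        2 / x ^ 3 * (x * (x ^ 3 / 2) - Real.sin x * (Real.sin x - x * Real.cos x)) := by
      field_simp
      ring
    rw [h4]
    have : 0 ≤ x * (x ^ 3 / 2) - Real.sin x * (Real.sin x - x * Real.cos x) := by linarith
    positivity

/-- Replacing the sines by their arguments. -/
lemma sin_sq_div_le {x y : ℝ} (hx : 0 < x) (hx4 : x ≤ Real.pi / 4) (hy : 0 < y)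
    (hy4 : y ≤ Real.pi / 4) (hxy : x ≠ y) :
    Real.sin x ^ 2 / |Real.sin x ^ 2 - Real.sin y ^ 2| ≤
      x ^ 2 / |x ^ 2 - y ^ 2| * Real.exp (5 / 4 * y ^ 2) := by
  have hpi : Real.pi / 4 ≤ 0.7855 := by linarith [Real.pi_lt_d4]
  set k := Real.sin x ^ 2 / x ^ 2 with hk
  set k' := Real.sin y ^ 2 / y ^ 2 with hk'
  have hsx : Real.sin x ^ 2 = k * x ^ 2 := by rw [hk]; field_simp
  have hsy : Real.sin y ^ 2 = k' * y ^ 2 := by rw [hk']; field_simp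
  have hx2 : x ^ 2 ≤ 0.6171 := by nlinarith
  have hy2 : y ^ 2 ≤ 0.6171 := by nlinarith
  -- `k` decreases to `8/π² ≈ 0.81` at `π/4`; this cruder bound suffices for the constant `5/4` in
  -- the exponent
  have hk69 : 0.69 ≤ k := by
    have h1 := (Real.sin_gt_sub_cube hx).le
    rw [hk, le_div_iff₀ (by positivity)]
    have h2 : 0 ≤ x - x ^ 3 / 6 := by nlinarith
    have h3 : (x - x ^ 3 / 6) ^ 2 ≤ Real.sin x ^ 2 := by gcongr
    nlinarith [sq_nonneg (x ^ 3)]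
  have hd : 0 < |x ^ 2 - y ^ 2| := by
    rw [abs_pos, sub_ne_zero]
    exact fun h => hxy ((sq_eq_sq₀ hx.le hy.le).1 h)
  have hexp : k * Real.exp (-(5 / 4 * y ^ 2)) ≤ k - y ^ 2 / 2 := by
    have h1 : Real.exp (-(5 / 4 * y ^ 2)) ≤ 1 - 5 / 4 * y ^ 2 + (5 / 4 * y ^ 2) ^ 2 / 2 := by
      set z := 5 / 4 * y ^ 2 with hz
      have hz0 : 0 ≤ z := by positivity
      have hq := Real.quadratic_le_exp_of_nonneg hz0
      rw [Real.exp_neg, inv_le_iff_one_le_mul₀ (Real.exp_pos z)]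
      have h6 : 0 ≤ 1 - z + z ^ 2 / 2 := by nlinarith [sq_nonneg (z - 1)]
      calc 1 ≤ (1 - z + z ^ 2 / 2) * (1 + z + z ^ 2 / 2) := by nlinarith [sq_nonneg (z ^ 2)]
        _ ≤ _ := by gcongr
    have h2 : k * Real.exp (-(5 / 4 * y ^ 2)) ≤
        k * (1 - 5 / 4 * y ^ 2 + (5 / 4 * y ^ 2) ^ 2 / 2) := by gcongr
    have hy0 : 0 ≤ y ^ 2 := sq_nonneg y
    nlinarith [mul_nonneg (sub_nonneg.2 hk69) hy0, mul_nonneg hy0 (sub_nonneg.2 hy2),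
      mul_nonneg (mul_nonneg (sub_nonneg.2 hk69) hy0) (sub_nonneg.2 hy2)]
  -- write `sin² x - sin² y = k x² - k' y²` and bound `k - k'` by monotonicity
  have hmain : |x ^ 2 - y ^ 2| * (k - y ^ 2 / 2) ≤ |Real.sin x ^ 2 - Real.sin y ^ 2| := by
    rw [hsx, hsy]
    rcases lt_or_gt_of_ne hxy with h | h
    · have hm := monotoneOn_sin_sq_div ⟨hx, hx4⟩ ⟨hy, hy4⟩ h.le
      simp only [← hk, ← hk'] at hm
      have h2 : x ^ 2 < y ^ 2 := by gcongr
      rw [abs_of_neg (by linarith)]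
      refine le_trans ?_ (neg_le_abs _)
      nlinarith [mul_le_mul_of_nonneg_left hm (sq_nonneg y)]
    · have hm := monotoneOn_sin_sq_div ⟨hy, hy4⟩ ⟨hx, hx4⟩ h.le
      simp only [← hk, ← hk'] at hm
      have h2 : y ^ 2 < x ^ 2 := by gcongr
      rw [abs_of_pos (by linarith)]
      refine le_trans ?_ (le_abs_self _)
      nlinarith [mul_le_mul_of_nonneg_left hm (sq_nonneg y)]
  have hkpos : 0 < k := by linarith
  have h5 : |x ^ 2 - y ^ 2| * (k * Real.exp (-(5 / 4 * y ^ 2))) ≤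
      |Real.sin x ^ 2 - Real.sin y ^ 2| := le_trans (by gcongr) hmain
  calc Real.sin x ^ 2 / |Real.sin x ^ 2 - Real.sin y ^ 2|
      ≤ Real.sin x ^ 2 / (|x ^ 2 - y ^ 2| * (k * Real.exp (-(5 / 4 * y ^ 2)))) := by gcongr
    _ = _ := by
        rw [hsx, Real.exp_neg]
        field_simp

end SineCorrection

/-! ### Richardson coefficients of linear nodes -/

section LinearNodes

lemma prod_odd_mul (n : ℕ) : (∏ i ∈ range n, (2 * (i : ℝ) + 1)) * 2 ^ n * n.factorial =
    (2 * n).factorial := by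
  induction n with
  | zero => simp
  | succ n ih =>
    rw [prod_range_succ, show 2 * (n + 1) = 2 * n + 1 + 1 by ring, Nat.factorial_succ,
      Nat.factorial_succ, Nat.factorial_succ]
    push_cast
    rw [← ih]
    ring

lemma prod_gap (n : ℕ) : ∏ i ∈ range n, (4 * ((n : ℝ) - i) * (n + i + 1)) =
    4 ^ n * (2 * n).factorial := by
  have h1 : ∏ i ∈ range n, ((n : ℝ) - i) = n.factorial := by
    rw [← Nat.descFactorial_self, Nat.descFactorial_eq_prod_range, Nat.cast_prod]
    exact prod_congr rfl fun i hi => by rw [Nat.cast_sub (mem_range.1 hi).le]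
  have h2 : (n.factorial : ℝ) * ∏ i ∈ range n, ((n : ℝ) + i + 1) = (2 * n).factorial := by
    rw [two_mul, ← Nat.factorial_mul_ascFactorial, Nat.ascFactorial_eq_prod_range]
    push_cast
    congr 1
    exact prod_congr rfl fun i _ => by ring
  rw [prod_mul_distrib, prod_mul_distrib, prod_const, card_range, h1, mul_assoc, h2]

/-- The part of the product over linear nodes with index below the given one. -/
lemma prod_below (n : ℕ) : ∏ i ∈ range n, (2 * (i : ℝ) + 1) ^ 2 /
    |(2 * (i : ℝ) + 1) ^ 2 - (2 * n + 1) ^ 2| = (n.centralBinom : ℝ) / 16 ^ n := by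
  have h : ∀ i ∈ range n, (2 * (i : ℝ) + 1) ^ 2 / |(2 * (i : ℝ) + 1) ^ 2 - (2 * n + 1) ^ 2| =
      (2 * (i : ℝ) + 1) ^ 2 / (4 * ((n : ℝ) - i) * (n + i + 1)) := by
    intro i hi
    have hi' : (i : ℝ) < n := by exact_mod_cast mem_range.1 hi
    have h0 : (0 : ℝ) ≤ i := Nat.cast_nonneg i
    rw [abs_of_neg (by nlinarith)]
    congr 1
    ring
  have hN := prod_odd_mul n
  have hc : (n.centralBinom : ℝ) * n.factorial * n.factorial = (2 * n).factorial := by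
    have := Nat.choose_mul_factorial_mul_factorial (show n ≤ 2 * n by omega)
    rw [show 2 * n - n = n by omega] at this
    rw [Nat.centralBinom_eq_two_mul_choose]
    exact_mod_cast this
  rw [prod_congr rfl h, prod_div_distrib, prod_gap, prod_pow, div_eq_div_iff (by positivity)
    (by positivity)]
  have hf : (n.factorial : ℝ) ≠ 0 := by positivity
  have h2 : (2 : ℝ) ^ n ≠ 0 := by positivity
  have hP : ∏ i ∈ range n, (2 * (i : ℝ) + 1) = n.centralBinom * n.factorial / 2 ^ n := by
    rw [eq_div_iff h2]
    apply mul_right_cancel₀ hf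
    rw [hN, hc]
  rw [hP, ← hc, show (16 : ℝ) = 2 ^ 2 * 4 by norm_num, mul_pow, ← pow_mul, mul_comm 2 n, pow_mul]
  field_simp

lemma choose_step {p j : ℕ} (hjp : j ≤ p) :
    ((2 * (p + 1)).choose (p + 1 - j) : ℝ) * ((p + 1 - j) * (p + 1 + j)) =
      (2 * p + 2) * (2 * p + 1) * (2 * p).choose (p - j) := by
  have h1 := Nat.choose_mul_succ_eq (2 * p) (p - j)
  have h2 := Nat.add_one_mul_choose_eq (2 * p + 1) (p - j)
  rw [show 2 * p + 1 - (p - j) = p + 1 + j by omega] at h1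
  rw [show p - j + 1 = p + 1 - j by omega] at h2
  have h1' : ((2 * p).choose (p - j) : ℝ) * (2 * p + 1) =
      (2 * p + 1).choose (p - j) * (p + 1 + j) := by exact_mod_cast h1
  have h2' : ((2 * p + 1 : ℕ) + 1 : ℝ) * (2 * p + 1).choose (p - j) =
      (2 * p + 1 + 1).choose (p + 1 - j) * ((p + 1 - j : ℕ) : ℝ) := by exact_mod_cast h2
  rw [Nat.cast_sub (by omega)] at h2'
  push_cast at h2'
  rw [show 2 * (p + 1) = 2 * p + 1 + 1 by ring]
  linear_combination (-(p + 1 + j) : ℝ) * h2' + (-(2 * p + 2) : ℝ) * h1'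

/-- The Richardson coefficients of the linear nodes `2l - 1`, in closed form. -/
lemma prod_linear_nodes {j p : ℕ} (hj : 1 ≤ j) (hjp : j ≤ p) :
    ∏ l ∈ (Icc 1 p).erase j, (2 * (l : ℝ) - 1) ^ 2 / |(2 * (l : ℝ) - 1) ^ 2 - (2 * j - 1) ^ 2| =
      4 * ((p : ℝ) + j) * (p.centralBinom : ℝ) * ((2 * p).choose (p - j) : ℝ) /
        (16 ^ p * (2 * (j : ℝ) - 1)) := by
  have hj1 : (1 : ℝ) ≤ j := by exact_mod_cast hj
  have hj0 : (2 * (j : ℝ) - 1) ≠ 0 := by linarith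
  induction p, hjp using Nat.le_induction with
  | base =>
    obtain ⟨n, rfl⟩ := Nat.exists_eq_add_of_le' hj
    have he : (Icc 1 (n + 1)).erase (n + 1) = Ico 1 (n + 1) := by
      ext x; simp only [mem_erase, mem_Icc, mem_Ico]; omega
    rw [he, prod_Ico_eq_prod_range, Nat.add_sub_cancel]
    have h := prod_below n
    have h2 : ∀ i ∈ range n, (2 * ((1 + i : ℕ) : ℝ) - 1) ^ 2 /
        |(2 * ((1 + i : ℕ) : ℝ) - 1) ^ 2 - (2 * ((n + 1 : ℕ) : ℝ) - 1) ^ 2| =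
        (2 * (i : ℝ) + 1) ^ 2 / |(2 * (i : ℝ) + 1) ^ 2 - (2 * n + 1) ^ 2| := by
      intro i _
      push_cast
      congr 3 <;> ring
    rw [prod_congr rfl h2, h, Nat.sub_self, Nat.choose_zero_right]
    have h3 : ((n : ℝ) + 1) * (n + 1).centralBinom = 2 * (2 * n + 1) * n.centralBinom := by
      exact_mod_cast Nat.succ_mul_centralBinom_succ n
    rw [div_eq_div_iff (by positivity) (by positivity), pow_succ]
    push_cast
    linear_combination (-8 * (16 : ℝ) ^ n) * h3
  | succ p hjp ih =>
    have he : (Icc 1 (p + 1)).erase j = insert (p + 1) ((Icc 1 p).erase j) := by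
      ext x; simp only [mem_erase, mem_Icc, mem_insert]; omega
    have hpj : (j : ℝ) ≤ p := by exact_mod_cast hjp
    rw [he, prod_insert (by simp), ih]
    have h3 : ((p : ℝ) + 1) * (p + 1).centralBinom = 2 * (2 * p + 1) * p.centralBinom := by
      exact_mod_cast Nat.succ_mul_centralBinom_succ p
    have h4 := choose_step hjp
    have h5 : |(2 * ((p + 1 : ℕ) : ℝ) - 1) ^ 2 - (2 * (j : ℝ) - 1) ^ 2| =
        4 * (((p : ℝ) + 1 - j) * (p + j)) := by
      push_cast
      rw [abs_of_nonneg (by nlinarith)]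
      ring
    rw [h5]
    have h6 : (0 : ℝ) < p + 1 - j := by linarith
    have h7 : (0 : ℝ) < p + j := by linarith
    have h8 : (0 : ℝ) < p + 1 + j := by linarith
    have h9 : (0 : ℝ) < p + 1 := by linarith
    have e3 : ((p + 1).centralBinom : ℝ) = 2 * (2 * p + 1) * p.centralBinom / (p + 1) := by
      field_simp; linarith
    have e4 : ((2 * (p + 1)).choose (p + 1 - j) : ℝ) =
        (2 * p + 2) * (2 * p + 1) * (2 * p).choose (p - j) / ((p + 1 - j) * (p + 1 + j)) := by
      rw [eq_div_iff (by positivity)]; exact h4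
    rw [e3, e4, pow_succ]
    push_cast
    field_simp
    ring

/-- A bound on the central binomial coefficient of the order of Stirling's formula. -/
lemma two_mul_add_one_mul_centralBinom_sq_le (p : ℕ) :
    (2 * (p : ℝ) + 1) * (p.centralBinom : ℝ) ^ 2 ≤ 16 ^ p := by
  induction p with
  | zero => simp
  | succ p ih =>
    have h3 : ((p : ℝ) + 1) * (p + 1).centralBinom = 2 * (2 * p + 1) * p.centralBinom := by
      exact_mod_cast Nat.succ_mul_centralBinom_succ p
    have h9 : (0 : ℝ) < p + 1 := by positivity
    have e3 : ((p + 1).centralBinom : ℝ) = 2 * (2 * p + 1) * p.centralBinom / (p + 1) := by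
      field_simp; linarith
    rw [e3, pow_succ (16 : ℝ)]
    push_cast
    rw [div_pow, mul_div_assoc', div_le_iff₀ (by positivity)]
    have h0 : (0 : ℝ) ≤ p := Nat.cast_nonneg p
    calc (2 * ((p : ℝ) + 1) + 1) * (2 * (2 * (p : ℝ) + 1) * (p.centralBinom : ℝ)) ^ 2
        = (4 * (2 * p + 1) * (2 * p + 3)) * ((2 * (p : ℝ) + 1) * (p.centralBinom : ℝ) ^ 2) := by ring
      _ ≤ (16 * ((p : ℝ) + 1) ^ 2) * (16 : ℝ) ^ p := by
          refine mul_le_mul ?_ ih (by positivity) (by positivity)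
          nlinarith
      _ = _ := by ring

lemma one_sub_div_one_add_le {x : ℝ} (hx0 : 0 ≤ x) (hx : x < 1) :
    (1 - x) / (1 + x) ≤ Real.exp (-2 * x) := by
  have h := Real.hasSum_log_sub_log_of_abs_lt_one (abs_lt.2 ⟨by linarith, hx⟩)
  have h1 := le_hasSum h 0 fun k _ => by positivity
  rw [← Real.log_le_iff_le_exp (div_pos (by linarith) (by linarith)),
    Real.log_div (by linarith) (by linarith)]
  norm_num at h1
  linarith

/-- Gaussian bound on binomial coefficients: each step away from the center multiplies by `(p - j) /
(p + j + 1)`, which is `(1 - x) / (1 + x) ≤ e^{-2x}` for `x = (2j + 1) / (2p + 1)`. -/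
lemma choose_le_exp {p j : ℕ} (hjp : j ≤ p) : ((2 * p).choose (p - j) : ℝ) ≤
    p.centralBinom * Real.exp (-2 * (j : ℝ) ^ 2 / (2 * p + 1)) := by
  induction j with
  | zero => simp [Nat.centralBinom_eq_two_mul_choose]
  | succ j ih =>
    have ih := ih (by omega)
    have h1 := Nat.choose_succ_right_eq (2 * p) (p - (j + 1))
    rw [show p - (j + 1) + 1 = p - j by omega, show 2 * p - (p - (j + 1)) = p + j + 1 by omega] at h1
    have h1' : ((2 * p).choose (p - j) : ℝ) * ((p - j : ℕ) : ℝ) =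
        (2 * p).choose (p - (j + 1)) * (p + j + 1) := by exact_mod_cast h1
    rw [Nat.cast_sub (by omega)] at h1'
    have hp : (j : ℝ) + 1 ≤ p := by exact_mod_cast hjp
    have hj0 : (0 : ℝ) ≤ j := Nat.cast_nonneg j
    have h2 := one_sub_div_one_add_le (x := (2 * (j : ℝ) + 1) / (2 * p + 1)) (by positivity)
      (by rw [div_lt_one (by positivity)]; linarith)
    have h3 : (1 - (2 * (j : ℝ) + 1) / (2 * p + 1)) / (1 + (2 * (j : ℝ) + 1) / (2 * p + 1)) =
        (p - j) / (p + j + 1) := by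
      field_simp
      ring
    rw [h3] at h2
    have h4 : ((2 * p).choose (p - (j + 1)) : ℝ) =
        (2 * p).choose (p - j) * (((p : ℝ) - j) / (p + j + 1)) := by
      field_simp
      linarith
    rw [h4]
    calc _ ≤ (p.centralBinom * Real.exp (-2 * (j : ℝ) ^ 2 / (2 * p + 1))) *
          Real.exp (-2 * ((2 * (j : ℝ) + 1) / (2 * p + 1))) := by
          gcongr
          exact div_nonneg (by linarith) (by positivity)
      _ = _ := by
          rw [mul_assoc, ← Real.exp_add]
          congr 2
          push_cast
          field_simp
          ring

/-- The Richardson coefficients of the linear nodes decay like `e^{-j²/p} / (2j - 1)`. -/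
lemma prod_linear_nodes_le {j p : ℕ} (hj : 1 ≤ j) (hjp : j ≤ p) :
    ∏ l ∈ (Icc 1 p).erase j, (2 * (l : ℝ) - 1) ^ 2 / |(2 * (l : ℝ) - 1) ^ 2 - (2 * j - 1) ^ 2| ≤
      4 / (2 * j - 1) * Real.exp (1 / 2 - (j : ℝ) ^ 2 / p) := by
  have hj1 : (1 : ℝ) ≤ j := by exact_mod_cast hj
  have hjp' : (j : ℝ) ≤ p := by exact_mod_cast hjp
  have hj0 : 0 < (2 * (j : ℝ) - 1) := by linarith
  have hp0 : (0 : ℝ) < p := by linarith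
  rw [prod_linear_nodes hj hjp]
  have h1 := choose_le_exp hjp
  have h2 := two_mul_add_one_mul_centralBinom_sq_le p
  have h3 : Real.exp (-2 * (j : ℝ) ^ 2 / (2 * p + 1)) ≤ Real.exp (1 / 2 - (j : ℝ) ^ 2 / p) := by
    rw [Real.exp_le_exp, div_le_iff₀ (by positivity)]
    have h5 : (j : ℝ) ^ 2 / p * p = (j : ℝ) ^ 2 := by field_simp
    have h6 : (j : ℝ) ^ 2 / p ≤ p := by rw [div_le_iff₀ hp0]; nlinarith
    nlinarith
  calc 4 * ((p : ℝ) + j) * p.centralBinom * (2 * p).choose (p - j) / (16 ^ p * (2 * j - 1))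
      ≤ 4 * (2 * p + 1) * p.centralBinom * (p.centralBinom * Real.exp (1 / 2 - (j : ℝ) ^ 2 / p)) /
        (16 ^ p * (2 * j - 1)) := by
        have h4 := h1.trans (mul_le_mul_of_nonneg_left h3 (Nat.cast_nonneg _))
        have h5 : (p : ℝ) + j ≤ 2 * p + 1 := by linarith
        generalize (p : ℝ) + j = x at h5 ⊢
        gcongr
    _ = 4 / (2 * j - 1) * Real.exp (1 / 2 - (j : ℝ) ^ 2 / p) *
        (((2 * p + 1) * (p.centralBinom : ℝ) ^ 2) / 16 ^ p) := by field_simp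
    _ ≤ 4 / (2 * j - 1) * Real.exp (1 / 2 - (j : ℝ) ^ 2 / p) * 1 := by
        gcongr
        rwa [div_le_one (by positivity)]
    _ = _ := mul_one _

end LinearNodes

/-! ### Bounds for the Richardson coefficients -/

section RichardsonCoefficients

variable {p j l : ℕ}

/-- Only the `24` nearest indices have inverse distance above `1 / 13`. The small factor in front of
`p` matters in `abs_richCoeff_le`, where the true order `log p` of the sum is not needed. -/
lemma sum_inv_dist_le (p j : ℕ) :
    ∑ l ∈ (Icc 1 p).erase j, 1 / |(l : ℝ) - j| ≤ p / 13 + 25 := by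
  have h : ∀ l ∈ (Icc 1 p).erase j,
      1 / |(l : ℝ) - j| ≤ 1 / 13 + if l ∈ Icc (j - 12) (j + 12) then 1 else 0 := by
    intro l hl
    have hlj := (mem_erase.1 hl).1
    split_ifs with hN
    · have h1 : (1 : ℝ) ≤ |(l : ℝ) - j| := by
        have : (1 : ℤ) ≤ |(l : ℤ) - j| := Int.one_le_abs (by omega)
        exact_mod_cast this
      have := (div_le_one (by linarith)).2 h1
      linarith
    · rw [add_zero]
      apply one_div_le_one_div_of_le (by norm_num)
      rw [mem_Icc, not_and_or] at hN
      have : (13 : ℤ) ≤ |(l : ℤ) - j| := by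
        rw [le_abs]; omega
      exact_mod_cast this
  refine (sum_le_sum h).trans ?_
  rw [sum_add_distrib, sum_const, nsmul_eq_mul, ← sum_filter, sum_const, nsmul_eq_mul, mul_one]
  have h1 : (((Icc 1 p).erase j).card : ℝ) ≤ p := by
    exact_mod_cast (card_le_card (erase_subset _ _)).trans (by simp)
  have h2 : ((((Icc 1 p).erase j).filter (· ∈ Icc (j - 12) (j + 12))).card : ℝ) ≤ 25 := by
    have : (((Icc 1 p).erase j).filter (· ∈ Icc (j - 12) (j + 12))).card ≤ 25 :=
      (card_le_card (t := Icc (j - 12) (j + 12)) fun x hx => (mem_filter.1 hx).2).trans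
        (by rw [Nat.card_Icc]; omega)
    exact_mod_cast this
  linarith

/-- The factors of the Richardson coefficients, compared with those of the linear nodes. The terms
of the exponent account for the sine, for rounding `r_j`, and for rounding the gap between `r_j` and
`r_l`. -/
lemma abs_factor_le (hj : 1 ≤ j) (hjp : j ≤ p) (hl : 1 ≤ l) (hlp : l ≤ p) (hlj : l ≠ j) :
    |1 / (1 - (repNum p l : ℝ) ^ 2 / (repNum p j : ℝ) ^ 2)| ≤
      (2 * (l : ℝ) - 1) ^ 2 / |(2 * (l : ℝ) - 1) ^ 2 - (2 * j - 1) ^ 2| *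
      Real.exp (5 / 4 * theta p j ^ 2 + 2 / preRep p j +
        4 * (Real.sin (theta p j) * Real.sin (theta p l)) / |(l : ℝ) - j|) := by
  have hp : (0 : ℝ) < p := by exact_mod_cast hj.trans hjp
  have hsj := sin_theta_pos hj hjp
  have hsl := sin_theta_pos hl hlp
  have hu := sin_mul_sin_theta_le hj hjp hl hlp
  have hu0 : 0 < Real.sin (theta p j) * Real.sin (theta p l) := by positivity
  have hD1 : (1 : ℝ) ≤ |(l : ℝ) - j| := by
    have : (1 : ℤ) ≤ |(l : ℤ) - j| := Int.one_le_abs (by omega)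
    exact_mod_cast this
  have hg : |(l : ℝ) - j| / (2 * (Real.sin (theta p j) * Real.sin (theta p l))) ≤
      |preRep p j - preRep p l| := by
    rcases lt_or_gt_of_ne hlj with h | h
    · have h1 := le_preRep_sub hl h hjp
      rw [abs_sub_comm, abs_of_pos (by rw [sub_pos]; exact_mod_cast h), abs_sub_comm,
        mul_comm (Real.sin (theta p j))]
      exact h1.trans (le_abs_self _)
    · rw [abs_of_pos (by rw [sub_pos]; exact_mod_cast h)]
      exact (le_preRep_sub hj h hlp).trans (le_abs_self _)
  have hDg : |(l : ℝ) - j| ≤ |preRep p j - preRep p l| := by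
    refine le_trans ?_ hg
    rw [le_div_iff₀ (by positivity)]
    nlinarith
  have hd : |(l : ℝ) - j| ≤ |(repNum p j : ℝ) - repNum p l| := by
    have : |(l : ℤ) - j| ≤ |(repNum p j : ℤ) - repNum p l| := by
      rcases lt_or_gt_of_ne hlj with h | h
      · have := repNum_add_le hl h hjp
        rw [abs_le']; constructor <;> rw [le_abs] <;> omega
      · have := repNum_add_le hj h hlp
        rw [abs_le']; constructor <;> rw [le_abs] <;> omega
    exact_mod_cast this
  have ha := preRep_pos hj hjp
  have hb := preRep_pos hl hlp
  have hf := factor_le ha hb (Nat.le_ceil _) (Nat.ceil_lt_add_one ha.le).le (Nat.le_ceil _)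
    (Nat.ceil_lt_add_one hb.le).le hD1 hu0 hg hDg hd
  have hratio : preRep p j ^ 2 / |preRep p j ^ 2 - preRep p l ^ 2| =
      Real.sin (theta p l) ^ 2 / |Real.sin (theta p l) ^ 2 - Real.sin (theta p j) ^ 2| := by
    have hκ : 0 < √8 * p / Real.pi := by have := Real.pi_pos; positivity
    have e : ∀ i, preRep p i = √8 * p / Real.pi / Real.sin (theta p i) := fun i => by
      unfold preRep; rw [div_div]
    rw [e, e]
    generalize √8 * p / Real.pi = κ at hκ
    generalize Real.sin (theta p j) = x at hsj
    generalize Real.sin (theta p l) = y at hsl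
    have : (κ / x) ^ 2 - (κ / y) ^ 2 = (y ^ 2 - x ^ 2) * (κ ^ 2 / (x ^ 2 * y ^ 2)) := by
      field_simp
    rw [this, abs_mul, abs_of_pos (by positivity : 0 < κ ^ 2 / (x ^ 2 * y ^ 2)), div_pow]
    by_cases hxy : |y ^ 2 - x ^ 2| = 0
    · simp [hxy]
    · field_simp
  have hθ : theta p l ≠ theta p j := by
    intro h
    have h1 := theta_sub (l := l) (j := j) (hj.trans hjp)
    rw [h, sub_self, eq_comm, mul_eq_zero] at h1
    rcases h1 with h1 | h1
    · have := Real.pi_pos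
      exact absurd h1 (by positivity)
    · rw [sub_eq_zero] at h1
      exact hlj (by exact_mod_cast h1)
  have hs := sin_sq_div_le (theta_pos hl hlp) (theta_le_pi_div_four hl hlp) (theta_pos hj hjp)
    (theta_le_pi_div_four hj hjp) hθ
  have hlin : theta p l ^ 2 / |theta p l ^ 2 - theta p j ^ 2| =
      (2 * (l : ℝ) - 1) ^ 2 / |(2 * (l : ℝ) - 1) ^ 2 - (2 * j - 1) ^ 2| := by
    have hc : 0 < Real.pi / (8 * p) := by have := Real.pi_pos; positivity
    have e : ∀ i : ℕ, theta p i = Real.pi / (8 * p) * (2 * i - 1) := fun i => by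
      unfold theta; ring
    rw [e, e, mul_pow, mul_pow, ← mul_sub, abs_mul, abs_of_pos (by positivity),
      mul_div_mul_left _ _ (by positivity)]
  rw [hratio] at hf
  rw [hlin] at hs
  refine hf.trans ?_
  rw [Real.exp_add, Real.exp_add]
  simp only [← mul_assoc]
  exact mul_le_mul_of_nonneg_right (mul_le_mul_of_nonneg_right hs (Real.exp_pos _).le)
    (Real.exp_pos _).le

/-- Over all factors, the corrections of `abs_factor_le` multiply to at most `exp (j²/p + const)`,
where the bound `j²/p` is met by the Gaussian factor of the linear nodes. -/
lemma abs_richCoeff_le (hj : 1 ≤ j) (hjp : j ≤ p) :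
    |richCoeff p j| ≤ 4 * Real.exp 60 / (2 * j - 1) := by
  have hj1 : (1 : ℝ) ≤ j := by exact_mod_cast hj
  have hjp' : (j : ℝ) ≤ p := by exact_mod_cast hjp
  have hp : (0 : ℝ) < p := by linarith
  have hsj := sin_theta_pos hj hjp
  have hθ := theta_pos hj hjp
  have hss := sin_theta_sq_le hj hjp
  have hs1 := Real.sin_le_one (theta p j)
  have hpi := Real.pi_lt_d2
  have hpi0 := Real.pi_pos
  unfold richCoeff
  rw [abs_prod]
  have h1 : ∀ l ∈ (Icc 1 p).erase j,
      |1 / (1 - (repNum p l : ℝ) ^ 2 / (repNum p j : ℝ) ^ 2)| ≤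
      (2 * (l : ℝ) - 1) ^ 2 / |(2 * (l : ℝ) - 1) ^ 2 - (2 * j - 1) ^ 2| *
      Real.exp (5 / 4 * theta p j ^ 2 + 2 / preRep p j +
        4 * (Real.sin (theta p j) * Real.sin (theta p l)) / |(l : ℝ) - j|) := by
    intro l hl
    rw [mem_erase, mem_Icc] at hl
    exact abs_factor_le hj hjp hl.2.1 hl.2.2 hl.1
  refine (prod_le_prod (fun _ _ => abs_nonneg _) h1).trans ?_
  rw [prod_mul_distrib, ← Real.exp_sum]
  have hsum : ∑ l ∈ (Icc 1 p).erase j, (5 / 4 * theta p j ^ 2 + 2 / preRep p j +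
      4 * (Real.sin (theta p j) * Real.sin (theta p l)) / |(l : ℝ) - j|) ≤
      (j : ℝ) ^ 2 / p + 119 / 2 := by
    have h2 : ∀ l ∈ (Icc 1 p).erase j, (5 / 4 * theta p j ^ 2 + 2 / preRep p j +
        4 * (Real.sin (theta p j) * Real.sin (theta p l)) / |(l : ℝ) - j|) ≤
        (5 / 4 * theta p j ^ 2 + 2 / preRep p j + Real.pi / p) +
          4 * Real.sin (theta p j) ^ 2 * (1 / |(l : ℝ) - j|) := by
      intro l hl
      have hlj : |(l : ℝ) - j| ≠ 0 := by
        rw [abs_ne_zero, sub_ne_zero]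
        exact_mod_cast (mem_erase.1 hl).1
      -- the excess of `sin θ_l` over `sin θ_j` is proportional to `|l - j|` and cancels the
      -- denominator
      have h3 : Real.sin (theta p l) ≤
          Real.sin (theta p j) + Real.pi / (4 * p) * |(l : ℝ) - j| := by
        have h4 := Real.abs_sin_sub_sin_le (theta p l) (theta p j)
        rw [theta_sub (hj.trans hjp), abs_mul,
            abs_of_pos (by positivity : 0 < Real.pi / (4 * p))] at h4
        linarith [le_abs_self (Real.sin (theta p l) - Real.sin (theta p j))]
      have h5 : 4 * (Real.sin (theta p j) * Real.sin (theta p l)) / |(l : ℝ) - j| ≤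
          4 * (Real.sin (theta p j) *
            (Real.sin (theta p j) + Real.pi / (4 * p) * |(l : ℝ) - j|)) / |(l : ℝ) - j| := by
        gcongr
      have h6 : 4 * (Real.sin (theta p j) *
            (Real.sin (theta p j) + Real.pi / (4 * p) * |(l : ℝ) - j|)) / |(l : ℝ) - j| =
          Real.pi / p * Real.sin (theta p j) +
            4 * Real.sin (theta p j) ^ 2 * (1 / |(l : ℝ) - j|) := by
        field_simp
        ring
      have h7 : Real.pi / p * Real.sin (theta p j) ≤ Real.pi / p :=
        mul_le_of_le_one_right (by positivity) hs1
      linarith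
    refine (sum_le_sum h2).trans ?_
    rw [sum_add_distrib, sum_const, nsmul_eq_mul, ← mul_sum]
    have h1 : (((Icc 1 p).erase j).card : ℝ) ≤ p := by
      exact_mod_cast (card_le_card (erase_subset _ _)).trans (by simp)
    have ha := preRep_pos hj hjp
    have h3 : 2 / preRep p j * p ≤ 3 := by
      have h8 : (2.8 : ℝ) ≤ √8 := Real.le_sqrt_of_sq_le (by norm_num)
      have : 2 / preRep p j * p = 2 * Real.pi * Real.sin (theta p j) / √8 := by
        unfold preRep; field_simp
      rw [this, div_le_iff₀ (by positivity)]
      nlinarith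
    have h4 : theta p j ^ 2 * p ≤ 0.6175 * ((j : ℝ) ^ 2 / p) := by
      have h5 : theta p j ^ 2 ≤ (Real.pi / 4 * (j / p)) ^ 2 := by
        gcongr
        exact theta_le hj hjp
      calc theta p j ^ 2 * p ≤ (Real.pi / 4 * (j / p)) ^ 2 * p := by gcongr
        _ = (Real.pi / 4) ^ 2 * ((j : ℝ) ^ 2 / p) := by field_simp
        _ ≤ _ := by
          gcongr
          have := Real.pi_lt_d4
          nlinarith
    have h6 : Real.sin (theta p j) ^ 2 ≤ theta p j ^ 2 := by
      gcongr
      exact Real.sin_le hθ.le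
    have h7 := sum_inv_dist_le p j
    have h8 : 4 * Real.sin (theta p j) ^ 2 * ∑ l ∈ (Icc 1 p).erase j, 1 / |(l : ℝ) - j| ≤
        4 * Real.sin (theta p j) ^ 2 * (p / 13 + 25) := by gcongr
    have h9 : (((Icc 1 p).erase j).card : ℝ) *
        (5 / 4 * theta p j ^ 2 + 2 / preRep p j + Real.pi / p) ≤
        p * (5 / 4 * theta p j ^ 2 + 2 / preRep p j + Real.pi / p) := by gcongr
    have h10 : p * (5 / 4 * theta p j ^ 2 + 2 / preRep p j + Real.pi / p) =
        5 / 4 * (theta p j ^ 2 * p) + 2 / preRep p j * p + Real.pi := by field_simp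
    have h11 : Real.sin (theta p j) ^ 2 * p ≤ theta p j ^ 2 * p := by gcongr
    -- the coefficient of `j²/p` is `0.6175 (5/4 + 4/13) < 1`
    have h12 : 0 ≤ (j : ℝ) ^ 2 / p := by positivity
    nlinarith
  refine (mul_le_mul (prod_linear_nodes_le hj hjp) (Real.exp_le_exp.2 hsum) (Real.exp_pos _).le
    (by have : 0 < 2 * (j : ℝ) - 1 := by linarith
        positivity)).trans (le_of_eq ?_)
  rw [mul_assoc, ← Real.exp_add, div_mul_eq_mul_div]
  congr 3
  ring

/-- The harmonic sum of the bounds on the coefficients. -/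
lemma richNorm_le (hp : 2 ≤ p) : richNorm p ≤ 12 * Real.exp 60 * Real.log p := by
  have h : ∀ j ∈ Icc 1 p, |richCoeff p j| ≤ 4 * Real.exp 60 * (j : ℝ)⁻¹ := by
    intro j hj
    rw [mem_Icc] at hj
    have hj1 : (1 : ℝ) ≤ j := by exact_mod_cast hj.1
    refine (abs_richCoeff_le hj.1 hj.2).trans ?_
    rw [div_eq_mul_inv]
    gcongr
    linarith
  have h2 : ∑ j ∈ Icc 1 p, (j : ℝ)⁻¹ ≤ 1 + Real.log p := by
    have := harmonic_le_one_add_log p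
    rw [harmonic_eq_sum_Icc] at this
    push_cast at this
    exact this
  have h3 : (1 : ℝ) / 2 ≤ Real.log p := by
    have h4 : Real.log 2 ≤ Real.log p :=
      Real.log_le_log (by norm_num) (by exact_mod_cast hp)
    linarith [Real.log_two_gt_d9]
  calc richNorm p ≤ ∑ j ∈ Icc 1 p, 4 * Real.exp 60 * (j : ℝ)⁻¹ := sum_le_sum h
    _ = 4 * Real.exp 60 * ∑ j ∈ Icc 1 p, (j : ℝ)⁻¹ := by rw [mul_sum]
    _ ≤ 4 * Real.exp 60 * (3 * Real.log p) := by
        gcongr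
        linarith
    _ = _ := by ring

lemma four_mul_div_pi_le_preRep (hp : 1 ≤ p) : 4 * p / Real.pi ≤ preRep p p := by
  have hs := sin_theta_pos hp le_rfl
  have hss := sin_theta_sq_le hp le_rfl
  have hpi0 := Real.pi_pos
  unfold preRep
  have hp0 : (0 : ℝ) < p := by exact_mod_cast hp
  rw [div_le_div_iff₀ (by positivity) (by positivity)]
  have h : 4 * Real.sin (theta p p) ≤ √8 := by
    apply Real.le_sqrt_of_sq_le
    nlinarith
  have : 0 < p * Real.pi := by positivity
  nlinarith

lemma three_le_repNum (hp : 2 ≤ p) : 3 ≤ repNum p p := by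
  have h := four_mul_div_pi_le_preRep (show 1 ≤ p by omega)
  have hp' : (2 : ℝ) ≤ p := by exact_mod_cast hp
  have : 2 < 4 * p / Real.pi := by
    rw [lt_div_iff₀ Real.pi_pos]
    linarith [Real.pi_lt_d2]
  rw [repNum_eq]
  refine Nat.succ_le_of_lt (Nat.lt_ceil.2 ?_)
  push_cast
  linarith

lemma le_repNum (hp : 1 ≤ p) : (p : ℝ) ≤ repNum p p := by
  refine le_trans ?_ ((four_mul_div_pi_le_preRep hp).trans (Nat.le_ceil _))
  have hp' : (0 : ℝ) ≤ p := by positivity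
  rw [le_div_iff₀ Real.pi_pos]
  nlinarith [Real.pi_lt_d2]

/-- The ratio of the step sizes `s_p / s_j = r_j / r_p` is at most `5p / (2j - 1)`. -/
lemma repNum_le (hp : 2 ≤ p) (hj : 1 ≤ j) (hjp : j ≤ p) :
    (repNum p j : ℝ) ≤ 5 * p * repNum p p / (2 * j - 1) := by
  have hj1 : (1 : ℝ) ≤ j := by exact_mod_cast hj
  have hjp' : (j : ℝ) ≤ p := by exact_mod_cast hjp
  have hp2 : (2 : ℝ) ≤ p := by exact_mod_cast hp
  have hj0 : 0 < 2 * (j : ℝ) - 1 := by linarith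
  have hθ := theta_pos hj hjp
  have hpi0 := Real.pi_pos
  have hs : (2 * (j : ℝ) - 1) / (4 * p) ≤ Real.sin (theta p j) := by
    have := Real.mul_le_sin hθ.le ((theta_le_pi_div_four hj hjp).trans (by linarith))
    convert this using 1
    unfold theta
    field_simp
    ring
  have hc := (Nat.ceil_lt_add_one (preRep_pos hj hjp).le).le
  rw [← repNum_eq] at hc
  -- the rounding error `1` is absorbed by `p² / (2j - 1)`
  have h8 : √8 ≤ 2.84 := by
    rw [Real.sqrt_le_left (by norm_num)]; norm_num
  have h1 : preRep p j ≤ 4 * p ^ 2 / (2 * j - 1) := by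
    unfold preRep
    calc √8 * p / (Real.pi * Real.sin (theta p j))
        ≤ 2.84 * p / (Real.pi * ((2 * (j : ℝ) - 1) / (4 * p))) := by gcongr
      _ = (2.84 / Real.pi) * (4 * p ^ 2 / (2 * j - 1)) := by field_simp
      _ ≤ 1 * (4 * p ^ 2 / (2 * j - 1)) := by
          gcongr
          rw [div_le_one hpi0]
          linarith [Real.pi_gt_three]
      _ = _ := one_mul _
  have h2 : 1 ≤ (p : ℝ) ^ 2 / (2 * j - 1) := by
    rw [le_div_iff₀ hj0]; nlinarith
  have h3 := le_repNum (show 1 ≤ p by omega)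
  calc (repNum p j : ℝ) ≤ 4 * p ^ 2 / (2 * j - 1) + (p : ℝ) ^ 2 / (2 * j - 1) := by linarith
    _ = 5 * p * p / (2 * j - 1) := by ring
    _ ≤ _ := by gcongr

/-- The Richardson coefficients are the values at `0` of the Lagrange basis at the nodes
`1 / r_j²`. -/
lemma sum_richCoeff_mul_pow {k : ℕ} (hk : k < p) :
    ∑ j ∈ Icc 1 p, richCoeff p j * ((1 / (repNum p j : ℝ)) ^ 2) ^ k = 0 ^ k := by
  have hr : ∀ j ∈ Icc 1 p, (0 : ℝ) < repNum p j := fun j hj => by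
    rw [mem_Icc] at hj
    exact_mod_cast repNum_pos hj.1 hj.2
  have hinj : Set.InjOn (fun j => (1 / (repNum p j : ℝ)) ^ 2) (Icc 1 p : Finset ℕ) := by
    intro a ha b hb hab
    have ha' := hr a ha
    have hb' := hr b hb
    have := (pow_left_inj₀ (by positivity) (by positivity) two_ne_zero).1 hab
    rw [one_div, one_div, inv_inj] at this
    exact repNum_injOn ha hb (by exact_mod_cast this)
  have hdeg : (Polynomial.X ^ k : Polynomial ℝ).degree < (Icc 1 p).card := by
    rw [Polynomial.degree_X_pow, Nat.card_Icc, Nat.add_sub_cancel]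
    exact_mod_cast hk
  have h := congrArg (Polynomial.eval 0) (Lagrange.eq_interpolate hinj hdeg)
  rw [Lagrange.interpolate_apply, Polynomial.eval_finsetSum, Polynomial.eval_pow,
    Polynomial.eval_X] at h
  rw [h]
  refine sum_congr rfl fun j hj => ?_
  rw [Polynomial.eval_mul, Polynomial.eval_C, Polynomial.eval_pow, Polynomial.eval_X, mul_comm]
  congr 1
  unfold richCoeff Lagrange.basis
  rw [Polynomial.eval_prod]
  refine prod_congr rfl fun l hl => ?_
  have hj' := hr j hj
  have hl' := hr l (mem_of_mem_erase hl)
  have hlj : (repNum p l : ℝ) ^ 2 ≠ (repNum p j : ℝ) ^ 2 := fun h => by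
    rw [pow_left_inj₀ hl'.le hj'.le two_ne_zero] at h
    exact (mem_erase.1 hl).1 (repNum_injOn (mem_of_mem_erase hl) hj (by exact_mod_cast h))
  have h1 : (repNum p j : ℝ) ^ 2 - (repNum p l : ℝ) ^ 2 ≠ 0 := sub_ne_zero.2 hlj.symm
  have h2 : (repNum p l : ℝ) ^ 2 - (repNum p j : ℝ) ^ 2 ≠ 0 := sub_ne_zero.2 hlj
  simp only [Lagrange.basisDivisor, Polynomial.eval_mul, Polynomial.eval_C, Polynomial.eval_sub,
    Polynomial.eval_X]
  rw [one_sub_div (by positivity), div_pow, div_pow, div_sub_div _ _ (by positivity) (by positivity)]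
  field_simp
  ring

end RichardsonCoefficients

end

section

open Finset MeasureTheory
open scoped ComplexOrder

/-! ### Scaling of the commutator series -/

section Scaling

/-- The series contains only powers of `τ` with exponent at least `q₀ + 1 ≥ 2`. -/
lemma weightedTail_mul_le {m : ℕ} {R : Type*} [NormedRing R] (A : Fin m → R) {q₀ : ℕ} (hq₀ : 1 ≤ q₀)
    {c τ : ℝ} (hc : 0 ≤ c) (hc1 : c ≤ 1) (hτ : 0 ≤ τ) :
    weightedTail A (fun _ => 1) q₀ (c * τ) ≤ c ^ 2 * weightedTail A (fun _ => 1) q₀ τ := by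
  have hs := fun τ (hτ : 0 ≤ τ) =>
    summable_tailTerm A (W := fun _ => 1) (fun _ => zero_le_one) (fun _ => le_rfl) q₀ (τ := τ) hτ
  rw [weightedTail, weightedTail, ← tsum_mul_left]
  refine (hs _ (by positivity)).tsum_le_tsum (fun k => ?_) ((hs τ hτ).mul_left _)
  rw [tailTerm, tailTerm, mul_left_comm, mul_sum (a := c ^ 2)]
  refine mul_le_mul_of_nonneg_left (sum_le_sum fun q hq => ?_) (by positivity)
  have h2 : 2 ≤ ∑ a, q a := le_trans (by omega) (mem_filter.1 hq).2
  rw [mul_pow, mul_left_comm]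
  exact mul_le_mul_of_nonneg_right (pow_le_pow_of_le_one hc hc1 h2)
    (mul_nonneg (weightedCommNorm_nonneg A (fun _ => zero_le_one) _) (by positivity))

end Scaling

/-! ### Nested commutators of odd grade -/

section MuComm

variable {ι : Type} [Fintype ι] [DecidableEq ι] {m : ℕ}

lemma alphaGrade_nonneg (L : Fin m → Superop ι) (q : ℕ) : 0 ≤ alphaGrade L q := by
  rw [alphaGrade_eq]
  exact gradeNorm_nonneg _ _

lemma muComm_nonneg (L : Fin m → Superop ι) (q₀ : ℕ) : 0 ≤ muComm L q₀ := by
  refine Real.sSup_nonneg ?_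
  rintro x ⟨q, -, -, -, rfl⟩
  exact Real.rpow_nonneg (alphaGrade_nonneg L q) _

lemma alphaGrade_le_muComm_pow (L : Fin m → Superop ι) {q₀ q : ℕ} (hq : Odd q) (h3 : 3 ≤ q)
    (hqq : q ≤ q₀) : alphaGrade L q ≤ muComm L q₀ ^ q := by
  have hfin : {x : ℝ | ∃ q : ℕ, 3 ≤ q ∧ q ≤ q₀ ∧ Odd q ∧
      x = alphaGrade L q ^ (1 / (q : ℝ))}.Finite := by
    refine ((Finset.finite_toSet (Icc 3 q₀)).image fun q : ℕ =>
      alphaGrade L q ^ (1 / (q : ℝ))).subset ?_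
    rintro x ⟨q, h1, h2, -, rfl⟩
    exact ⟨q, by simp [h1, h2], rfl⟩
  have h : alphaGrade L q ^ (1 / (q : ℝ)) ≤ muComm L q₀ :=
    le_csSup hfin.bddAbove ⟨q, h3, hqq, hq, rfl⟩
  have h0 := alphaGrade_nonneg L q
  calc alphaGrade L q = (alphaGrade L q ^ (1 / (q : ℝ))) ^ q := by
        rw [one_div, Real.rpow_inv_natCast_pow h0 (by omega)]
    _ ≤ _ := pow_le_pow_left₀ (Real.rpow_nonneg h0 _) h q

end MuComm

/-! ### Admissible step sizes -/

section StepSizes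

lemma maxStep_eq (p k : ℕ) : maxStep p k = 1 / (numSteps p k p : ℝ) := by
  rw [maxStep, numSteps, div_div, Nat.cast_mul]

lemma one_half_le_log {p : ℕ} (hp : 2 ≤ p) : 1 / 2 ≤ Real.log p := by
  have h4 : Real.log 2 ≤ Real.log p :=
    Real.log_le_log (by norm_num) (by exact_mod_cast hp)
  linarith [Real.log_two_gt_d9]

variable {ι : Type} [Fintype ι] [DecidableEq ι] {m : ℕ}

/-- All sufficiently small step sizes are admissible: in the second condition the left-hand side is
of second order in the step size, the right-hand side of first order. -/
lemma exists_isLeast_admissible {C : ℝ} (hC : 0 < C) (L : Fin m → Superop ι) {q₀ : ℕ}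
    (hq₀ : 1 ≤ q₀) {t ε : ℝ} (ht : 0 < t) (hε : 0 < ε) {p : ℕ} (hp : 2 ≤ p) :
    ∃ k : ℕ, IsLeast {k' : ℕ | Admissible C L q₀ t ε p k'} k := by
  suffices h : {k' : ℕ | Admissible C L q₀ t ε p k'}.Nonempty from
    ⟨_, Nat.sInf_mem h, fun _ => Nat.sInf_le⟩
  have hr : (0 : ℝ) < repNum p p := by exact_mod_cast repNum_pos (by omega : 1 ≤ p) le_rfl
  have hlog := one_half_le_log hp
  set x := ε / (4 * Real.exp 1 * C * Real.log p) with hx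
  have hx0 : 0 < x := by positivity
  set a := (2 * muComm L q₀ * t) ^ (3 / 2 : ℝ)
  set σ : ℝ := 1 / (repNum p p : ℝ) with hσ
  have hσ0 : 0 < σ := by positivity
  set α := alphaTrunc L q₀ (σ * t) with hα
  obtain ⟨k, hk⟩ := exists_nat_ge (max 1 (max (σ * a / Real.exp (-1)) (α / (σ * x))))
  have hk1 : (1 : ℝ) ≤ k := (le_max_left _ _).trans hk
  have hk2 := ((le_max_left _ _).trans (le_max_right _ _)).trans hk
  have hk3 := ((le_max_right _ _).trans (le_max_right _ _)).trans hk
  have hk0 : (0 : ℝ) < k := by linarith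
  have hs : maxStep p k = 1 / (k : ℝ) * σ := by rw [maxStep, hσ]; ring
  refine ⟨k, by exact_mod_cast hk1, ?_, ?_⟩
  · rw [hs]
    rw [div_le_iff₀ (Real.exp_pos _)] at hk2
    calc 1 / (k : ℝ) * σ * a = (σ * a) / k := by ring
      _ ≤ _ := by rw [div_le_iff₀ hk0]; linarith
  · rw [div_le_iff₀ (by positivity)] at hk3
    rw [hs, mul_div_assoc, ← hx, mul_assoc, alphaTrunc_eq L q₀ (by positivity)]
    refine (weightedTail_mul_le _ hq₀ (by positivity) (by rw [div_le_one hk0]; exact hk1)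
      (by positivity)).trans ?_
    rw [← alphaTrunc_eq L q₀ (by positivity), ← hα]
    calc (1 / (k : ℝ)) ^ 2 * α ≤ (1 / (k : ℝ)) ^ 2 * (k * (σ * x)) := by gcongr
      _ = _ := by field_simp

end StepSizes

/-! ### Accuracy of the estimate -/

section Accuracy

lemma sum_fin_add_one {M : Type*} [AddCommMonoid M] (f : ℕ → M) (p : ℕ) :
    ∑ i : Fin p, f (i + 1) = ∑ j ∈ Icc 1 p, f j := by
  rw [Fin.sum_univ_eq_sum_range (fun i => f (i + 1)), range_eq_Ico, sum_Ico_add' f 0 p 1]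
  congr 1

lemma one_le_richNorm {p : ℕ} (hp : 1 ≤ p) : 1 ≤ richNorm p := by
  have h := sum_richCoeff_mul_pow (p := p) (k := 0) (by omega)
  simp only [pow_zero, mul_one] at h
  rw [← h]
  exact sum_le_sum fun j _ => le_abs_self _

lemma sum_sq_richCoeff_le (p : ℕ) : ∑ i : Fin p, richCoeff p (i + 1) ^ 2 ≤ richNorm p ^ 2 := by
  rw [sum_fin_add_one (fun j => richCoeff p j ^ 2)]
  simp_rw [← sq_abs (richCoeff p _)]
  exact sum_sq_le_sq_sum_of_nonneg fun _ _ => abs_nonneg _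

variable {ι : Type} [Fintype ι] [DecidableEq ι] {m : ℕ}

/-- The bias of the extrapolation with exact expectation values: the remainder of the extrapolation
and the error of the truncated effective generators contribute `ε/8 ‖O‖` each. The constant `C` is
twice the one in the bound on `richNorm`. -/
lemma norm_bias_le {C : ℝ} (hC1 : 1 ≤ C) {L : Fin m → Superop ι} (hL : ∀ j, IsLindbladian (L j))
    {q₀ : ℕ} (hq₀ : 1 ≤ q₀) {t ε : ℝ} (ht : 0 < t) (hε : 0 < ε) (hε1 : ε < 1)
    (O : Matrix ι ι ℂ) {ρ : Matrix ι ι ℂ} (hρ : IsDensity ρ) {p k : ℕ} (hp : 2 ≤ p)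
    (hb : richNorm p ≤ C / 2 * Real.log p)
    (hpε : Real.exp (-2 * p) ≤ ε / (8 * C * Real.log p)) (hk : Admissible C L q₀ t ε p k) :
    ‖∑ j ∈ Icc 1 p, (richCoeff p j : ℂ) * (O * trotterState L t (numSteps p k j) ρ).trace
      - (O * superExp ((t : ℂ) • ∑ j, L j) ρ).trace‖ ≤ ε / 4 * opNorm O := by
  obtain ⟨hk1, hkμ, hkα⟩ := hk
  obtain ⟨i⟩ := nonempty_of_isDensity hρ
  have : Nonempty ι := ⟨i⟩
  have hlog := one_half_le_log hp
  have hk0 : (0 : ℝ) < k := by exact_mod_cast hk1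
  have hr0 : ∀ j ∈ Icc 1 p, (0 : ℝ) < repNum p j := fun j hj => by
    rw [mem_Icc] at hj
    exact_mod_cast repNum_pos hj.1 hj.2
  have hrp := hr0 p (by rw [mem_Icc]; omega)
  set x := ε / (4 * Real.exp 1 * C * Real.log p) with hx
  have hx0 : 0 < x := by positivity
  set σ := maxStep p k with hσ
  have hσ' : σ = 1 / ((k : ℝ) * repNum p p) := by rw [hσ, maxStep, div_div]
  have hσ0 : 0 < σ := by rw [hσ']; positivity
  have he := Real.exp_one_lt_d9
  have he0 := Real.exp_one_gt_d9
  -- `e s_p ≤ 1` since `r_p ≥ 3`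
  have hσ1 : Real.exp 1 * σ ≤ 1 := by
    have h3 : (3 : ℝ) ≤ repNum p p := by exact_mod_cast three_le_repNum hp
    have h1 : (1 : ℝ) ≤ k := by exact_mod_cast hk1
    rw [hσ', mul_one_div, div_le_one (by positivity)]
    nlinarith
  have hμ := muComm_nonneg L q₀
  -- the square of the first condition of admissibility
  have hσμ : (Real.exp 1 * σ) ^ 2 * (2 * muComm L q₀ * t) ^ 3 ≤ 1 := by
    have h0 : 0 ≤ 2 * muComm L q₀ * t := by positivity
    have h1 : (2 * muComm L q₀ * t) ^ 3 = ((2 * muComm L q₀ * t) ^ (3 / 2 : ℝ)) ^ 2 := by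
      rw [← Real.rpow_natCast _ 2, ← Real.rpow_mul h0, ← Real.rpow_natCast _ 3]
      norm_num
    have h2 : Real.exp 1 * σ * (2 * muComm L q₀ * t) ^ (3 / 2 : ℝ) ≤ 1 := by
      have := mul_le_mul_of_nonneg_left hkμ (Real.exp_pos 1).le
      rwa [← Real.exp_add, ← mul_assoc, add_neg_cancel, Real.exp_zero] at this
    rw [h1, ← mul_pow]
    exact pow_le_one₀ (by positivity) h2
  -- smaller steps: the error per step is of second order, so the sum over all steps decreases
  have hxj : ∀ j ∈ Icc 1 p, (numSteps p k j : ℝ) *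
      weightedTail (fun j => amp (L j)) (fun _ => 1) q₀ (t / (numSteps p k j : ℝ)) ≤ x := by
    intro j hj
    have hj' := mem_Icc.1 hj
    have hrj := hr0 j hj
    have hle : (repNum p p : ℝ) ≤ repNum p j := by
      exact_mod_cast repNum_le_of_le hj'.1 hj'.2 le_rfl
    set c := (repNum p p : ℝ) / repNum p j with hc
    have hc1 : c ≤ 1 := by rwa [hc, div_le_one hrj]
    have hc0 : 0 < c := by positivity
    have e : t / (numSteps p k j : ℝ) = c * (σ * t) := by
      rw [hσ', hc, numSteps, Nat.cast_mul]; field_simp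
    have h1 := weightedTail_mul_le (fun j => amp (L j)) hq₀ hc0.le hc1
      (show 0 ≤ σ * t by positivity)
    rw [← alphaTrunc_eq L q₀ (show 0 ≤ σ * t by positivity)] at h1
    rw [mul_div_assoc, ← hx] at hkα
    rw [e]
    calc _ ≤ (numSteps p k j : ℝ) * (c ^ 2 * (σ * x)) := by gcongr; exact h1.trans (by gcongr)
      _ = c * x := by rw [hσ', hc, numSteps, Nat.cast_mul]; field_simp
      _ ≤ 1 * x := by gcongr
      _ = x := one_mul x
  have hmain := norm_extrapolation_bias_le (fun j => amp (L j))
    (fun j => (hL j).ampHom.dissipative) hq₀ ht hσ0 hσ1 hμ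
    (fun q hq h3 hqq => by
      rw [← alphaGrade_eq]; exact alphaGrade_le_muComm_pow L hq h3 hqq) hσμ
    (expectation O ρ i) (norm_nonneg (mop O)) (norm_expectation_le O hρ i) (Icc 1 p)
    (richCoeff p) (numSteps p k)
    (fun j hj => by
      rw [mem_Icc] at hj
      exact Nat.mul_pos hk1 (repNum_pos hj.1 hj.2))
    (fun j hj => by
      have hj' := mem_Icc.1 hj
      have hrj := hr0 j hj
      rw [hσ', numSteps, Nat.cast_mul]
      have : (repNum p p : ℝ) ≤ repNum p j := by
        exact_mod_cast repNum_le_of_le hj'.1 hj'.2 le_rfl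
      gcongr)
    hxj (show 1 ≤ p by omega)
    (by simpa using sum_richCoeff_mul_pow (p := p) (k := 0) (by omega))
    (fun l hl hlp => by
      have h := sum_richCoeff_mul_pow (p := p) hlp
      rw [zero_pow (by omega)] at h
      calc _ = ∑ j ∈ Icc 1 p, ((1 / (k : ℝ)) ^ 2) ^ l *
            (richCoeff p j * ((1 / (repNum p j : ℝ)) ^ 2) ^ l) := by
            refine sum_congr rfl fun j _ => ?_
            rw [numSteps, Nat.cast_mul, ← one_div_mul_one_div]
            ring
        _ = 0 := by rw [← mul_sum, h, mul_zero])
  have e1 : ∀ N : ℕ, expectation O ρ i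
      (stageProd (fun j => amp (L j)) (t / N) (palindrome m) ^ N) =
      (O * trotterState L t N ρ).trace := fun N => by
    rw [← map_productFormula amp, ← map_pow, expectation_amp, trotterState]
  have e2 : expectation O ρ i (NormedSpace.exp ((t : ℂ) • ∑ j, amp (L j))) =
      (O * superExp ((t : ℂ) • ∑ j, L j) ρ).trace := by
    rw [← map_sum, ← map_smul, ← map_superExp amp, expectation_amp]
  simp only [e1, e2] at hmain
  refine hmain.trans ?_
  change richNorm p * (opNorm O * _) ≤ _
  have hO : 0 ≤ opNorm O := norm_nonneg _
  have hy0 : 0 < C * Real.log p := by positivity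
  have hx1 : x ≤ 1 := by
    rw [hx, div_le_one (by positivity)]
    nlinarith
  have hexp : Real.exp x - 1 ≤ 2 * x := by
    have := Real.abs_exp_sub_one_le (x := x) (by rwa [abs_of_pos hx0])
    rw [abs_of_pos hx0] at this
    exact (le_abs_self _).trans this
  have hfirst : Real.exp (1 / 4) * Real.exp (-2) ^ p / (1 - Real.exp (-2)) ≤
      ε / (4 * (C * Real.log p)) := by
    rw [← Real.exp_nat_mul, mul_comm (p : ℝ)]
    have h1 : Real.exp (1 / 4) ≤ 4 / 3 := by
      have h := Real.add_one_le_exp (-(1 / 4) : ℝ)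
      rw [Real.exp_neg] at h
      have h0 := Real.exp_pos (1 / 4 : ℝ)
      have h' : 3 / 4 * Real.exp (1 / 4) ≤ 1 := by
        calc 3 / 4 * Real.exp (1 / 4) ≤ (Real.exp (1 / 4))⁻¹ * Real.exp (1 / 4) := by
              gcongr
              linarith
          _ = 1 := inv_mul_cancel₀ h0.ne'
      linarith
    have h2 : Real.exp (-2) ≤ 1 / 4 := by
      rw [Real.exp_neg, inv_eq_one_div]
      refine one_div_le_one_div_of_le (by norm_num) ?_
      have : Real.exp 2 = Real.exp 1 * Real.exp 1 := by rw [← Real.exp_add]; norm_num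
      rw [this]; nlinarith
    calc Real.exp (1 / 4) * Real.exp (-2 * p) / (1 - Real.exp (-2))
        ≤ 4 / 3 * (ε / (8 * C * Real.log p)) / (1 - 1 / 4) := by gcongr
      _ ≤ 2 * (ε / (8 * C * Real.log p)) := by
        have : 0 ≤ ε / (8 * C * Real.log p) := by positivity
        rw [div_le_iff₀ (by norm_num)]
        linarith
      _ = _ := by field_simp; ring
  have hsecond : 2 * x ≤ ε / (4 * (C * Real.log p)) := by
    calc 2 * x = 2 / Real.exp 1 * (ε / (4 * (C * Real.log p))) := by rw [hx]; field_simp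
      _ ≤ 1 * (ε / (4 * (C * Real.log p))) := by
        gcongr
        rw [div_le_one (Real.exp_pos 1)]
        linarith
      _ = _ := one_mul _
  calc richNorm p * (opNorm O * (Real.exp (1 / 4) * Real.exp (-2) ^ p / (1 - Real.exp (-2)) +
        (Real.exp x - 1)))
      ≤ C / 2 * Real.log p * (opNorm O * (ε / (4 * (C * Real.log p)) +
        ε / (4 * (C * Real.log p)))) := by
        have h0 : 0 ≤ Real.exp x - 1 := by linarith [Real.add_one_le_exp x]
        have h1 : 0 < 1 - Real.exp (-2) := by
          have := Real.exp_lt_one_iff.2 (show (-2 : ℝ) < 0 by norm_num)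
          linarith
        refine mul_le_mul hb (mul_le_mul_of_nonneg_left (add_le_add hfirst
          (hexp.trans hsecond)) hO) (by positivity) (by positivity)
    _ = _ := by field_simp; ring

/-- The constant `4/3` makes the number of runs at least `16/3 (‖b‖₁ / ε)²`, which is what
Chebyshev's inequality needs for a deviation of `3ε/4`. -/
lemma four_thirds_le_log {p : ℕ} (hp : 2 ≤ p) : 4 / 3 ≤ Real.log (3 * p) := by
  have hp' : (2 : ℝ) ≤ p := by exact_mod_cast hp
  have h4 : Real.log 4 ≤ Real.log (3 * p) := Real.log_le_log (by norm_num) (by linarith)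
  have : Real.log 4 = 2 * Real.log 2 := by
    rw [show (4 : ℝ) = 2 ^ 2 by norm_num, Real.log_pow]; norm_num
  linarith [Real.log_two_gt_d9]

/-- The statistical error of the estimate is dominated by the number of runs, the bias by the
choice of the order and of the step sizes. -/
lemma two_thirds_le_outcomeLaw {C : ℝ} (hC1 : 1 ≤ C) {L : Fin m → Superop ι}
    (hL : ∀ j, IsLindbladian (L j)) {q₀ : ℕ} (hq₀ : 1 ≤ q₀) {t ε : ℝ} (ht : 0 < t) (hε : 0 < ε)
    (hε1 : ε < 1) {O : Matrix ι ι ℂ} (hO : O.IsHermitian) {ρ : Matrix ι ι ℂ} (hρ : IsDensity ρ)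
    {p k : ℕ} (hp : 2 ≤ p) (hb : richNorm p ≤ C / 2 * Real.log p)
    (hpε : Real.exp (-2 * p) ≤ ε / (8 * C * Real.log p)) (hk : Admissible C L q₀ t ε p k) :
    2 / 3 ≤ (outcomeLaw L t hO ρ p k (shots p ε)).real
      {μ | ‖((estimate p (shots p ε) μ : ℝ) : ℂ)
        - (O * superExp ((t : ℂ) • ∑ j, L j) ρ).trace‖ ≤ ε * opNorm O} := by
  have hbias := norm_bias_le hC1 hL hq₀ ht hε hε1 O hρ hp hb hpε hk
  have h1 : ∀ i : Fin p, (trotterState L t (numSteps p k (i + 1)) ρ).trace = 1 := fun i => by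
    rw [trace_trotterState hL, hρ.2]
  have h2 : ∀ i : Fin p, traceNorm (trotterState L t (numSteps p k (i + 1)) ρ) ≤ 1 :=
    fun i => traceNorm_trotterState_le hL ht.le _ hρ
  have hM : 0 ≤ opNorm O := norm_nonneg _
  have hnorm := one_le_richNorm (show 1 ≤ p by omega)
  have hlog := four_thirds_le_log hp
  have hS0 : 0 < 4 * (richNorm p ^ 2 / ε ^ 2) * Real.log (3 * p) := by positivity
  have hS : 1 ≤ shots p ε := Nat.ceil_pos.2 hS0
  have hS' : 16 / 3 * (richNorm p ^ 2 / ε ^ 2) ≤ shots p ε := by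
    refine le_trans ?_ (Nat.le_ceil _)
    have : 0 ≤ richNorm p ^ 2 / ε ^ 2 := by positivity
    nlinarith
  have hSpos : (0 : ℝ) < shots p ε := by exact_mod_cast hS
  -- the error `ε` is split into `3/4` statistical error and `1/4` bias
  have hdev := estimate_deviation hO hS (fun i : Fin p => trotterState L t (numSteps p k (i + 1)) ρ)
    h1 h2 (c := 3 / 4 * ε * opNorm O) (by positivity) (by
      have h3 : richNorm p ^ 2 / shots p ε ≤ 3 / 16 * ε ^ 2 := by
        rw [div_le_iff₀ hSpos]
        rw [mul_div_assoc', div_le_iff₀ (by positivity)] at hS'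
        linarith
      calc 3 * (opNorm O ^ 2 * (∑ i : Fin p, richCoeff p (i + 1) ^ 2) / shots p ε)
          ≤ 3 * (opNorm O ^ 2 * richNorm p ^ 2 / shots p ε) := by
            gcongr
            exact sum_sq_richCoeff_le p
        _ = 3 * opNorm O ^ 2 * (richNorm p ^ 2 / shots p ε) := by ring
        _ ≤ 3 * opNorm O ^ 2 * (3 / 16 * ε ^ 2) := by gcongr
        _ = _ := by ring)
  have hprob : ∀ ij : Fin p × Fin (shots p ε), IsProbabilityMeasure
      (measurementLaw hO (trotterState L t (numSteps p k (ij.1 + 1)) ρ)) := fun ij =>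
    isProbabilityMeasure_measurementLaw hO (h1 ij.1) (h2 ij.1)
  refine hdev.trans (measureReal_mono ?_)
  intro μ hμ
  rw [Set.mem_ofPred_eq] at hμ ⊢
  rw [sum_fin_add_one (fun j => (richCoeff p j : ℂ) *
    (O * trotterState L t (numSteps p k j) ρ).trace)] at hμ
  calc _ ≤ _ := norm_sub_le_norm_sub_add_norm_sub _ _ _
    _ ≤ 3 / 4 * ε * opNorm O + ε / 4 * opNorm O := add_le_add hμ hbias
    _ = _ := by ring

end Accuracy

end

section

open Finset

/-! ### Costs -/

section Costs

variable {C ε : ℝ}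

/-- The order of the extrapolation is logarithmic in the precision. -/
lemma exists_isExtrapolationOrder (hC : 1 ≤ C) (hε : 0 < ε) (hε1 : ε < 1) :
    ∃ p, IsExtrapolationOrder C ε p ∧
      (p : ℝ) ≤ (3 + Real.log (8 * C)) * (1 + Real.log (1 / ε)) := by
  have hlC : 0 ≤ Real.log (8 * C) := Real.log_nonneg (by linarith)
  have hlε : 0 ≤ Real.log (1 / ε) := Real.log_nonneg (by rw [le_div_iff₀ hε]; linarith)
  -- `e^{-n} ≤ ε / (8C)`, and the other factor `e^{-n}` compensates `log n`
  set n := 2 + ⌈Real.log (8 * C) + Real.log (1 / ε)⌉₊ with hn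
  have hn1 : Real.log (8 * C) + Real.log (1 / ε) ≤ n := by
    rw [hn, Nat.cast_add]
    have := Nat.le_ceil (Real.log (8 * C) + Real.log (1 / ε))
    push_cast
    linarith
  have hn2 : (n : ℝ) ≤ 3 + (Real.log (8 * C) + Real.log (1 / ε)) := by
    rw [hn, Nat.cast_add]
    have := Nat.ceil_lt_add_one (add_nonneg hlC hlε)
    push_cast
    linarith
  have hmem : n ∈ {p' : ℕ | 2 ≤ p' ∧ Real.exp (-2 * p') ≤ ε / (8 * C * Real.log p')} := by
    have h2 : 2 ≤ n := by omega
    refine ⟨h2, ?_⟩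
    have hlog := one_half_le_log h2
    have h3 : Real.log n ≤ Real.exp n := by
      have h4 := Real.log_le_sub_one_of_pos (show (0 : ℝ) < n by positivity)
      have h5 := Real.add_one_le_exp (n : ℝ)
      linarith
    have h4 : 8 * C / ε ≤ Real.exp n := by
      rw [← Real.log_le_iff_le_exp (by positivity), div_eq_mul_one_div,
        Real.log_mul (by positivity) (by positivity)]
      exact hn1
    rw [le_div_iff₀ (by positivity)]
    calc Real.exp (-2 * n) * (8 * C * Real.log n)
        = Real.exp (-2 * n) * (8 * C / ε * Real.log n) * ε := by field_simp
      _ ≤ Real.exp (-2 * n) * (Real.exp n * Real.exp n) * ε := by gcongr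
      _ = ε := by
          rw [← Real.exp_add, ← Real.exp_add, show -2 * (n : ℝ) + (n + n) = 0 by ring,
            Real.exp_zero, one_mul]
  refine ⟨_, ⟨Nat.sInf_mem ⟨n, hmem⟩, fun _ => Nat.sInf_le⟩, ?_⟩
  calc _ ≤ (n : ℝ) := by exact_mod_cast Nat.sInf_le hmem
    _ ≤ 3 + (Real.log (8 * C) + Real.log (1 / ε)) := hn2
    _ ≤ _ := by nlinarith

lemma log_le_of_le_mul {p : ℕ} (hp : 2 ≤ p) {A Λ : ℝ} (hA : 1 ≤ A) (hΛ : 1 ≤ Λ)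
    (h : (p : ℝ) ≤ A * Λ) : Real.log p ≤ (1 + Real.log A) * (1 + Real.log Λ) := by
  have h1 := Real.log_le_log (by positivity) h
  rw [Real.log_mul (by positivity) (by positivity)] at h1
  have := Real.log_nonneg hA
  have := Real.log_nonneg hΛ
  nlinarith

/-- The number of runs per step size is of order `log³ p / ε²`. -/
lemma shots_le {C₁ : ℝ} {p : ℕ} (hp : 2 ≤ p) (hb : richNorm p ≤ C₁ * Real.log p) (hε : 0 < ε)
    (hε1 : ε < 1) : (shots p ε : ℝ) ≤ (20 * C₁ ^ 2 + 8) * Real.log p ^ 3 / ε ^ 2 := by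
  have hnorm := one_le_richNorm (show 1 ≤ p by omega)
  have hlog := one_half_le_log hp
  have hlog0 : 0 < Real.log p := by linarith
  have hlog3 := four_thirds_le_log hp
  have h3 : Real.log (3 * p) ≤ 5 * Real.log p := by
    rw [Real.log_mul (by norm_num) (by positivity)]
    have := Real.log_le_sub_one_of_pos (show (0 : ℝ) < 3 by norm_num)
    linarith
  have h0 : 0 ≤ 4 * (richNorm p ^ 2 / ε ^ 2) * Real.log (3 * p) := by positivity
  have h1 : 1 ≤ 8 * Real.log p ^ 3 / ε ^ 2 := by
    rw [le_div_iff₀ (by positivity), one_mul]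
    have h4 : (1 / 2 : ℝ) ^ 3 ≤ Real.log p ^ 3 := by gcongr
    nlinarith
  calc (shots p ε : ℝ) ≤ 4 * (richNorm p ^ 2 / ε ^ 2) * Real.log (3 * p) + 1 :=
        (Nat.ceil_lt_add_one h0).le
    _ ≤ 4 * ((C₁ * Real.log p) ^ 2 / ε ^ 2) * (5 * Real.log p) + 8 * Real.log p ^ 3 / ε ^ 2 := by
        gcongr
    _ = _ := by ring

lemma sum_inv_two_mul_sub_one_le {p : ℕ} (hp : 2 ≤ p) :
    ∑ j ∈ Icc 1 p, (2 * (j : ℝ) - 1)⁻¹ ≤ 3 * Real.log p := by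
  have hlog := one_half_le_log hp
  have h2 : ∑ j ∈ Icc 1 p, (j : ℝ)⁻¹ ≤ 1 + Real.log p := by
    have := harmonic_le_one_add_log p
    rw [harmonic_eq_sum_Icc] at this
    push_cast at this
    exact this
  refine le_trans (sum_le_sum fun j hj => ?_) (h2.trans (by linarith))
  have hj1 : (1 : ℝ) ≤ j := by exact_mod_cast (mem_Icc.1 hj).1
  gcongr
  linarith

/-- The number of Trotter steps of a run, relative to the number `1 / s_p` of the shortest run. -/
lemma numSteps_le {p k j : ℕ} (hp : 2 ≤ p) (hk : 1 ≤ k) (hj : j ∈ Icc 1 p) :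
    (numSteps p k j : ℝ) ≤ 5 * p / maxStep p k * (2 * (j : ℝ) - 1)⁻¹ := by
  rw [mem_Icc] at hj
  have hk0 : (0 : ℝ) < k := by exact_mod_cast hk
  have hj1 : (1 : ℝ) ≤ j := by exact_mod_cast hj.1
  have hj0 : 0 < 2 * (j : ℝ) - 1 := by linarith
  rw [maxStep_eq, numSteps, numSteps, Nat.cast_mul, Nat.cast_mul]
  calc (k : ℝ) * repNum p j ≤ k * (5 * p * repNum p p / (2 * j - 1)) := by
        gcongr
        exact repNum_le hp hj.1 hj.2
    _ = _ := by field_simp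

/-- Summing `1 / (2j - 1)` over the step sizes gives only a logarithm. -/
lemma totalSteps_le {p k : ℕ} (hp : 2 ≤ p) (hk : 1 ≤ k) :
    (totalSteps p k ε : ℝ) ≤ 15 * p * Real.log p / maxStep p k * shots p ε := by
  have hs : 0 ≤ maxStep p k := by rw [maxStep_eq]; positivity
  rw [totalSteps, ← mul_sum, Nat.cast_mul, Nat.cast_sum, mul_comm]
  gcongr
  calc ∑ j ∈ Icc 1 p, (numSteps p k j : ℝ)
      ≤ ∑ j ∈ Icc 1 p, 5 * p / maxStep p k * (2 * (j : ℝ) - 1)⁻¹ :=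
        sum_le_sum fun j hj => numSteps_le hp hk hj
    _ = 5 * p / maxStep p k * ∑ j ∈ Icc 1 p, (2 * (j : ℝ) - 1)⁻¹ := by rw [mul_sum]
    _ ≤ 5 * p / maxStep p k * (3 * Real.log p) := by
        gcongr
        exact sum_inv_two_mul_sub_one_le hp
    _ = _ := by ring

end Costs

end

end Lindblad

end

open Lindblad in
theorem theorem3 :
    ∃ C : ℝ, 0 < C ∧ (∀ p : ℕ, 2 ≤ p → richNorm p ≤ C * Real.log p) ∧
    ∃ K : ℝ, 0 < K ∧
    ∀ (n m : ℕ) (L : Fin m → Superop (Fin n)) (_ : ∀ j, IsLindbladian (L j))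
      (q₀ : ℕ) (_ : 1 ≤ q₀) (t : ℝ) (_ : 0 < t) (ε : ℝ) (_ : 0 < ε) (_ : ε < 1)
      (O : Matrix (Fin n) (Fin n) ℂ) (hO : O.IsHermitian)
      (ρ₀ : Matrix (Fin n) (Fin n) ℂ) (_ : IsDensity ρ₀),
    ∃ p : ℕ, IsExtrapolationOrder C ε p ∧ (p : ℝ) ≤ K * (1 + Real.log (1 / ε)) ∧
      (∃ k : ℕ, IsLeast {k' : ℕ | Admissible C L q₀ t ε p k'} k) ∧
      ∀ k : ℕ, Admissible C L q₀ t ε p k →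
        2 / 3 ≤ (outcomeLaw L t hO ρ₀ p k (shots p ε)).real
          {μ | ‖((estimate p (shots p ε) μ : ℝ) : ℂ)
              - (O * superExp ((t : ℂ) • ∑ j, L j) ρ₀).trace‖ ≤ ε * opNorm O} ∧
        (totalRuns p ε : ℝ) ≤ K * (1 + Real.log (1 / ε))
          * (1 + Real.log (1 + Real.log (1 / ε))) ^ 3 / ε ^ 2 ∧
        (∀ j ∈ Finset.Icc 1 p,
          (numSteps p k j : ℝ) ≤ K * (1 + Real.log (1 / ε)) / maxStep p k) ∧
        (totalSteps p k ε : ℝ) ≤ K * (1 + Real.log (1 / ε))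
          * (1 + Real.log (1 + Real.log (1 / ε))) ^ 4 / (ε ^ 2 * maxStep p k) := by
  set C₁ : ℝ := 12 * Real.exp 60 with hC₁
  have hC₁1 : 1 ≤ C₁ := by linarith [Real.add_one_le_exp (60 : ℝ)]
  have hb : ∀ p : ℕ, 2 ≤ p → richNorm p ≤ C₁ * Real.log p := fun p hp => richNorm_le hp
  set Kp : ℝ := 3 + Real.log (8 * (2 * C₁)) with hKp
  have hKp1 : 1 ≤ Kp := by linarith [Real.log_nonneg (show 1 ≤ 8 * (2 * C₁) by linarith)]
  set Kl : ℝ := 1 + Real.log Kp with hKl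
  have hKl1 : 1 ≤ Kl := by linarith [Real.log_nonneg hKp1]
  set Ks : ℝ := (20 * C₁ ^ 2 + 8) * Kl ^ 3 with hKs
  have hKs1 : 1 ≤ Ks := one_le_mul_of_one_le_of_one_le (by nlinarith) (one_le_pow₀ hKl1)
  -- the constant of the total cost exceeds all the others
  have hK1 : Kp ≤ 15 * Kp * Ks * Kl := by
    have : 1 ≤ Ks * Kl := one_le_mul_of_one_le_of_one_le hKs1 hKl1
    nlinarith
  have hK2 : Kp * Ks ≤ 15 * Kp * Ks * Kl := by
    have : 0 < Kp * Ks := by positivity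
    nlinarith
  have hK3 : 5 * Kp ≤ 15 * Kp * Ks * Kl := by
    have : 1 ≤ Ks * Kl := one_le_mul_of_one_le_of_one_le hKs1 hKl1
    nlinarith
  -- twice the constant for `‖b‖₁`, which leaves the bias at a quarter of the error
  refine ⟨2 * C₁, by positivity, fun p hp => (hb p hp).trans ?_, 15 * Kp * Ks * Kl, by positivity,
    ?_⟩
  · have := one_half_le_log hp
    gcongr
    linarith
  intro n m L hL q₀ hq₀ t ht ε hε hε1 O hO ρ₀ hρ₀
  obtain ⟨p, hpo, hpK⟩ := exists_isExtrapolationOrder (C := 2 * C₁) (by linarith) hε hε1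
  have hp2 : 2 ≤ p := hpo.1.1
  set Λ := 1 + Real.log (1 / ε) with hΛ
  have hΛ1 : 1 ≤ Λ := by
    have := Real.log_nonneg (show 1 ≤ 1 / ε by rw [le_div_iff₀ hε]; linarith)
    linarith
  have hY1 : 0 ≤ Real.log Λ := Real.log_nonneg hΛ1
  have hlog := log_le_of_le_mul hp2 hKp1 hΛ1 hpK
  have hlog0 := one_half_le_log hp2
  have hS : (shots p ε : ℝ) ≤ Ks * (1 + Real.log Λ) ^ 3 / ε ^ 2 := by
    refine (shots_le hp2 (hb p hp2) hε hε1).trans ?_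
    calc _ ≤ (20 * C₁ ^ 2 + 8) * (Kl * (1 + Real.log Λ)) ^ 3 / ε ^ 2 := by gcongr
      _ = _ := by rw [hKs]; ring
  refine ⟨p, hpo, hpK.trans (by gcongr), exists_isLeast_admissible (by positivity) L hq₀ ht hε hp2,
    fun k hk => ⟨?_, ?_, fun j hj => ?_, ?_⟩⟩
  · refine two_thirds_le_outcomeLaw (by linarith) hL hq₀ ht hε hε1 hO hρ₀ hp2 ?_ hpo.1.2 hk
    rw [mul_div_cancel_left₀ _ two_ne_zero]
    exact hb p hp2
  · rw [totalRuns, Nat.cast_mul]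
    calc (p : ℝ) * shots p ε ≤ Kp * Λ * (Ks * (1 + Real.log Λ) ^ 3 / ε ^ 2) := by gcongr
      _ = Kp * Ks * Λ * (1 + Real.log Λ) ^ 3 / ε ^ 2 := by ring
      _ ≤ _ := by gcongr
  · have hs : 0 ≤ maxStep p k := by rw [maxStep_eq]; positivity
    have hj1 : (1 : ℝ) ≤ j := by exact_mod_cast (Finset.mem_Icc.1 hj).1
    have hinv : (2 * (j : ℝ) - 1)⁻¹ ≤ 1 := inv_le_one_of_one_le₀ (by linarith)
    refine (numSteps_le hp2 hk.1 hj).trans ?_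
    calc 5 * p / maxStep p k * (2 * (j : ℝ) - 1)⁻¹ ≤ 5 * (Kp * Λ) / maxStep p k * 1 := by
          refine mul_le_mul ?_ hinv (inv_nonneg.2 (by linarith)) (by positivity)
          gcongr
      _ = 5 * Kp * Λ / maxStep p k := by ring
      _ ≤ _ := by gcongr
  · have hs : 0 ≤ maxStep p k := by rw [maxStep_eq]; positivity
    refine (totalSteps_le hp2 hk.1).trans ?_
    calc 15 * p * Real.log p / maxStep p k * shots p ε
        ≤ 15 * (Kp * Λ) * (Kl * (1 + Real.log Λ)) / maxStep p k *
          (Ks * (1 + Real.log Λ) ^ 3 / ε ^ 2) := by gcongr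
      _ = _ := by
          rw [div_mul_div_comm, mul_comm (maxStep p k)]
          congr 1
          ring
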